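/- Let $f_1,f_2,f_3$ be a basis (Milnor frame) of the Lie algebra $\mathfrak{sl}(2,\mathbb R)$ with $[f_2,f_3]=-2f_1$, $[f_3,f_1]=2f_2$, $[f_1,f_2]=2f_3$, with dual basis $f^1,f^2,f^3$. Left-invariant Riemannian metrics on $\mathrm{SL}(2,\mathbb R)$ are identified with inner products on $\mathfrak{sl}(2,\mathbb R)$. Let $Q=\{(a,b,c)\in\mathbb R^3: a>0,\ b>c>0\}$. For $(a,b,c)\in Q$ consider the maximal solution $g(t)$, $t\in(-T_b,T_f)$, among left-invariant metrics, of the normalized Ricci flow $$\frac{\partial g}{\partial t}=-2\,\mathrm{Rc}+\tfrac23 R\,g,\qquad g(0)=a\,f^1\otimes f^1+b\,f^2\otimes f^2+c\,f^3\otimes f^3 .$$ Then $g(t)=A(t)f^1\otimes f^1+B(t)f^2\otimes f^2+C(t)f^3\otimes f^3$ for all $t$. Put $\kappa=\frac{\sqrt6}{4}\sqrt{abc/4}$ (so $\kappa=\frac{\sqrt6}{4}$ under the normalization $abc=4$), and consider the following behaviors as $t\downarrow -T_b$, each of which includes the assertion $0<T_b<\infty$: 1. $A\sim\kappa(t+T_b)^{-1/2}$,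 $B\sim\eta_2(t+T_b)^{1/4}$, $C\sim\eta_3(t+T_b)^{1/4}$ for some $\eta_2,\eta_3\in(0,\infty)$; 2. $A\sim\eta_1(t+T_b)^{1/4}$, $B\sim\kappa(t+T_b)^{-1/2}$, $C\sim\eta_3(t+T_b)^{1/4}$ for some $\eta_1,\eta_3\in(0,\infty)$; 3. $A\sim B\sim\kappa(t+T_b)^{-1/2}$, $C\sim\frac{32}{3}(t+T_b)$. There is an open dense subset $Q_0$ of $Q$ such that for every initial condition in $Q_0$ the maximal solution behaves as in (1) or as in (2). In fact, let $Q_1$ (resp. $Q_2$) be the set of initial conditions in $Q$ for which (1) (resp. (2)) occurs. Then there is a $C^\infty$ embedded hypersurface $S_0\subset Q$, invariant under multiplication by positive scalars, such that $Q_1$ and $Q_2$ are open and are the two connected components of $Q\setminus S_0$; and for every initial condition in $S_0$ behavior (3) occurs. -/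

import Mathlib

open Filter Topology Asymptotics
open scoped ContDiff

noncomputable section

/-- A left-invariant Riemannian metric on a Lie group, given by the inner product that it induces
on the Lie algebra. -/
@[ext]
structure LeftInvariantMetric (𝔤 : Type*) [LieRing 𝔤] [LieAlgebra ℝ 𝔤] where
  form : LinearMap.BilinForm ℝ 𝔤
  symm : ∀ X Y, form X Y = form Y X
  pos : ∀ X, X ≠ 0 → 0 < form X X

namespace LeftInvariantMetric

variable {𝔤 : Type*} [LieRing 𝔤] [LieAlgebra ℝ 𝔤]

theorem nondegenerate (g : LeftInvariantMetric 𝔤) : g.form.Nondegenerate := by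
  refine ⟨fun X hX => ?_, fun X hX => ?_⟩ <;>
  · by_contra h
    exact (g.pos X h).ne' (hX X)

/-- The Koszul form of a left-invariant metric: on left-invariant vector fields
`2 g(∇_X Y, Z) = g([X,Y],Z) - g([Y,Z],X) + g([Z,X],Y)`. -/
def koszul (g : LeftInvariantMetric 𝔤) : 𝔤 →ₗ[ℝ] 𝔤 →ₗ[ℝ] Module.Dual ℝ 𝔤 :=
  LinearMap.mk₂ ℝ
    (fun X Y =>
      { toFun := fun Z => (1 / 2) * (g.form ⁅X, Y⁆ Z - g.form ⁅Y, Z⁆ X + g.form ⁅Z, X⁆ Y)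
        map_add' := by intro Z Z'; simp; ring
        map_smul' := by intro r Z; simp; ring })
    (by intro X X' Y; ext Z; simp; ring)
    (by intro r X Y; ext Z; simp; ring)
    (by intro X Y Y'; ext Z; simp; ring)
    (by intro r X Y; ext Z; simp; ring)

variable [FiniteDimensional ℝ 𝔤]

/-- The Levi-Civita connection on left-invariant vector fields: `g.leviCivita X Y` is `∇_X Y`,
the vector that represents the Koszul form. -/
def leviCivita (g : LeftInvariantMetric 𝔤) : 𝔤 →ₗ[ℝ] 𝔤 →ₗ[ℝ] 𝔤 :=
  g.koszul.compr₂ (g.form.toDual g.nondegenerate).symm.toLinearMap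

/-- The Riemann curvature `R(X,Y)Z = ∇_X ∇_Y Z - ∇_Y ∇_X Z - ∇_[X,Y] Z`. -/
def curvature (g : LeftInvariantMetric 𝔤) (X Y Z : 𝔤) : 𝔤 :=
  g.leviCivita X (g.leviCivita Y Z) - g.leviCivita Y (g.leviCivita X Z) - g.leviCivita ⁅X, Y⁆ Z

/-- The endomorphism `X ↦ R(X,Y)Z`. -/
def curvatureEnd (g : LeftInvariantMetric 𝔤) (Y Z : 𝔤) : 𝔤 →ₗ[ℝ] 𝔤 where
  toFun X := g.curvature X Y Z
  map_add' := by intro X X'; simp [curvature]; abel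
  map_smul' := by intro r X; simp [curvature, smul_sub]

/-- The Ricci tensor `Rc(Y,Z) = tr (X ↦ R(X,Y)Z)`. -/
def ricci (g : LeftInvariantMetric 𝔤) : LinearMap.BilinForm ℝ 𝔤 :=
  LinearMap.mk₂ ℝ (fun Y Z => LinearMap.trace ℝ 𝔤 (g.curvatureEnd Y Z))
    (by
      intro Y Y' Z
      rw [← map_add]; congr 1; ext X
      simp [curvatureEnd, curvature]; abel)
    (by
      intro r Y Z
      rw [← map_smul]; congr 1; ext X
      simp [curvatureEnd, curvature, smul_sub])
    (by
      intro Y Z Z'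
      rw [← map_add]; congr 1; ext X
      simp [curvatureEnd, curvature]; abel)
    (by
      intro r Y Z
      rw [← map_smul]; congr 1; ext X
      simp [curvatureEnd, curvature, smul_sub])

/-- The scalar curvature, the trace of the Ricci tensor with respect to the metric. -/
def scalarCurvature (g : LeftInvariantMetric 𝔤) : ℝ :=
  LinearMap.trace ℝ 𝔤 ((g.form.toDual g.nondegenerate).symm.toLinearMap ∘ₗ g.ricci)

end LeftInvariantMetric

/-- The normalized Ricci flow `∂g/∂t = -2 Rc + (2/3) R g` (in dimension three) for
left-invariant metrics, on a set `I` of times. -/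
def IsNormalizedRicciFlowOn {𝔤 : Type*} [LieRing 𝔤] [LieAlgebra ℝ 𝔤] [FiniteDimensional ℝ 𝔤]
    (g : ℝ → LeftInvariantMetric 𝔤) (I : Set ℝ) : Prop :=
  ∀ t ∈ I, ∀ X Y : 𝔤, HasDerivAt (fun s => (g s).form X Y)
    (-2 * (g t).ricci X Y + (2 / 3) * (g t).scalarCurvature * (g t).form X Y) t

/-- `g` is a maximal solution of the normalized Ricci flow, with open interval of existence
`I ∋ 0` (the values of `g` outside `I` are irrelevant). -/
structure IsMaximalNormalizedRicciFlow {𝔤 : Type*} [LieRing 𝔤] [LieAlgebra ℝ 𝔤]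
    [FiniteDimensional ℝ 𝔤] (g : ℝ → LeftInvariantMetric 𝔤) (I : Set ℝ) : Prop where
  isOpen : IsOpen I
  ordConnected : I.OrdConnected
  zero_mem : (0 : ℝ) ∈ I
  isFlow : IsNormalizedRicciFlowOn g I
  maximal : ∀ (h : ℝ → LeftInvariantMetric 𝔤) (J : Set ℝ), IsOpen J → J.OrdConnected → I ⊆ J →
    IsNormalizedRicciFlowOn h J → (∀ t ∈ I, h t = g t) → J = I

/-- The Lie algebra of `SL(2,ℝ)`: real two by two matrices of trace zero. -/
abbrev SL2Alg : Type := LieAlgebra.SpecialLinear.sl (Fin 2) ℝ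

/-- A basis `f₁, f₂, f₃` (indexed by `0, 1, 2`) of the Lie algebra of `SL(2,ℝ)` with
`[f₂,f₃] = -2 f₁`, `[f₃,f₁] = 2 f₂`, `[f₁,f₂] = 2 f₃`. -/
structure IsMilnorFrame (f : Module.Basis (Fin 3) ℝ SL2Alg) : Prop where
  bracket_12 : ⁅f 1, f 2⁆ = (-2 : ℝ) • f 0
  bracket_20 : ⁅f 2, f 0⁆ = (2 : ℝ) • f 1
  bracket_01 : ⁅f 0, f 1⁆ = (2 : ℝ) • f 2

/-- The parameter set `Q = {(a,b,c) : a > 0, b > c > 0}`. -/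
def initialSet : Set (Fin 3 → ℝ) := {x | 0 < x 0 ∧ x 2 < x 1 ∧ 0 < x 2}

/-- `g`, `I` is a maximal solution of the normalized Ricci flow whose initial metric is
`x₀ f¹⊗f¹ + x₁ f²⊗f² + x₂ f³⊗f³`. -/
def IsMaximalFlowFrom (f : Module.Basis (Fin 3) ℝ SL2Alg) (x : Fin 3 → ℝ)
    (g : ℝ → LeftInvariantMetric SL2Alg) (I : Set ℝ) : Prop :=
  IsMaximalNormalizedRicciFlow g I ∧ ∀ i j, (g 0).form (f i) (f j) = if i = j then x i else 0

/-- `T_b` is finite, `-T_b` being the left endpoint of `I`, and as `t ↓ -T_b` the coefficients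
`A, B, C` of `g` in the frame `f` are asymptotic to `u₀(t+T_b)`, `u₁(t+T_b)`, `u₂(t+T_b)`. -/
def BackwardAsymptotics (f : Module.Basis (Fin 3) ℝ SL2Alg) (g : ℝ → LeftInvariantMetric SL2Alg)
    (I : Set ℝ) (u : Fin 3 → ℝ → ℝ) : Prop :=
  ∃ Tb : ℝ, 0 < Tb ∧ IsGLB I (-Tb) ∧
    ∀ i, (fun t => (g t).form (f i) (f i)) ~[𝓝[>] (-Tb)] (fun t => u i (t + Tb))

/-- The coefficient of `(t+T_b)^{-1/2}` for initial metric `x`; it is `√6/4` if the (conserved)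
product `x₀ x₁ x₂` is normalized to be `4`. -/
def blowupConstant (x : Fin 3 → ℝ) : ℝ := √6 / 4 * √(x 0 * x 1 * x 2 / 4)

def BackwardCase1 (f : Module.Basis (Fin 3) ℝ SL2Alg) (x : Fin 3 → ℝ)
    (g : ℝ → LeftInvariantMetric SL2Alg) (I : Set ℝ) : Prop :=
  ∃ η₂ η₃ : ℝ, 0 < η₂ ∧ 0 < η₃ ∧ BackwardAsymptotics f g I
    ![fun τ => blowupConstant x * τ ^ (-1 / 2 : ℝ),
      fun τ => η₂ * τ ^ (1 / 4 : ℝ),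
      fun τ => η₃ * τ ^ (1 / 4 : ℝ)]

def BackwardCase2 (f : Module.Basis (Fin 3) ℝ SL2Alg) (x : Fin 3 → ℝ)
    (g : ℝ → LeftInvariantMetric SL2Alg) (I : Set ℝ) : Prop :=
  ∃ η₁ η₃ : ℝ, 0 < η₁ ∧ 0 < η₃ ∧ BackwardAsymptotics f g I
    ![fun τ => η₁ * τ ^ (1 / 4 : ℝ),
      fun τ => blowupConstant x * τ ^ (-1 / 2 : ℝ),
      fun τ => η₃ * τ ^ (1 / 4 : ℝ)]

def BackwardCase3 (f : Module.Basis (Fin 3) ℝ SL2Alg) (x : Fin 3 → ℝ)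
    (g : ℝ → LeftInvariantMetric SL2Alg) (I : Set ℝ) : Prop :=
  BackwardAsymptotics f g I
    ![fun τ => blowupConstant x * τ ^ (-1 / 2 : ℝ),
      fun τ => blowupConstant x * τ ^ (-1 / 2 : ℝ),
      fun τ => 32 / 3 * τ]

/-- The initial conditions in `Q` for which the behavior `P` occurs: there is a maximal solution,
and every maximal solution has the property `P`. -/
def initialSetOf (f : Module.Basis (Fin 3) ℝ SL2Alg)
    (P : (Fin 3 → ℝ) → (ℝ → LeftInvariantMetric SL2Alg) → Set ℝ → Prop) : Set (Fin 3 → ℝ) :=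
  {x | x ∈ initialSet ∧ (∃ g I, IsMaximalFlowFrom f x g I) ∧
    ∀ g I, IsMaximalFlowFrom f x g I → P x g I}

/-- `S` is a smooth embedded hypersurface: near each of its points it is the zero set of a
smooth function with nowhere vanishing differential. -/
def IsSmoothEmbeddedHypersurface {E : Type*} [NormedAddCommGroup E] [NormedSpace ℝ E]
    (S : Set E) : Prop :=
  ∀ p ∈ S, ∃ U : Set E, IsOpen U ∧ p ∈ U ∧ ∃ F : E → ℝ, ContDiffOn ℝ ∞ F U ∧
    (∀ x ∈ U, fderiv ℝ F x ≠ 0) ∧ S ∩ U = {x ∈ U | F x = 0}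

/-- `U₁` and `U₂` are the two connected components of `U`. -/
def AreTheTwoComponents {X : Type*} [TopologicalSpace X] (U U₁ U₂ : Set X) : Prop :=
  U₁ ≠ U₂ ∧ (fun x => connectedComponentIn U x) '' U = {U₁, U₂}

end

/-! In the Gram coordinates of a frame the flow is an ODE whose field is C¹ on invertible matrices,
so solutions are unique. The half-turns about the frame axes are automorphisms of the Lie algebra
and fix a diagonal initial metric. By uniqueness the metric stays diagonal. Only A, B, C remain;
their product P is conserved and B - C stays positive. With K = 8/(3P), each logarithmic derivative
is -K times a quadratic form.

The orbits are governed by the scale-invariant ratios z = A/B and w = C/B. In the variable σ =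
log(w/(1-w)), which increases with t, they are the graphs of solutions of dz/dσ = -`orbitSlope w z`.
The strip 1-w ≤ z ≤ 1 is invariant as σ increases, its width w tends to 0 as σ → -∞, and solutions
inside it approach each other. Solutions started on z = 1 at σ = -n therefore converge to a smooth
solution H that lies in the strip for all σ (`exists_separatrix`). The hypersurface is the cone A =
B·H(log(C/(B-C))).

The difference z - H satisfies a linear equation with nonpositive rate (`deriv_dist_separatrix`), so
backward in time its sign persists and its size does not decrease. An orbit that stays in the strip
has w → 0 and z → 1 (`strip_asymptotics`). If z > H initially, this would contradict z + w ≥ 1 + δ,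
so A > B at some time. If z < H, it would contradict z ≤ 1 - δ, so B > A + C at some time. If z = H,
the orbit stays in the strip, and C follows from ABC = P.

Once one coefficient X dominates, `dominant_asymptotics` applies. The function X⁻² has derivative
comparable to a constant, which gives a finite blow-up time and the exact rate. The ratio of the
other two coefficients has a positive limit, and the conserved product then determines both up to
constants. The three behaviors are mutually exclusive, so the sign of `coneFunction` identifies the
sets Q₁ and Q₂ exactly. -/

noncomputable section

/-! ### Curvature of a left-invariant metric in a basis -/

section Coordinates

/-- The entries of the inverse of a three by three matrix. -/
def invGram (G : Fin 3 → Fin 3 → ℝ) (i j : Fin 3) : ℝ :=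
  (Matrix.of G).det⁻¹ * (Matrix.of G).adjugate i j

/-- Christoffel symbols of the metric `G` in a basis with structure constants `c`. -/
def christoffel (c : Fin 3 → Fin 3 → Fin 3 → ℝ) (G : Fin 3 → Fin 3 → ℝ) (i j k : Fin 3) : ℝ :=
  ∑ l, invGram G k l *
    ((1 / 2) * ((∑ m, c i j m * G m l) - (∑ m, c j l m * G m i) + ∑ m, c l i m * G m j))

/-- Components of the Ricci tensor in a basis with structure constants `c`. -/
def ricciCoord (c : Fin 3 → Fin 3 → Fin 3 → ℝ) (G : Fin 3 → Fin 3 → ℝ) (j k : Fin 3) : ℝ :=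
  ∑ i, ((∑ m, christoffel c G j k m * christoffel c G i m i) -
    (∑ m, christoffel c G i k m * christoffel c G j m i) - ∑ m, c i j m * christoffel c G m k i)

/-- The scalar curvature in a basis with structure constants `c`. -/
def scalarCoord (c : Fin 3 → Fin 3 → Fin 3 → ℝ) (G : Fin 3 → Fin 3 → ℝ) : ℝ :=
  ∑ j, ∑ l, invGram G j l * ricciCoord c G j l

/-- The vector field of the normalized Ricci flow in a basis with structure constants `c`. -/
def flowField (c : Fin 3 → Fin 3 → Fin 3 → ℝ) (G : Fin 3 → Fin 3 → ℝ) : Fin 3 → Fin 3 → ℝ :=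
  fun i j => -2 * ricciCoord c G i j + (2 / 3) * scalarCoord c G * G i j

theorem contDiffAt_invGram {G : Fin 3 → Fin 3 → ℝ} (hG : (Matrix.of G).det ≠ 0) (i j : Fin 3) :
    ContDiffAt ℝ 1 (fun G => invGram G i j) G := by
  unfold invGram
  have h1 : ContDiffAt ℝ 1 (fun G : Fin 3 → Fin 3 → ℝ => (Matrix.of G).det) G := by
    simp only [Matrix.det_fin_three, Matrix.of_apply]
    fun_prop
  refine (h1.inv hG).mul ?_
  simp only [Matrix.adjugate_fin_three, Matrix.of_apply]
  fin_cases i <;> fin_cases j <;> simp <;> fun_prop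

theorem contDiffAt_christoffel (c : Fin 3 → Fin 3 → Fin 3 → ℝ) {G : Fin 3 → Fin 3 → ℝ}
    (hG : (Matrix.of G).det ≠ 0) (i j k : Fin 3) :
    ContDiffAt ℝ 1 (fun G => christoffel c G i j k) G := by
  unfold christoffel
  refine ContDiffAt.sum fun l _ => (contDiffAt_invGram hG k l).mul ?_
  fun_prop

theorem contDiffAt_ricciCoord (c : Fin 3 → Fin 3 → Fin 3 → ℝ) {G : Fin 3 → Fin 3 → ℝ}
    (hG : (Matrix.of G).det ≠ 0) (j k : Fin 3) :
    ContDiffAt ℝ 1 (fun G => ricciCoord c G j k) G := by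
  unfold ricciCoord
  have h := contDiffAt_christoffel c hG
  refine ContDiffAt.sum fun i _ => ((ContDiffAt.sum fun m _ => (h _ _ _).mul (h _ _ _)).sub
    (ContDiffAt.sum fun m _ => (h _ _ _).mul (h _ _ _))).sub
    (ContDiffAt.sum fun m _ => contDiffAt_const.mul (h _ _ _))

theorem contDiffAt_flowField (c : Fin 3 → Fin 3 → Fin 3 → ℝ) {G : Fin 3 → Fin 3 → ℝ}
    (hG : (Matrix.of G).det ≠ 0) : ContDiffAt ℝ 1 (flowField c) G := by
  refine contDiffAt_pi.2 fun i => contDiffAt_pi.2 fun j => ?_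
  unfold flowField scalarCoord
  have h := contDiffAt_ricciCoord c hG
  have h' := contDiffAt_invGram hG
  refine (contDiffAt_const.mul (h i j)).add ((contDiffAt_const.mul
    (ContDiffAt.sum fun j _ => ContDiffAt.sum fun l _ => (h' j l).mul (h j l))).mul ?_)
  fun_prop

end Coordinates

namespace LeftInvariantMetric

variable {𝔤 : Type*} [LieRing 𝔤] [LieAlgebra ℝ 𝔤]

/-- The matrix of the metric in a basis. -/
def gram (g : LeftInvariantMetric 𝔤) (f : Module.Basis (Fin 3) ℝ 𝔤) : Fin 3 → Fin 3 → ℝ :=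
  fun i j => g.form (f i) (f j)

/-- The structure constants of a Lie algebra in a basis. -/
def _root_.structureConstants (f : Module.Basis (Fin 3) ℝ 𝔤) : Fin 3 → Fin 3 → Fin 3 → ℝ :=
  fun i j k => f.repr ⁅f i, f j⁆ k

theorem ext_gram (f : Module.Basis (Fin 3) ℝ 𝔤) {g h : LeftInvariantMetric 𝔤}
    (H : g.gram f = h.gram f) : g = h := by
  apply LeftInvariantMetric.ext
  exact LinearMap.BilinForm.ext_basis f fun i j => congrFun (congrFun H i) j

theorem det_gram_ne_zero (g : LeftInvariantMetric 𝔤) (f : Module.Basis (Fin 3) ℝ 𝔤) :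
    (Matrix.of (g.gram f)).det ≠ 0 := by
  have h := (LinearMap.BilinForm.nondegenerate_iff_det_ne_zero f).1 g.nondegenerate
  convert h using 2
  ext i j
  simp [gram, LinearMap.BilinForm.toMatrix_apply]

theorem invGram_mul_gram (g : LeftInvariantMetric 𝔤) (f : Module.Basis (Fin 3) ℝ 𝔤) (k l : Fin 3) :
    ∑ m, g.gram f k m * invGram (g.gram f) m l = if k = l then 1 else 0 := by
  have h := Matrix.mul_nonsing_inv (Matrix.of (g.gram f)) (isUnit_iff_ne_zero.2 (g.det_gram_ne_zero f))
  have h2 := congrFun (congrFun h k) l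
  rw [Matrix.mul_apply, Matrix.one_apply] at h2
  rw [← h2]
  simp [invGram, Matrix.inv_def]

theorem gram_symm (g : LeftInvariantMetric 𝔤) (f : Module.Basis (Fin 3) ℝ 𝔤) (i j : Fin 3) :
    g.gram f i j = g.gram f j i := g.symm _ _

theorem _root_.Module.Basis.linearMap_apply_eq_sum {W : Type*} [AddCommGroup W] [Module ℝ W]
    (f : Module.Basis (Fin 3) ℝ 𝔤) (φ : 𝔤 →ₗ[ℝ] W) (X : 𝔤) :
    φ X = ∑ m, f.repr X m • φ (f m) := by
  conv_lhs => rw [← f.sum_repr X, map_sum]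
  simp only [map_smul]

theorem form_bracket (g : LeftInvariantMetric 𝔤) (f : Module.Basis (Fin 3) ℝ 𝔤) (i j l : Fin 3) :
    g.form ⁅f i, f j⁆ (f l) = ∑ m, structureConstants f i j m * g.gram f m l := by
  rw [f.linearMap_apply_eq_sum g.form, LinearMap.sum_apply]
  rfl

variable [FiniteDimensional ℝ 𝔤]

theorem repr_toDual_symm (g : LeftInvariantMetric 𝔤) (f : Module.Basis (Fin 3) ℝ 𝔤)
    (φ : Module.Dual ℝ 𝔤) (k : Fin 3) :
    f.repr ((g.form.toDual g.nondegenerate).symm φ) k = ∑ l, invGram (g.gram f) k l * φ (f l) := by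
  have h : (g.form.toDual g.nondegenerate).symm φ =
      ∑ k, (∑ l, invGram (g.gram f) k l * φ (f l)) • f k := by
    rw [LinearEquiv.symm_apply_eq]
    refine f.ext fun i => ?_
    rw [LinearMap.BilinForm.toDual_def, map_sum, LinearMap.sum_apply]
    have : ∀ k, g.form ((∑ l, invGram (g.gram f) k l * φ (f l)) • f k) (f i) =
        ∑ l, (g.gram f i k * invGram (g.gram f) k l) * φ (f l) := by
      intro k
      rw [gram_symm, map_smul, LinearMap.smul_apply, smul_eq_mul, Finset.sum_mul]
      refine Finset.sum_congr rfl fun l _ => ?_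
      simp only [gram]; ring
    simp_rw [this]
    rw [Finset.sum_comm]
    simp_rw [← Finset.sum_mul, invGram_mul_gram]
    simp
  rw [h]
  simp [Finsupp.single_apply]

theorem repr_leviCivita (g : LeftInvariantMetric 𝔤) (f : Module.Basis (Fin 3) ℝ 𝔤) (i j k : Fin 3) :
    f.repr (g.leviCivita (f i) (f j)) k =
      christoffel (structureConstants f) (g.gram f) i j k := by
  have : g.leviCivita (f i) (f j) =
    (g.form.toDual g.nondegenerate).symm (g.koszul (f i) (f j)) := rfl
  rw [this, repr_toDual_symm, christoffel]
  refine Finset.sum_congr rfl fun l _ => ?_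
  congr 1
  simp only [koszul, LinearMap.mk₂_apply, LinearMap.coe_mk, AddHom.coe_mk, form_bracket]

theorem repr_leviCivita_right (g : LeftInvariantMetric 𝔤) (f : Module.Basis (Fin 3) ℝ 𝔤)
    (i k : Fin 3) (X : 𝔤) :
    f.repr (g.leviCivita (f i) X) k =
      ∑ m, f.repr X m * christoffel (structureConstants f) (g.gram f) i m k := by
  rw [f.linearMap_apply_eq_sum (g.leviCivita (f i)), map_sum, Finsupp.finsetSum_apply]
  simp only [map_smul, Finsupp.smul_apply, repr_leviCivita, smul_eq_mul]

theorem repr_leviCivita_left (g : LeftInvariantMetric 𝔤) (f : Module.Basis (Fin 3) ℝ 𝔤)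
    (j k : Fin 3) (X : 𝔤) :
    f.repr (g.leviCivita X (f j)) k =
      ∑ m, f.repr X m * christoffel (structureConstants f) (g.gram f) m j k := by
  rw [f.linearMap_apply_eq_sum g.leviCivita, LinearMap.sum_apply, map_sum, Finsupp.finsetSum_apply]
  simp only [LinearMap.smul_apply, map_smul, Finsupp.smul_apply, repr_leviCivita, smul_eq_mul]

theorem ricci_apply_basis (g : LeftInvariantMetric 𝔤) (f : Module.Basis (Fin 3) ℝ 𝔤) (j k : Fin 3) :
    g.ricci (f j) (f k) = ricciCoord (structureConstants f) (g.gram f) j k := by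
  rw [ricci, LinearMap.mk₂_apply, LinearMap.trace_eq_matrix_trace ℝ f, Matrix.trace, ricciCoord]
  refine Finset.sum_congr rfl fun i _ => ?_
  rw [Matrix.diag_apply, LinearMap.toMatrix_apply]
  change f.repr (g.curvature (f i) (f j) (f k)) i = _
  rw [curvature, map_sub, map_sub, Finsupp.sub_apply, Finsupp.sub_apply, repr_leviCivita_left,
    repr_leviCivita_right, repr_leviCivita_right]
  simp only [repr_leviCivita]
  rfl

theorem scalarCurvature_eq (g : LeftInvariantMetric 𝔤) (f : Module.Basis (Fin 3) ℝ 𝔤) :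
    g.scalarCurvature = scalarCoord (structureConstants f) (g.gram f) := by
  rw [scalarCurvature, LinearMap.trace_eq_matrix_trace ℝ f, Matrix.trace, scalarCoord]
  refine Finset.sum_congr rfl fun i _ => ?_
  rw [Matrix.diag_apply, LinearMap.toMatrix_apply]
  change f.repr ((g.form.toDual g.nondegenerate).symm (g.ricci (f i))) i = _
  simp only [repr_toDual_symm, ricci_apply_basis]

/-- Bilinearity reduces the flow to basis vectors. The result is an autonomous ODE for the Gram
matrix, to which uniqueness theorems apply. -/
theorem _root_.isNormalizedRicciFlowOn_iff (f : Module.Basis (Fin 3) ℝ 𝔤)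
    (g : ℝ → LeftInvariantMetric 𝔤) (I : Set ℝ) :
    IsNormalizedRicciFlowOn g I ↔ ∀ t ∈ I, HasDerivAt (fun s => (g s).gram f)
      (flowField (structureConstants f) ((g t).gram f)) t := by
  constructor
  · intro h t ht
    refine hasDerivAt_pi.2 fun i => hasDerivAt_pi.2 fun j => ?_
    have := h t ht (f i) (f j)
    rwa [ricci_apply_basis, scalarCurvature_eq _ f] at this
  · intro h t ht X Y
    have h1 : ∀ i j, HasDerivAt (fun s => (g s).form (f i) (f j))
        (-2 * (g t).ricci (f i) (f j) + (2 / 3) * (g t).scalarCurvature * (g t).form (f i) (f j))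
        t := by
      intro i j
      rw [ricci_apply_basis, scalarCurvature_eq _ f]
      exact hasDerivAt_pi.1 (hasDerivAt_pi.1 (h t ht) i) j
    have h2 : ∀ B : LinearMap.BilinForm ℝ 𝔤, B X Y =
        ∑ i, ∑ j, f.repr X i * (f.repr Y j * B (f i) (f j)) := by
      intro B
      rw [f.linearMap_apply_eq_sum B, LinearMap.sum_apply]
      refine Finset.sum_congr rfl fun i _ => ?_
      rw [LinearMap.smul_apply, f.linearMap_apply_eq_sum (B (f i)), smul_eq_mul, Finset.mul_sum]
      rfl
    have h3 := HasDerivAt.fun_sum (u := Finset.univ) fun i _ => HasDerivAt.fun_sum (u := Finset.univ)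
      fun j _ => ((h1 i j).const_mul (f.repr Y j)).const_mul (f.repr X i)
    rw [h2 (g t).ricci, h2 (g t).form, funext fun s => h2 (g s).form]
    refine h3.congr_deriv ?_
    simp only [Finset.mul_sum, ← Finset.sum_add_distrib]
    refine Finset.sum_congr rfl fun i _ => Finset.sum_congr rfl fun j _ => ?_
    ring

end LeftInvariantMetric

/-! ### General facts on ordinary differential equations -/

section ODEGeneral

/-- The set of times near which the curves coincide is open, and it is relatively closed in `J`
because local uniqueness applies wherever they meet. Regularity of `v` is needed only along `α`,
since at a meeting point `β` has the same value. -/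
theorem eqOn_of_hasDerivAt_of_contDiffAt {E : Type*} [NormedAddCommGroup E] [NormedSpace ℝ E]
    {v : E → E} {α β : ℝ → E} {J : Set ℝ} (hJ : IsOpen J) (hJ' : J.OrdConnected)
    (hα : ∀ t ∈ J, HasDerivAt α (v (α t)) t) (hβ : ∀ t ∈ J, HasDerivAt β (v (β t)) t)
    (hv : ∀ t ∈ J, ContDiffAt ℝ 1 v (α t)) {t₁ : ℝ} (ht₁ : t₁ ∈ J) (h : α t₁ = β t₁) :
    Set.EqOn α β J := by
  have key : ∀ t ∈ J, α t = β t → α =ᶠ[𝓝 t] β := by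
    intro t ht hab
    obtain ⟨K, s, hs, hL⟩ := (hv t ht).exists_lipschitzOnWith
    have hJt := hJ.mem_nhds ht
    refine ODE_solution_unique_of_eventually (v := fun _ => v) (s := fun _ => s) (K := K)
      (Eventually.of_forall fun _ => hL) ?_ ?_ hab
    · filter_upwards [hJt, (hα t ht).continuousAt.preimage_mem_nhds hs] with r hr hr'
      exact ⟨hα r hr, hr'⟩
    · rw [hab] at hs
      filter_upwards [hJt, (hβ t ht).continuousAt.preimage_mem_nhds hs] with r hr hr'
      exact ⟨hβ r hr, hr'⟩
  have hsub : J ⊆ {t | α =ᶠ[𝓝 t] β} := by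
    refine hJ'.isPreconnected.subset_of_closure_inter_subset isOpen_setOfPred_eventually_nhds
      ⟨t₁, ht₁, key t₁ ht₁ h⟩ ?_
    rintro t ⟨htc, ht⟩
    refine key t ht ?_
    have : ∃ᶠ r in 𝓝 t, α r = β r :=
      (mem_closure_iff_frequently.1 htc).mono fun r hr => hr.self_of_nhds
    have hc := ((hα t ht).continuousAt.sub (hβ t ht).continuousAt)
    by_contra hne
    have h0 : α t - β t ≠ 0 := sub_ne_zero.2 hne
    have := this.and_eventually (hc.eventually_ne h0)
    obtain ⟨r, h1, h2⟩ := this.exists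
    exact h2 (sub_eq_zero.2 h1)
  exact fun t ht => (hsub ht).self_of_nhds

theorem exists_hasDerivAt_of_continuousOn {k : ℝ → ℝ} {I : Set ℝ} (hI : IsOpen I)
    (hI' : I.OrdConnected) (hk : ContinuousOn k I) : ∃ K : ℝ → ℝ, ∀ t ∈ I, HasDerivAt K (k t) t := by
  rcases I.eq_empty_or_nonempty with rfl | ⟨t₁, h₁⟩
  · exact ⟨0, by simp⟩
  refine ⟨fun t => ∫ r in t₁..t, k r, fun t ht => ?_⟩
  refine intervalIntegral.integral_hasDerivAt_right ?_
    (hk.stronglyMeasurableAtFilter hI t ht) (hk.continuousAt (hI.mem_nhds ht))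
  exact (hk.mono (hI'.uIcc_subset h₁ ht)).intervalIntegrable

/-- Backward positivity for the linear differential inequality `y' ≤ k y`. -/
theorem pos_of_deriv_le_mul {y y' k : ℝ → ℝ} {I : Set ℝ} (hI : IsOpen I) (hI' : I.OrdConnected)
    (hk : ContinuousOn k I) (hy : ∀ t ∈ I, HasDerivAt y (y' t) t)
    {t t₁ : ℝ} (ht : t ∈ I) (ht₁ : t₁ ∈ I) (htt : t ≤ t₁)
    (hle : ∀ r ∈ I, r ≤ t₁ → y' r ≤ k r * y r) (h : 0 < y t₁) : 0 < y t := by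
  obtain ⟨K, hK⟩ := exists_hasDerivAt_of_continuousOn hI hI' hk
  have hsub : Set.Icc t t₁ ⊆ I := hI'.out ht ht₁
  have hd : ∀ r ∈ I, HasDerivAt (fun r => y r * Real.exp (-K r))
      (y' r * Real.exp (-K r) + y r * (Real.exp (-K r) * (-k r))) r :=
    fun r hr => (hy r hr).mul (hK r hr).neg.exp
  have hanti : AntitoneOn (fun r => y r * Real.exp (-K r)) (Set.Icc t t₁) := by
    refine antitoneOn_of_deriv_nonpos (convex_Icc _ _)
      (fun r hr => (hd r (hsub hr)).continuousAt.continuousWithinAt)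
      (fun r hr => (hd r (hsub (interior_subset hr))).differentiableAt.differentiableWithinAt) ?_
    intro r hr
    have hr' := interior_subset hr
    rw [(hd r (hsub hr')).deriv]
    nlinarith [hle r (hsub hr') hr'.2, Real.exp_pos (-K r)]
  have := hanti (Set.left_mem_Icc.2 htt) (Set.right_mem_Icc.2 htt) htt
  have h2 : 0 < y t₁ * Real.exp (-K t₁) := by positivity
  have h3 : 0 < y t * Real.exp (-K t) := lt_of_lt_of_le h2 this
  exact pos_of_mul_pos_left h3 (Real.exp_pos _).le

/-- Multiplying by the integrating factor exp(-∫k) leaves a constant. Hence a solution of a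
homogeneous linear equation either keeps its sign or vanishes identically. -/
theorem mul_exp_const_of_hasDerivAt {y k : ℝ → ℝ} {I : Set ℝ} (hI : IsOpen I) (hI' : I.OrdConnected)
    (hk : ContinuousOn k I) (hy : ∀ t ∈ I, HasDerivAt y (k t * y t) t) :
    ∃ e : ℝ → ℝ, (∀ t, 0 < e t) ∧ ∃ c, ∀ t ∈ I, y t = c * e t := by
  obtain ⟨K, hK⟩ := exists_hasDerivAt_of_continuousOn hI hI' hk
  have hd : ∀ r ∈ I, HasDerivAt (fun r => y r * Real.exp (-K r)) 0 r := by
    intro r hr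
    refine ((hy r hr).mul (hK r hr).neg.exp).congr_deriv ?_
    ring
  obtain ⟨c, hc⟩ := hI.exists_is_const_of_deriv_eq_zero hI'.isPreconnected
    (fun r hr => (hd r hr).differentiableAt.differentiableWithinAt) (fun r hr => (hd r hr).deriv)
  refine ⟨fun t => Real.exp (K t), fun t => Real.exp_pos _, c, fun t ht => ?_⟩
  rw [← hc t ht, mul_assoc, ← Real.exp_add]
  simp

theorem pos_of_hasDerivAt_mul {y k : ℝ → ℝ} {I : Set ℝ} (hI : IsOpen I) (hI' : I.OrdConnected)
    (hk : ContinuousOn k I) (hy : ∀ t ∈ I, HasDerivAt y (k t * y t) t)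
    {t₁ : ℝ} (ht₁ : t₁ ∈ I) (h : 0 < y t₁) : ∀ t ∈ I, 0 < y t := by
  obtain ⟨e, he, c, hc⟩ := mul_exp_const_of_hasDerivAt hI hI' hk hy
  have hc0 : 0 < c := by
    rw [hc t₁ ht₁] at h
    exact pos_of_mul_pos_left h (he _).le
  intro t ht
  rw [hc t ht]
  exact mul_pos hc0 (he t)

theorem zero_of_hasDerivAt_mul {y k : ℝ → ℝ} {I : Set ℝ} (hI : IsOpen I) (hI' : I.OrdConnected)
    (hk : ContinuousOn k I) (hy : ∀ t ∈ I, HasDerivAt y (k t * y t) t)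
    {t₁ : ℝ} (ht₁ : t₁ ∈ I) (h : y t₁ = 0) : ∀ t ∈ I, y t = 0 := by
  obtain ⟨e, he, c, hc⟩ := mul_exp_const_of_hasDerivAt hI hI' hk hy
  have hc0 : c = 0 := by
    rw [hc t₁ ht₁] at h
    exact (mul_eq_zero.1 h).resolve_right (he _).ne'
  intro t ht
  rw [hc t ht, hc0, zero_mul]

end ODEGeneral

/-! ### Uniqueness and gluing of flows -/

section Uniqueness

variable {𝔤 : Type*} [LieRing 𝔤] [LieAlgebra ℝ 𝔤] [FiniteDimensional ℝ 𝔤]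

theorem IsNormalizedRicciFlowOn.eqOn (f : Module.Basis (Fin 3) ℝ 𝔤)
    {g h : ℝ → LeftInvariantMetric 𝔤} {J : Set ℝ} (hJ : IsOpen J) (hJ' : J.OrdConnected)
    (hg : IsNormalizedRicciFlowOn g J) (hh : IsNormalizedRicciFlowOn h J) {t₁ : ℝ} (ht₁ : t₁ ∈ J)
    (heq : g t₁ = h t₁) : Set.EqOn g h J := by
  have := eqOn_of_hasDerivAt_of_contDiffAt hJ hJ' ((isNormalizedRicciFlowOn_iff f g J).1 hg)
    ((isNormalizedRicciFlowOn_iff f h J).1 hh)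
    (fun t _ => contDiffAt_flowField _ ((g t).det_gram_ne_zero f)) ht₁ (by rw [heq])
  exact fun t ht => LeftInvariantMetric.ext_gram f (this ht)

theorem IsNormalizedRicciFlowOn.mono {g : ℝ → LeftInvariantMetric 𝔤} {I J : Set ℝ}
    (hg : IsNormalizedRicciFlowOn g J) (h : I ⊆ J) : IsNormalizedRicciFlowOn g I :=
  fun t ht => hg t (h ht)

theorem IsNormalizedRicciFlowOn.congr_of_eventuallyEq {g h : ℝ → LeftInvariantMetric 𝔤} {t : ℝ}
    (hg : IsNormalizedRicciFlowOn g {t}) (H : h =ᶠ[𝓝 t] g) : IsNormalizedRicciFlowOn h {t} := by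
  intro r hr X Y
  rw [Set.mem_singleton_iff.1 hr, H.self_of_nhds]
  exact (hg t rfl X Y).congr_of_eventuallyEq (H.mono fun s hs => by simp only [hs])

/-- By uniqueness the two flows agree on the overlap of their intervals, so they glue to a flow on
the union, which maximality forces to be `I`. -/
theorem IsMaximalNormalizedRicciFlow.subset (f : Module.Basis (Fin 3) ℝ 𝔤)
    {g h : ℝ → LeftInvariantMetric 𝔤} {I J : Set ℝ} (hg : IsMaximalNormalizedRicciFlow g I)
    (hJ : IsOpen J) (hJ' : J.OrdConnected) (hh : IsNormalizedRicciFlowOn h J) {t₁ : ℝ}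
    (hI₁ : t₁ ∈ I) (hJ₁ : t₁ ∈ J) (heq : h t₁ = g t₁) : J ⊆ I := by
  classical
  have hEq : Set.EqOn g h (I ∩ J) := IsNormalizedRicciFlowOn.eqOn f (hg.isOpen.inter hJ)
    (hg.ordConnected.inter hJ') (hg.isFlow.mono Set.inter_subset_left)
    (hh.mono Set.inter_subset_right) ⟨hI₁, hJ₁⟩ heq.symm
  let k : ℝ → LeftInvariantMetric 𝔤 := fun t => if t ∈ I then g t else h t
  have hkI : ∀ t ∈ I, k t = g t := fun t ht => if_pos ht
  have hkJ : ∀ t ∈ J, k t = h t := by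
    intro t ht
    by_cases hI : t ∈ I
    · rw [hkI t hI, hEq ⟨hI, ht⟩]
    · exact if_neg hI
  have hflow : IsNormalizedRicciFlowOn k (I ∪ J) := by
    rintro t (ht | ht)
    · exact IsNormalizedRicciFlowOn.congr_of_eventuallyEq (hg.isFlow.mono (by simpa using ht))
        (by filter_upwards [hg.isOpen.mem_nhds ht] using hkI) t rfl
    · exact IsNormalizedRicciFlowOn.congr_of_eventuallyEq (hh.mono (by simpa using ht))
        (by filter_upwards [hJ.mem_nhds ht] using hkJ) t rfl
  have hconn : (I ∪ J).OrdConnected :=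
    (hg.ordConnected.isPreconnected.union t₁ hI₁ hJ₁ hJ'.isPreconnected).ordConnected
  have := hg.maximal k (I ∪ J) (hg.isOpen.union hJ) hconn Set.subset_union_left hflow hkI
  exact Set.union_eq_left.1 this

/-- A local flow extends to a maximal one. -/
theorem exists_isMaximalNormalizedRicciFlow (f : Module.Basis (Fin 3) ℝ 𝔤)
    {h₀ : ℝ → LeftInvariantMetric 𝔤} {J₀ : Set ℝ} (hJ₀ : IsOpen J₀) (hJ₀' : J₀.OrdConnected)
    (h0 : (0 : ℝ) ∈ J₀) (hh₀ : IsNormalizedRicciFlowOn h₀ J₀) :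
    ∃ g I, IsMaximalNormalizedRicciFlow g I ∧ g 0 = h₀ 0 := by
  classical
  let P : Set ℝ → (ℝ → LeftInvariantMetric 𝔤) → Prop := fun J h =>
    IsOpen J ∧ J.OrdConnected ∧ (0 : ℝ) ∈ J ∧ IsNormalizedRicciFlowOn h J ∧ h 0 = h₀ 0
  -- Zorn's lemma is not needed: flows with the same metric at time 0 agree on overlaps, so the
  -- union of all their intervals carries a single flow.
  let I : Set ℝ := ⋃₀ {J | ∃ h, P J h}
  have hI : ∀ t : ℝ, ∃ h : ℝ → LeftInvariantMetric 𝔤, t ∈ I → ∃ J, t ∈ J ∧ P J h := by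
    intro t
    by_cases ht : t ∈ I
    · obtain ⟨J, ⟨h, hP⟩, htJ⟩ := ht
      exact ⟨h, fun _ => ⟨J, htJ, hP⟩⟩
    · exact ⟨h₀, fun h => absurd h ht⟩
  choose H hH using hI
  let g : ℝ → LeftInvariantMetric 𝔤 := fun t => H t t
  have hsub : ∀ J h, P J h → J ⊆ I := fun J h hP => Set.subset_sUnion_of_mem ⟨h, hP⟩
  have hg : ∀ J h, P J h → ∀ t ∈ J, g t = h t := by
    intro J h hP t ht
    obtain ⟨J', ht', hP'⟩ := hH t (hsub J h hP ht)
    have := IsNormalizedRicciFlowOn.eqOn f (hP'.1.inter hP.1) (hP'.2.1.inter hP.2.1)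
      (hP'.2.2.2.1.mono Set.inter_subset_left) (hP.2.2.2.1.mono Set.inter_subset_right)
      ⟨hP'.2.2.1, hP.2.2.1⟩ (by rw [hP'.2.2.2.2, hP.2.2.2.2])
    exact this ⟨ht', ht⟩
  have hP₀ : P J₀ h₀ := ⟨hJ₀, hJ₀', h0, hh₀, rfl⟩
  have h0I : (0 : ℝ) ∈ I := hsub _ _ hP₀ h0
  have hflow : IsNormalizedRicciFlowOn g I := by
    intro t ht
    obtain ⟨J, htJ, hP⟩ := hH t ht
    exact IsNormalizedRicciFlowOn.congr_of_eventuallyEq (hP.2.2.2.1.mono (by simpa using htJ))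
        (by filter_upwards [hP.1.mem_nhds htJ] using hg _ _ hP) t rfl
  refine ⟨g, I, ⟨isOpen_sUnion ?_, ?_, h0I, hflow, ?_⟩, hg _ _ hP₀ 0 h0⟩
  · rintro J ⟨h, hP⟩
    exact hP.1
  · refine (isPreconnected_sUnion 0 _ ?_ ?_).ordConnected
    · rintro J ⟨h, hP⟩
      exact hP.2.2.1
    · rintro J ⟨h, hP⟩
      exact hP.2.1.isPreconnected
  · intro h J hJ hJ' hIJ hh heq
    refine Set.Subset.antisymm (hsub J h ⟨hJ, hJ', hIJ h0I, hh, ?_⟩) hIJ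
    rw [heq 0 h0I, hg _ _ hP₀ 0 h0]

end Uniqueness

/-! ### The flow in a Milnor frame -/

section Milnor

/-- The structure constants of a Milnor frame. -/
def milnorConstants : Fin 3 → Fin 3 → Fin 3 → ℝ :=
  ![![0, ![0, 0, 2], ![0, -2, 0]], ![![0, 0, -2], 0, ![-2, 0, 0]], ![![0, 2, 0], ![2, 0, 0], 0]]

theorem IsMilnorFrame.structureConstants_eq {f : Module.Basis (Fin 3) ℝ SL2Alg}
    (hf : IsMilnorFrame f) : structureConstants f = milnorConstants := by
  have h10 : ⁅f 1, f 0⁆ = (-2 : ℝ) • f 2 := by rw [← lie_skew, hf.bracket_01, neg_smul]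
  have h21 : ⁅f 2, f 1⁆ = (2 : ℝ) • f 0 := by rw [← lie_skew, hf.bracket_12, neg_smul, neg_neg]
  have h02 : ⁅f 0, f 2⁆ = (-2 : ℝ) • f 1 := by rw [← lie_skew, hf.bracket_20, neg_smul]
  funext i j k
  fin_cases i <;> fin_cases j <;>
    simp [structureConstants, milnorConstants, h10, h21, h02, hf.bracket_01, hf.bracket_12,
      hf.bracket_20] <;> fin_cases k <;> simp

/-- Conjugation of a matrix by a diagonal matrix of signs. -/
def signFlip (s : Fin 3 → ℝ) (G : Fin 3 → Fin 3 → ℝ) : Fin 3 → Fin 3 → ℝ :=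
  fun i j => s i * s j * G i j

theorem invGram_signFlip {s : Fin 3 → ℝ} (hs : ∀ i, s i = 1 ∨ s i = -1)
    (G : Fin 3 → Fin 3 → ℝ) (i j : Fin 3) :
    invGram (signFlip s G) i j = s i * s j * invGram G i j := by
  have hdet : (Matrix.of (signFlip s G)).det = (Matrix.of G).det := by
    simp only [Matrix.det_fin_three, Matrix.of_apply, signFlip]
    rcases hs 0 with h0 | h0 <;> rcases hs 1 with h1 | h1 <;> rcases hs 2 with h2 | h2 <;>
      rw [h0, h1, h2] <;> ring
  rw [invGram, invGram, hdet]
  have hadj : (Matrix.of (signFlip s G)).adjugate i j =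
      s i * s j * (Matrix.of G).adjugate i j := by
    simp only [Matrix.adjugate_fin_three, Matrix.of_apply, signFlip]
    rcases hs 0 with h0 | h0 <;> rcases hs 1 with h1 | h1 <;> rcases hs 2 with h2 | h2 <;>
      fin_cases i <;> fin_cases j <;> simp [h0, h1, h2] <;> ring
  rw [hadj]
  ring

variable {c : Fin 3 → Fin 3 → Fin 3 → ℝ} {s : Fin 3 → ℝ}

/-- The condition `hc` says that diag(s) is a Lie algebra automorphism. Curvature is natural under
automorphisms, so each index of a tensor or connection symbol contributes one sign. -/
theorem christoffel_signFlip (hs : ∀ i, s i = 1 ∨ s i = -1)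
    (hc : ∀ i j k, c i j k * s k = s i * s j * c i j k) (G : Fin 3 → Fin 3 → ℝ) (i j k : Fin 3) :
    christoffel c (signFlip s G) i j k = s i * s j * s k * christoffel c G i j k := by
  have hs2 : ∀ i, s i * s i = 1 := fun i => by rcases hs i with h | h <;> rw [h] <;> norm_num
  have key : ∀ i j l, ∑ m, c i j m * signFlip s G m l = s i * s j * s l * ∑ m, c i j m * G m l := by
    intro i j l
    rw [Finset.mul_sum]
    refine Finset.sum_congr rfl fun m _ => ?_
    rw [signFlip]
    linear_combination (s l * G m l) * hc i j m
  rw [christoffel, christoffel, Finset.mul_sum]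
  refine Finset.sum_congr rfl fun l _ => ?_
  rw [key, key, key, invGram_signFlip hs]
  linear_combination (s i * s j * s k * (invGram G k l *
    ((1 / 2) * ((∑ m, c i j m * G m l) - (∑ m, c j l m * G m i) + ∑ m, c l i m * G m j)))) * hs2 l

theorem ricciCoord_signFlip (hs : ∀ i, s i = 1 ∨ s i = -1)
    (hc : ∀ i j k, c i j k * s k = s i * s j * c i j k) (G : Fin 3 → Fin 3 → ℝ) (j k : Fin 3) :
    ricciCoord c (signFlip s G) j k = s j * s k * ricciCoord c G j k := by
  have hs2 : ∀ i, s i * s i = 1 := fun i => by rcases hs i with h | h <;> rw [h] <;> norm_num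
  rw [ricciCoord, ricciCoord, Finset.mul_sum]
  refine Finset.sum_congr rfl fun i _ => ?_
  rw [mul_sub, mul_sub, Finset.mul_sum, Finset.mul_sum, Finset.mul_sum]
  simp only [christoffel_signFlip hs hc]
  congr 1
  · congr 1
    · refine Finset.sum_congr rfl fun m _ => ?_
      linear_combination (s j * s k * christoffel c G j k m * christoffel c G i m i) *
        (s i * s i * hs2 m + hs2 i)
    · refine Finset.sum_congr rfl fun m _ => ?_
      linear_combination (s j * s k * christoffel c G i k m * christoffel c G j m i) *
        (s i * s i * hs2 m + hs2 i)
  · refine Finset.sum_congr rfl fun m _ => ?_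
    linear_combination (s k * s i * christoffel c G m k i) * hc i j m +
      (s j * s k * c i j m * christoffel c G m k i) * hs2 i

theorem flowField_signFlip (hs : ∀ i, s i = 1 ∨ s i = -1)
    (hc : ∀ i j k, c i j k * s k = s i * s j * c i j k) (G : Fin 3 → Fin 3 → ℝ) :
    flowField c (signFlip s G) = signFlip s (flowField c G) := by
  have hs2 : ∀ i, s i * s i = 1 := fun i => by rcases hs i with h | h <;> rw [h] <;> norm_num
  have hsc : scalarCoord c (signFlip s G) = scalarCoord c G := by
    rw [scalarCoord, scalarCoord]
    refine Finset.sum_congr rfl fun j _ => Finset.sum_congr rfl fun l _ => ?_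
    rw [ricciCoord_signFlip hs hc, invGram_signFlip hs]
    linear_combination (invGram G j l * ricciCoord c G j l) * (s j * s j * hs2 l + hs2 j)
  funext i j
  rw [flowField, hsc, ricciCoord_signFlip hs hc, signFlip, signFlip, flowField]
  ring

/-- The diagonal matrix with given entries. -/
def diagGram (d : Fin 3 → ℝ) : Fin 3 → Fin 3 → ℝ := fun i j => if i = j then d i else 0

/-- The polynomial vector field that, for `P = d₀ d₁ d₂`, is the normalized Ricci flow of the
diagonal metric with entries `d`. -/
def polyField (P : ℝ) (d : Fin 3 → ℝ) : Fin 3 → ℝ :=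
  ![-(8 / (3 * P)) * (2 * d 0 ^ 2 + d 0 * d 1 + d 0 * d 2 - (d 1 - d 2) ^ 2) * d 0,
    -(8 / (3 * P)) * (2 * d 1 ^ 2 + d 0 * d 1 - d 1 * d 2 - (d 0 + d 2) ^ 2) * d 1,
    -(8 / (3 * P)) * (2 * d 2 ^ 2 + d 0 * d 2 - d 1 * d 2 - (d 0 + d 1) ^ 2) * d 2]

theorem invGram_diagGram {d : Fin 3 → ℝ} (hd : ∀ i, d i ≠ 0) :
    invGram (diagGram d) = diagGram (fun i => (d i)⁻¹) := by
  have h0 := hd 0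
  have h1 := hd 1
  have h2 := hd 2
  funext i j
  fin_cases i <;> fin_cases j <;>
    simp [invGram, diagGram, Matrix.adjugate_fin_three, Matrix.det_fin_three] <;> field_simp

theorem ricciCoord_diagGram {d : Fin 3 → ℝ} (hd : ∀ i, d i ≠ 0) :
    ricciCoord milnorConstants (diagGram d) = diagGram
      ![2 * (d 0 ^ 2 - (d 1 - d 2) ^ 2) / (d 1 * d 2), -2 * ((d 0 + d 2) ^ 2 - d 1 ^ 2) / (d 0 * d 2),
        -2 * ((d 0 + d 1) ^ 2 - d 2 ^ 2) / (d 0 * d 1)] := by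
  have h0 := hd 0
  have h1 := hd 1
  have h2 := hd 2
  -- For a diagonal metric in a Milnor frame only the symbols with three distinct indices survive.
  have hΓ : christoffel milnorConstants (diagGram d) =
      ![![![0, 0, 0], ![0, 0, (d 2 + d 0 + d 1) / d 2], ![0, -(d 0 + d 1 + d 2) / d 1, 0]],
        ![![0, 0, (d 0 + d 1 - d 2) / d 2], ![0, 0, 0], ![(d 2 - d 0 - d 1) / d 0, 0, 0]],
        ![![0, (d 1 - d 0 - d 2) / d 1, 0], ![(d 0 + d 2 - d 1) / d 0, 0, 0], ![0, 0, 0]]] := by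
    funext i j k
    fin_cases i <;> fin_cases j <;> fin_cases k <;>
      simp [christoffel, invGram_diagGram hd, diagGram, milnorConstants] <;>
      field_simp <;> ring
  funext i j
  rw [ricciCoord, hΓ]
  fin_cases i <;> fin_cases j <;>
    simp [Fin.sum_univ_three, diagGram, milnorConstants] <;> field_simp <;> ring

theorem flowField_diagGram {d : Fin 3 → ℝ} (hd : ∀ i, d i ≠ 0) :
    flowField milnorConstants (diagGram d) = diagGram (polyField (d 0 * d 1 * d 2) d) := by
  have h0 := hd 0
  have h1 := hd 1
  have h2 := hd 2
  have hs : scalarCoord milnorConstants (diagGram d) =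
      -2 * (d 0 ^ 2 + d 1 ^ 2 + d 2 ^ 2 - 2 * d 1 * d 2 + 2 * d 0 * d 2 + 2 * d 0 * d 1) /
        (d 0 * d 1 * d 2) := by
    simp only [scalarCoord, ricciCoord_diagGram hd, invGram_diagGram hd, Fin.sum_univ_three, diagGram]
    simp
    field_simp
    ring
  funext i j
  rw [flowField, hs, ricciCoord_diagGram hd]
  fin_cases i <;> fin_cases j <;> simp [diagGram, polyField] <;> field_simp <;> ring

end Milnor

/-! ### Diagonal flows -/

section Diagonal

/-- The diagonal metric with coefficients `d` (non-positive coefficients being replaced by `1`). -/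
def diagMetric {𝔤 : Type*} [LieRing 𝔤] [LieAlgebra ℝ 𝔤] (f : Module.Basis (Fin 3) ℝ 𝔤)
    (d : Fin 3 → ℝ) : LeftInvariantMetric 𝔤 where
  form := LinearMap.mk₂ ℝ
    (fun X Y => ∑ i, (if 0 < d i then d i else 1) * (f.repr X i * f.repr Y i))
    (by intro X X' Y; rw [← Finset.sum_add_distrib]
        exact Finset.sum_congr rfl fun i _ => by rw [map_add, Finsupp.add_apply]; ring)
    (by intro r X Y; rw [Finset.smul_sum]
        exact Finset.sum_congr rfl fun i _ => by
          rw [map_smul, Finsupp.smul_apply, smul_eq_mul, smul_eq_mul]; ring)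
    (by intro X X' Y; rw [← Finset.sum_add_distrib]
        exact Finset.sum_congr rfl fun i _ => by rw [map_add, Finsupp.add_apply]; ring)
    (by intro r X Y; rw [Finset.smul_sum]
        exact Finset.sum_congr rfl fun i _ => by
          rw [map_smul, Finsupp.smul_apply, smul_eq_mul, smul_eq_mul]; ring)
  symm X Y := by
    simp only [LinearMap.mk₂_apply]
    exact Finset.sum_congr rfl fun i _ => by ring
  pos X hX := by
    simp only [LinearMap.mk₂_apply]
    have hpos : ∀ i, 0 < (if 0 < d i then d i else 1) := fun i => by split_ifs with h <;> simp [h]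
    obtain ⟨i, hi⟩ : ∃ i, f.repr X i ≠ 0 := by
      by_contra! h
      exact hX (f.repr.map_eq_zero_iff.1 (Finsupp.ext h))
    exact Finset.sum_pos' (fun j _ => mul_nonneg (hpos j).le (mul_self_nonneg _))
      ⟨i, Finset.mem_univ _, mul_pos (hpos i) (mul_self_pos.2 hi)⟩

theorem gram_diagMetric {𝔤 : Type*} [LieRing 𝔤] [LieAlgebra ℝ 𝔤] (f : Module.Basis (Fin 3) ℝ 𝔤)
    {d : Fin 3 → ℝ} (hd : ∀ i, 0 < d i) : (diagMetric f d).gram f = diagGram d := by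
  funext i j
  simp only [LeftInvariantMetric.gram, diagMetric, LinearMap.mk₂_apply, diagGram, hd, if_true,
    f.repr_self, Finsupp.single_apply]
  by_cases h : i = j <;> simp [h]

/-- Freezing the conserved product P turns a rational field into a polynomial one, so local
existence holds near every point of ℝ³. -/
theorem contDiff_polyField (P : ℝ) : ContDiff ℝ 1 (polyField P) := by
  refine contDiff_pi.2 fun i => ?_
  fin_cases i <;> simp [polyField] <;> fun_prop

theorem LeftInvariantMetric.gram_diag_pos {𝔤 : Type*} [LieRing 𝔤] [LieAlgebra ℝ 𝔤]
    (g : LeftInvariantMetric 𝔤) (f : Module.Basis (Fin 3) ℝ 𝔤) (i : Fin 3) : 0 < g.gram f i i :=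
  g.pos _ (f.ne_zero i)

/-- Logarithmic derivatives of the coefficients along `polyField`. -/
def polyRate (P : ℝ) (d : Fin 3 → ℝ) : Fin 3 → ℝ :=
  ![-(8 / (3 * P)) * (2 * d 0 ^ 2 + d 0 * d 1 + d 0 * d 2 - (d 1 - d 2) ^ 2),
    -(8 / (3 * P)) * (2 * d 1 ^ 2 + d 0 * d 1 - d 1 * d 2 - (d 0 + d 2) ^ 2),
    -(8 / (3 * P)) * (2 * d 2 ^ 2 + d 0 * d 2 - d 1 * d 2 - (d 0 + d 1) ^ 2)]

theorem polyField_apply (P : ℝ) (d : Fin 3 → ℝ) (i : Fin 3) :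
    polyField P d i = polyRate P d i * d i := by
  fin_cases i <;> rfl

/-- This is conservation of volume: the term (2/3)Rg makes the flow trace-free. -/
theorem polyRate_sum (P : ℝ) (d : Fin 3 → ℝ) :
    polyRate P d 0 + polyRate P d 1 + polyRate P d 2 = 0 := by
  simp [polyRate]
  ring

theorem continuous_polyRate (P : ℝ) (i : Fin 3) : Continuous fun d => polyRate P d i := by
  fin_cases i <;> simp [polyRate] <;> fun_prop

theorem prod_const_of_polyField {P : ℝ} {α : ℝ → Fin 3 → ℝ} {J : Set ℝ} (hJ : IsOpen J)
    (hJ' : J.OrdConnected) (hα : ∀ t ∈ J, HasDerivAt α (polyField P (α t)) t)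
    {t t₁ : ℝ} (ht : t ∈ J) (ht₁ : t₁ ∈ J) :
    α t 0 * α t 1 * α t 2 = α t₁ 0 * α t₁ 1 * α t₁ 2 := by
  have hd : ∀ r ∈ J, HasDerivAt (fun r => α r 0 * α r 1 * α r 2) 0 r := by
    intro r hr
    have h := hasDerivAt_pi.1 (hα r hr)
    refine (((h 0).fun_mul (h 1)).fun_mul (h 2)).congr_deriv ?_
    simp only [polyField_apply]
    linear_combination (α r 0 * α r 1 * α r 2) * polyRate_sum P (α r)
  obtain ⟨c, hc⟩ := hJ.exists_is_const_of_deriv_eq_zero hJ'.isPreconnected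
    (fun r hr => (hd r hr).differentiableAt.differentiableWithinAt) (fun r hr => (hd r hr).deriv)
  rw [hc t ht, hc t₁ ht₁]

theorem pos_of_polyField {P : ℝ} {α : ℝ → Fin 3 → ℝ} {J : Set ℝ} (hJ : IsOpen J)
    (hJ' : J.OrdConnected) (hα : ∀ t ∈ J, HasDerivAt α (polyField P (α t)) t)
    {t₁ : ℝ} (ht₁ : t₁ ∈ J) (hpos : ∀ i, 0 < α t₁ i) (t : ℝ) (ht : t ∈ J) (i : Fin 3) :
    0 < α t i := by
  refine pos_of_hasDerivAt_mul (y := fun t => α t i) (k := fun t => polyRate P (α t) i) hJ hJ' ?_ ?_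
    ht₁ (hpos i) t ht
  · exact (continuous_polyRate P i).comp_continuousOn
      fun r hr => (hα r hr).continuousAt.continuousWithinAt
  · intro r hr
    rw [← polyField_apply]
    exact hasDerivAt_pi.1 (hα r hr) i

variable {f : Module.Basis (Fin 3) ℝ SL2Alg}

theorem IsMilnorFrame.isNormalizedRicciFlowOn_diagMetric (hf : IsMilnorFrame f) {P : ℝ}
    {α : ℝ → Fin 3 → ℝ} {J : Set ℝ} (hJ : IsOpen J)
    (hα : ∀ t ∈ J, HasDerivAt α (polyField P (α t)) t) (hpos : ∀ t ∈ J, ∀ i, 0 < α t i)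
    (hP : ∀ t ∈ J, α t 0 * α t 1 * α t 2 = P) :
    IsNormalizedRicciFlowOn (fun t => diagMetric f (α t)) J := by
  rw [isNormalizedRicciFlowOn_iff f]
  intro t ht
  rw [gram_diagMetric f (hpos t ht), hf.structureConstants_eq,
    flowField_diagGram fun i => (hpos t ht i).ne', hP t ht]
  have h1 : HasDerivAt (fun s => diagGram (α s)) (diagGram (polyField P (α t))) t := by
    refine hasDerivAt_pi.2 fun i => hasDerivAt_pi.2 fun j => ?_
    by_cases hij : i = j
    · simpa [diagGram, hij] using hasDerivAt_pi.1 (hα t ht) j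
    · simpa [diagGram, hij] using hasDerivAt_const t (0 : ℝ)
  refine h1.congr_of_eventuallyEq ?_
  filter_upwards [hJ.mem_nhds ht] with s hs
  rw [gram_diagMetric f (hpos s hs)]

/-- Local existence of diagonal flows, with a time of existence that is uniform for initial
metrics of the same volume near a given one. -/
theorem IsMilnorFrame.exists_flow_near (hf : IsMilnorFrame f) {p : Fin 3 → ℝ} :
    ∃ r > (0 : ℝ), ∃ ε > (0 : ℝ), ∀ q ∈ Metric.closedBall p r, (∀ i, 0 < q i) →
      q 0 * q 1 * q 2 = p 0 * p 1 * p 2 → ∀ t₁ : ℝ, ∃ h : ℝ → LeftInvariantMetric SL2Alg,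
        IsNormalizedRicciFlowOn h (Set.Ioo (t₁ - ε) (t₁ + ε)) ∧ h t₁ = diagMetric f q := by
  set P := p 0 * p 1 * p 2 with hPdef
  -- Picard–Lindelöf for the field with frozen P gives `r` and `ε` depending only on `p`. A solution
  -- from `q` is a Ricci flow because the product of `q` is also P.
  obtain ⟨r, hr, ε, hε, H⟩ := ((contDiff_polyField P).contDiffAt
    (x := p)).exists_forall_mem_closedBall_exists_eq_forall_mem_Ioo_hasDerivAt 0
  refine ⟨r, hr, ε, hε, fun q hq hqpos hqP t₁ => ?_⟩
  obtain ⟨α, hα0, hα⟩ := H q hq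
  have hα' : ∀ t ∈ Set.Ioo (t₁ - ε) (t₁ + ε),
      HasDerivAt (fun t => α (t - t₁)) (polyField P (α (t - t₁))) t := by
    intro t ht
    exact (hα (t - t₁) ⟨by linarith [ht.1], by linarith [ht.2]⟩).comp_sub_const t t₁
  have ht₁ : t₁ ∈ Set.Ioo (t₁ - ε) (t₁ + ε) := ⟨by linarith, by linarith⟩
  have h1 : α (t₁ - t₁) = q := by rw [sub_self, hα0]
  refine ⟨fun t => diagMetric f (α (t - t₁)), ?_, by simp only [h1]⟩
  refine hf.isNormalizedRicciFlowOn_diagMetric isOpen_Ioo hα' ?_ ?_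
  · exact pos_of_polyField isOpen_Ioo Set.ordConnected_Ioo hα' ht₁ (by simpa only [h1] using hqpos)
  · intro t ht
    have := prod_const_of_polyField isOpen_Ioo Set.ordConnected_Ioo hα' ht ht₁
    rw [this, h1, hqP]

theorem IsMilnorFrame.exists_isMaximalFlowFrom (hf : IsMilnorFrame f) {x : Fin 3 → ℝ}
    (hx : ∀ i, 0 < x i) : ∃ g I, IsMaximalFlowFrom f x g I := by
  obtain ⟨r, hr, ε, hε, H⟩ := hf.exists_flow_near (p := x)
  obtain ⟨h, hh, h0⟩ := H x (Metric.mem_closedBall_self hr.le) hx rfl 0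
  obtain ⟨g, I, hg, hg0⟩ := exists_isMaximalNormalizedRicciFlow f isOpen_Ioo Set.ordConnected_Ioo
    (by constructor <;> linarith) hh
  refine ⟨g, I, hg, fun i j => ?_⟩
  rw [hg0, h0]
  exact congrFun (congrFun (gram_diagMetric f hx) i) j

variable {x : Fin 3 → ℝ} {g : ℝ → LeftInvariantMetric SL2Alg} {I : Set ℝ}

/-- The flipped curve solves the same equation and starts at the same diagonal matrix, so uniqueness
identifies the two. -/
theorem IsMaximalFlowFrom.gram_signFlip (hf : IsMilnorFrame f) (hg : IsMaximalFlowFrom f x g I)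
    {s : Fin 3 → ℝ} (hs : ∀ i, s i = 1 ∨ s i = -1)
    (hc : ∀ i j k, milnorConstants i j k * s k = s i * s j * milnorConstants i j k) :
    ∀ t ∈ I, (g t).gram f = signFlip s ((g t).gram f) := by
  have hd := (isNormalizedRicciFlowOn_iff f g I).1 hg.1.isFlow
  rw [hf.structureConstants_eq] at hd
  refine eqOn_of_hasDerivAt_of_contDiffAt (v := flowField milnorConstants) hg.1.isOpen
    hg.1.ordConnected hd ?_ (fun t _ => contDiffAt_flowField _ ((g t).det_gram_ne_zero f))
    hg.1.zero_mem ?_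
  · intro t ht
    rw [flowField_signFlip hs hc]
    exact hasDerivAt_pi.2 fun i => hasDerivAt_pi.2 fun j =>
      (hasDerivAt_pi.1 (hasDerivAt_pi.1 (hd t ht) i) j).const_mul (s i * s j)
  · funext i j
    simp only [LeftInvariantMetric.gram, signFlip, hg.2]
    split_ifs with h
    · subst h
      rcases hs i with h | h <;> rw [h] <;> ring
    · ring

/-- Two half-turns suffice: every off-diagonal entry changes sign under at least one of them. -/
theorem IsMaximalFlowFrom.gram_offDiag (hf : IsMilnorFrame f) (hg : IsMaximalFlowFrom f x g I)
    {t : ℝ} (ht : t ∈ I) {i j : Fin 3} (hij : i ≠ j) : (g t).gram f i j = 0 := by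
  have h1 := hg.gram_signFlip hf (s := ![1, -1, -1])
    (by intro i; fin_cases i <;> simp)
    (by intro i j k; fin_cases i <;> fin_cases j <;> fin_cases k <;> simp [milnorConstants]) t ht
  have h2 := hg.gram_signFlip hf (s := ![-1, 1, -1])
    (by intro i; fin_cases i <;> simp)
    (by intro i j k; fin_cases i <;> fin_cases j <;> fin_cases k <;> simp [milnorConstants]) t ht
  have h1' := congrFun (congrFun h1 i) j
  have h2' := congrFun (congrFun h2 i) j
  fin_cases i <;> fin_cases j <;> simp [signFlip] at h1' h2' hij ⊢ <;> linarith

/-- The coefficients of a metric in a frame. -/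
def diagCoeff (f : Module.Basis (Fin 3) ℝ SL2Alg) (g : ℝ → LeftInvariantMetric SL2Alg) (t : ℝ) :
    Fin 3 → ℝ := fun i => (g t).form (f i) (f i)

theorem diagCoeff_pos (t : ℝ) (i : Fin 3) : 0 < diagCoeff f g t i := (g t).gram_diag_pos f i

theorem IsMaximalFlowFrom.gram_eq (hf : IsMilnorFrame f) (hg : IsMaximalFlowFrom f x g I)
    {t : ℝ} (ht : t ∈ I) : (g t).gram f = diagGram (diagCoeff f g t) := by
  funext i j
  by_cases h : i = j
  · subst h
    simp [diagGram, LeftInvariantMetric.gram, diagCoeff]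
  · rw [hg.gram_offDiag hf ht h, diagGram, if_neg h]

theorem IsMaximalFlowFrom.diagCoeff_zero (hg : IsMaximalFlowFrom f x g I) :
    diagCoeff f g 0 = x := by
  funext i
  rw [diagCoeff, hg.2, if_pos rfl]

theorem IsMaximalFlowFrom.hasDerivAt_diagCoeff' (hf : IsMilnorFrame f)
    (hg : IsMaximalFlowFrom f x g I) {t : ℝ} (ht : t ∈ I) :
    HasDerivAt (diagCoeff f g) (polyField (diagCoeff f g t 0 * diagCoeff f g t 1 * diagCoeff f g t 2)
      (diagCoeff f g t)) t := by
  have hd := (isNormalizedRicciFlowOn_iff f g I).1 hg.1.isFlow t ht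
  rw [hf.structureConstants_eq, hg.gram_eq hf ht,
    flowField_diagGram fun i => (diagCoeff_pos t i).ne'] at hd
  refine hasDerivAt_pi.2 fun i => ?_
  have := hasDerivAt_pi.1 (hasDerivAt_pi.1 hd i) i
  rw [diagGram, if_pos rfl] at this
  exact this

theorem IsMaximalFlowFrom.prod_eq (hf : IsMilnorFrame f) (hg : IsMaximalFlowFrom f x g I)
    {t : ℝ} (ht : t ∈ I) :
    diagCoeff f g t 0 * diagCoeff f g t 1 * diagCoeff f g t 2 = x 0 * x 1 * x 2 := by
  have hd : ∀ r ∈ I, HasDerivAt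
      (fun r => diagCoeff f g r 0 * diagCoeff f g r 1 * diagCoeff f g r 2) 0 r := by
    intro r hr
    have h := hasDerivAt_pi.1 (hg.hasDerivAt_diagCoeff' hf hr)
    refine (((h 0).fun_mul (h 1)).fun_mul (h 2)).congr_deriv ?_
    simp only [polyField_apply]
    linear_combination (diagCoeff f g r 0 * diagCoeff f g r 1 * diagCoeff f g r 2) *
      polyRate_sum _ (diagCoeff f g r)
  obtain ⟨c, hc⟩ := hg.1.isOpen.exists_is_const_of_deriv_eq_zero hg.1.ordConnected.isPreconnected
    (fun r hr => (hd r hr).differentiableAt.differentiableWithinAt) (fun r hr => (hd r hr).deriv)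
  have h0 := hc 0 hg.1.zero_mem
  simp only [hg.diagCoeff_zero] at h0
  rw [h0]
  exact hc t ht

theorem IsMaximalFlowFrom.hasDerivAt_diagCoeff (hf : IsMilnorFrame f)
    (hg : IsMaximalFlowFrom f x g I) {t : ℝ} (ht : t ∈ I) :
    HasDerivAt (diagCoeff f g) (polyField (x 0 * x 1 * x 2) (diagCoeff f g t)) t := by
  rw [← hg.prod_eq hf ht]
  exact hg.hasDerivAt_diagCoeff' hf ht

/-- The coefficients of a maximal flow cannot converge to positive limits at a finite left end of
the interval of existence. -/
theorem IsMaximalFlowFrom.not_tendsto (hf : IsMilnorFrame f) (hg : IsMaximalFlowFrom f x g I)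
    {t₀ : ℝ} (ht₀ : IsGLB I t₀) {p : Fin 3 → ℝ} :
    ¬ Tendsto (diagCoeff f g) (𝓝[>] t₀) (𝓝 p) := by
  intro hlim
  have h0I := hg.1.zero_mem
  have hnot : t₀ ∉ I := by
    intro hmem
    obtain ⟨l, hl, hI⟩ := exists_Ioc_subset_of_mem_nhds (hg.1.isOpen.mem_nhds hmem) ⟨t₀ - 1, by simp⟩
    have := ht₀.1 (hI (show (l + t₀) / 2 ∈ Set.Ioc l t₀ from ⟨by linarith, by linarith⟩))
    linarith
  have ht₀0 : t₀ < 0 := lt_of_le_of_ne (ht₀.1 h0I) fun h => hnot (h ▸ h0I)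
  have hsub : ∀ t, t₀ < t → t ≤ 0 → t ∈ I := by
    intro t ht ht'
    obtain ⟨r, hr, hrt⟩ := (isGLB_lt_iff ht₀).1 ht
    exact hg.1.ordConnected.out hr h0I ⟨hrt.le, ht'⟩
  have hev : ∀ᶠ t in 𝓝[>] t₀, t ∈ I := by
    filter_upwards [Ioo_mem_nhdsGT ht₀0] with t ht using hsub t ht.1 ht.2.le
  have hP : p 0 * p 1 * p 2 = x 0 * x 1 * x 2 := by
    have h := tendsto_pi_nhds.1 hlim
    have h1 := ((h 0).mul (h 1)).mul (h 2)
    refine tendsto_nhds_unique h1 (tendsto_const_nhds.congr' ?_)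
    filter_upwards [hev] with t ht using (hg.prod_eq hf ht).symm
  obtain ⟨r, hr, ε, hε, H⟩ := hf.exists_flow_near (p := p)
  -- Restart the flow at a time closer to `t₀` than the uniform existence time `ε`. The restarted
  -- flow passes `t₀`, contradicting maximality.
  obtain ⟨t₁, ht₁, ht₁I, ht₁ε⟩ := ((hlim.eventually (Metric.closedBall_mem_nhds p hr)).and
    (hev.and (Ioo_mem_nhdsGT (show t₀ < t₀ + ε by linarith)))).exists
  obtain ⟨h, hh, hh1⟩ := H _ ht₁ (fun i => diagCoeff_pos t₁ i)
    ((hg.prod_eq hf ht₁I).trans hP.symm) t₁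
  have heq : h t₁ = g t₁ := by
    refine LeftInvariantMetric.ext_gram f ?_
    rw [hh1, gram_diagMetric f fun i => diagCoeff_pos t₁ i, hg.gram_eq hf ht₁I]
  have := hg.1.subset f isOpen_Ioo Set.ordConnected_Ioo hh ht₁I ⟨by linarith, by linarith⟩ heq
  exact hnot (this ⟨by linarith [ht₁ε.2], by linarith [ht₁ε.1]⟩)

end Diagonal

/-! ### The separatrix -/

section Separatrix

/-- In the variables `z = A / B`, `w = C / B` and `σ = log (w / (1 - w))`, orbits of the flow are
the solutions of `dz/dσ = -orbitSlope w z`. -/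
def orbitSlope (w z : ℝ) : ℝ := z * (1 + z) * (z + w - 1) / (1 + z + w)

/-- The difference quotient of `orbitSlope w`. -/
def orbitSlopeQuot (w z y : ℝ) : ℝ :=
  ((1 + w) * (z ^ 2 + z * y + y ^ 2 + w * (z + y) + w - 1) + z * y * (z + y + w)) /
    ((1 + z + w) * (1 + y + w))

theorem orbitSlope_sub {w z y : ℝ} (hw : 0 ≤ w) (hz : 0 ≤ z) (hy : 0 ≤ y) :
    orbitSlope w z - orbitSlope w y = orbitSlopeQuot w z y * (z - y) := by
  have h1 : 1 + z + w ≠ 0 := by positivity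
  have h2 : 1 + y + w ≠ 0 := by positivity
  unfold orbitSlope orbitSlopeQuot
  field_simp
  ring

/-- The part of the bracket without z is y² + wy + w - 1 = (1+y)(y+w-1). Only `y` has to lie above
the line y + w = 1, so any orbit can be compared with the separatrix. -/
theorem orbitSlopeQuot_nonneg {w z y : ℝ} (hw : 0 ≤ w) (hz : 0 ≤ z) (hy : 0 ≤ y)
    (hyw : 1 ≤ y + w) : 0 ≤ orbitSlopeQuot w z y := by
  unfold orbitSlopeQuot
  have h : 0 ≤ y ^ 2 + w * y + w - 1 := by nlinarith
  have h2 : 0 ≤ z ^ 2 + z * y + y ^ 2 + w * (z + y) + w - 1 := by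
    nlinarith [mul_nonneg hz hy, mul_nonneg hw hz, sq_nonneg z]
  positivity

theorem abs_orbitSlopeQuot_le {w z y : ℝ} (hw : w ∈ Set.Icc (0 : ℝ) 1) (hz : z ∈ Set.Icc (0 : ℝ) 1)
    (hy : y ∈ Set.Icc (0 : ℝ) 1) : |orbitSlopeQuot w z y| ≤ 20 := by
  obtain ⟨hw0, hw1⟩ := hw
  obtain ⟨hz0, hz1⟩ := hz
  obtain ⟨hy0, hy1⟩ := hy
  have hden : 1 ≤ (1 + z + w) * (1 + y + w) := by
    nlinarith [mul_nonneg (add_nonneg hz0 hw0) (add_nonneg hy0 hw0)]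
  unfold orbitSlopeQuot
  rw [abs_div, abs_of_pos (lt_of_lt_of_le one_pos hden)]
  refine (div_le_self (abs_nonneg _) hden).trans ?_
  have a1 : z * y ≤ 1 := mul_le_one₀ hz1 hy0 hy1
  have a2 : 0 ≤ z * y := mul_nonneg hz0 hy0
  have b1 : -1 ≤ z ^ 2 + z * y + y ^ 2 + w * (z + y) + w - 1 := by
    nlinarith [mul_nonneg hw0 hz0, mul_nonneg hw0 hy0]
  have b2 : z ^ 2 + z * y + y ^ 2 + w * (z + y) + w - 1 ≤ 5 := by
    nlinarith [mul_le_one₀ hw1 hz0 hz1, mul_le_one₀ hw1 hy0 hy1]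
  have b3 : 0 ≤ z + y + w := by positivity
  rw [abs_le]
  constructor <;> nlinarith

theorem abs_orbitSlope_le {w z : ℝ} (hw : w ∈ Set.Icc (0 : ℝ) 1) (hz : z ∈ Set.Icc (0 : ℝ) 1) :
    |orbitSlope w z| ≤ 2 := by
  obtain ⟨hw0, hw1⟩ := hw
  obtain ⟨hz0, hz1⟩ := hz
  have hden : 1 ≤ 1 + z + w := by linarith
  unfold orbitSlope
  rw [abs_div, abs_of_pos (lt_of_lt_of_le one_pos hden)]
  refine (div_le_self (abs_nonneg _) hden).trans ?_
  rw [abs_mul]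
  have h1 : |z * (1 + z)| ≤ 2 := by rw [abs_of_nonneg (by positivity)]; nlinarith
  have h2 : |z + w - 1| ≤ 1 := abs_le.2 ⟨by linarith, by linarith⟩
  nlinarith [abs_nonneg (z * (1 + z)), abs_nonneg (z + w - 1)]

theorem sigmoid_mem_Icc (σ : ℝ) : Real.sigmoid σ ∈ Set.Icc (0 : ℝ) 1 :=
  ⟨(Real.sigmoid_pos σ).le, Real.sigmoid_le_one σ⟩

/-- The slope field, truncated to `0 ≤ z ≤ 1`. -/
def truncSlope (σ z : ℝ) : ℝ :=
  -orbitSlope (Real.sigmoid σ) (Set.projIcc (0 : ℝ) 1 zero_le_one z)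

/-- Truncation makes the field globally bounded by 2 and 20-Lipschitz in z. The radius 4n is the
bound 2 times the length 2n of the interval. -/
theorem isPicardLindelof_truncSlope (n : ℕ) :
    IsPicardLindelof truncSlope (tmin := -n) (tmax := n)
      ⟨-n, le_rfl, by linarith [(Nat.cast_nonneg n : (0 : ℝ) ≤ n)]⟩ 1 (4 * n) 0 2 20 where
  lipschitzOnWith σ _ := by
    refine LipschitzOnWith.of_dist_le_mul fun z _ y _ => ?_
    have hz := (Set.projIcc (0 : ℝ) 1 zero_le_one z).2
    have hy := (Set.projIcc (0 : ℝ) 1 zero_le_one y).2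
    have hs := sigmoid_mem_Icc σ
    rw [truncSlope, truncSlope, dist_neg_neg, Real.dist_eq, orbitSlope_sub hs.1 hz.1 hy.1, abs_mul]
    refine mul_le_mul (abs_orbitSlopeQuot_le hs hz hy) ?_ (abs_nonneg _) (by norm_num)
    have := (LipschitzWith.projIcc (zero_le_one (α := ℝ))).dist_le_mul z y
    rw [NNReal.coe_one, one_mul, Subtype.dist_eq, Real.dist_eq] at this
    exact this
  continuousOn z _ := by
    have hz := (Set.projIcc (0 : ℝ) 1 zero_le_one z).2
    have hne : ∀ σ, 1 + (Set.projIcc (0 : ℝ) 1 zero_le_one z : ℝ) + Real.sigmoid σ ≠ 0 := fun σ => by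
      have := hz.1
      have := Real.sigmoid_pos σ
      positivity
    have hc := continuous_sigmoid
    unfold truncSlope orbitSlope
    exact (Continuous.neg (by fun_prop (disch := exact hne _))).continuousOn
  norm_le σ _ z _ := by
    rw [truncSlope, norm_neg, Real.norm_eq_abs]
    exact abs_orbitSlope_le (sigmoid_mem_Icc σ) (Set.projIcc (0 : ℝ) 1 zero_le_one z).2
  mul_max_le := by
    have : (0 : ℝ) ≤ n := Nat.cast_nonneg n
    simp
    linarith

/-- The solution starts on the edge z = 1 at σ = -n and cannot leave the strip. On z = 1 its slope
is negative; on z = 1 - w its slope is 0 while the edge itself strictly descends. Inside the strip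
the truncation has no effect. -/
theorem exists_approx_separatrix (n : ℕ) : ∃ z : ℝ → ℝ, ∀ σ ∈ Set.Icc (-n : ℝ) n,
    1 ≤ z σ + Real.sigmoid σ ∧ z σ ≤ 1 ∧
    HasDerivWithinAt z (-orbitSlope (Real.sigmoid σ) (z σ)) (Set.Icc (-n : ℝ) n) σ := by
  obtain ⟨z, hz0, hz⟩ := (isPicardLindelof_truncSlope n).exists_eq_forall_mem_Icc_hasDerivWithinAt₀
  have hz0 : z (-n) = 1 := hz0
  have hcont : ContinuousOn z (Set.Icc (-n : ℝ) n) := fun σ hσ => (hz σ hσ).continuousWithinAt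
  have hright : ∀ σ ∈ Set.Ico (-n : ℝ) n, HasDerivWithinAt z (truncSlope σ (z σ)) (Set.Ici σ) σ := by
    intro σ hσ
    exact ((hz σ ⟨hσ.1, hσ.2.le⟩).mono (Set.Icc_subset_Icc_left hσ.1)).mono_of_mem_nhdsWithin
      (Icc_mem_nhdsGE hσ.2)
  have hle : ∀ ⦃σ⦄, σ ∈ Set.Icc (-n : ℝ) n → z σ ≤ 1 := by
    refine image_le_of_deriv_right_lt_deriv_boundary' hcont hright (B := fun _ => 1)
      (B' := fun _ => 0) hz0.le continuousOn_const (fun σ _ => hasDerivWithinAt_const _ _ _) ?_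
    intro σ _ h1
    rw [h1, truncSlope, Set.projIcc_right, orbitSlope, neg_lt_zero]
    have := Real.sigmoid_pos σ
    have h2 : (1 : ℝ) + Real.sigmoid σ - 1 = Real.sigmoid σ := by ring
    simp only [h2]
    positivity
  have hge : ∀ ⦃σ⦄, σ ∈ Set.Icc (-n : ℝ) n → 1 - Real.sigmoid σ ≤ z σ := by
    refine image_le_of_deriv_right_lt_deriv_boundary' (f := fun σ => 1 - Real.sigmoid σ)
      (f' := fun σ => -(Real.sigmoid σ * (1 - Real.sigmoid σ)))
      (continuous_const.sub continuous_sigmoid).continuousOn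
      (fun σ _ => ((Real.hasDerivAt_sigmoid σ).const_sub 1).hasDerivWithinAt)
      (by rw [hz0]; linarith [Real.sigmoid_pos (-n)]) hcont hright ?_
    intro σ _ h1
    have h0 := Real.sigmoid_pos σ
    have h2 := Real.sigmoid_lt_one σ
    rw [← h1, truncSlope, Set.projIcc_of_mem _ (show 1 - Real.sigmoid σ ∈ Set.Icc (0 : ℝ) 1 from
      ⟨by linarith, by linarith⟩), orbitSlope]
    have h3 : 1 - Real.sigmoid σ + Real.sigmoid σ - 1 = 0 := by ring
    simp only [h3, mul_zero, zero_div, neg_zero, neg_lt_zero]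
    exact mul_pos h0 (by linarith)
  refine ⟨z, fun σ hσ => ⟨by linarith [hge hσ], hle hσ, ?_⟩⟩
  have := hz σ hσ
  rwa [truncSlope, Set.projIcc_of_mem _ (show z σ ∈ Set.Icc (0 : ℝ) 1 from
    ⟨by linarith [hge hσ, Real.sigmoid_lt_one σ], hle hσ⟩)] at this

/-- Inside the strip the difference quotient of the slope is nonnegative, so the gap between
solutions shrinks as σ grows. At σ = -n it is at most the width of the strip. -/
theorem abs_sub_le_of_approx_separatrix {z y : ℝ → ℝ} {n m : ℕ} (hnm : n ≤ m)
    (hz : ∀ σ ∈ Set.Icc (-n : ℝ) n, 1 ≤ z σ + Real.sigmoid σ ∧ z σ ≤ 1 ∧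
      HasDerivWithinAt z (-orbitSlope (Real.sigmoid σ) (z σ)) (Set.Icc (-n : ℝ) n) σ)
    (hy : ∀ σ ∈ Set.Icc (-m : ℝ) m, 1 ≤ y σ + Real.sigmoid σ ∧ y σ ≤ 1 ∧
      HasDerivWithinAt y (-orbitSlope (Real.sigmoid σ) (y σ)) (Set.Icc (-m : ℝ) m) σ)
    {σ : ℝ} (hσ : σ ∈ Set.Icc (-n : ℝ) n) : |z σ - y σ| ≤ Real.sigmoid (-n) := by
  have hnm' : (n : ℝ) ≤ m := Nat.cast_le.2 hnm
  have hsub : Set.Icc (-n : ℝ) n ⊆ Set.Icc (-m : ℝ) m := Set.Icc_subset_Icc (by linarith) hnm'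
  have hd : ∀ r ∈ Set.Icc (-n : ℝ) n, HasDerivWithinAt (fun r => (z r - y r) ^ 2)
      (2 * (z r - y r) * (-orbitSlope (Real.sigmoid r) (z r) - -orbitSlope (Real.sigmoid r) (y r)))
      (Set.Icc (-n : ℝ) n) r := by
    intro r hr
    have := ((hz r hr).2.2.sub ((hy r (hsub hr)).2.2.mono hsub)).fun_pow 2
    simpa using this
  have hanti : AntitoneOn (fun r => (z r - y r) ^ 2) (Set.Icc (-n : ℝ) n) := by
    refine antitoneOn_of_hasDerivWithinAt_nonpos (convex_Icc _ _)
      (fun r hr => (hd r hr).continuousWithinAt)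
      (fun r hr => (hd r (interior_subset hr)).mono interior_subset) ?_
    intro r hr
    have hr' := interior_subset hr
    have h0 := Real.sigmoid_pos r
    have h1 := Real.sigmoid_lt_one r
    have hz' := hz r hr'
    have hy' := hy r (hsub hr')
    have hq := orbitSlopeQuot_nonneg h0.le (show 0 ≤ z r by linarith) (show 0 ≤ y r by linarith) hy'.1
    have := orbitSlope_sub h0.le (show 0 ≤ z r by linarith) (show 0 ≤ y r by linarith)
    have h3 : 2 * (z r - y r) * (-orbitSlope (Real.sigmoid r) (z r) -
        -orbitSlope (Real.sigmoid r) (y r)) =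
        -(2 * (orbitSlopeQuot (Real.sigmoid r) (z r) (y r) * (z r - y r) ^ 2)) := by
      linear_combination (-2 * (z r - y r)) * this
    rw [h3, neg_nonpos]
    positivity
  have hn : (-n : ℝ) ∈ Set.Icc (-n : ℝ) n := ⟨le_rfl, hσ.1.trans hσ.2⟩
  have h1 := hanti hn hσ hσ.1
  have hzn := hz _ hn
  have hyn := hy _ (hsub hn)
  have h2 : |z (-n) - y (-n)| ≤ Real.sigmoid (-n) := abs_le.2 ⟨by linarith, by linarith⟩
  exact (sq_le_sq.1 h1).trans h2

theorem tendsto_sigmoid_neg_natCast : Tendsto (fun n : ℕ => Real.sigmoid (-n)) atTop (𝓝 0) :=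
  Real.tendsto_sigmoid_atBot.comp (tendsto_neg_atTop_atBot.comp tendsto_natCast_atTop_atTop)

theorem contDiffAt_orbitSlope {w z : ℝ} (hw : 0 ≤ w) (hz : 0 ≤ z) :
    ContDiffAt ℝ ∞ (fun p : ℝ × ℝ => orbitSlope p.1 p.2) (w, z) := by
  unfold orbitSlope
  refine ContDiffAt.div (by fun_prop) (by fun_prop) ?_
  simp only
  positivity

/-- The separatrix: a solution of the orbit equation that stays in the strip `1 - w ≤ z ≤ 1`. -/
theorem exists_separatrix : ∃ H : ℝ → ℝ, ContDiff ℝ ∞ H ∧ ∀ σ, 1 ≤ H σ + Real.sigmoid σ ∧ H σ ≤ 1 ∧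
    HasDerivAt H (-orbitSlope (Real.sigmoid σ) (H σ)) σ := by
  choose z hz using exists_approx_separatrix
  have hmem : ∀ σ : ℝ, ∃ N : ℕ, ∀ n ≥ N, σ ∈ Set.Icc (-n : ℝ) n := by
    intro σ
    obtain ⟨N, hN⟩ := exists_nat_ge |σ|
    refine ⟨N, fun n hn => abs_le.1 (hN.trans (Nat.cast_le.2 hn))⟩
  have hcau : ∀ σ, CauchySeq fun n => z n σ := by
    intro σ
    refine Metric.cauchySeq_iff'.2 fun ε hε => ?_
    obtain ⟨N, hN⟩ := hmem σ
    obtain ⟨M, hM⟩ := eventually_atTop.1 (tendsto_sigmoid_neg_natCast.eventually_lt_const hε)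
    refine ⟨max N M, fun n hn => ?_⟩
    rw [dist_comm, Real.dist_eq]
    exact (abs_sub_le_of_approx_separatrix hn (hz _) (hz _) (hN _ (le_max_left _ _))).trans_lt
      (hM _ (le_max_right _ _))
  choose H hH using fun σ => cauchySeq_tendsto_of_complete (hcau σ)
  have hstrip : ∀ σ, 1 ≤ H σ + Real.sigmoid σ ∧ H σ ≤ 1 := by
    intro σ
    obtain ⟨N, hN⟩ := hmem σ
    constructor
    · refine ge_of_tendsto ((hH σ).add_const _) ?_
      filter_upwards [eventually_ge_atTop N] with n hn using (hz n σ (hN n hn)).1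
    · refine le_of_tendsto (hH σ) ?_
      filter_upwards [eventually_ge_atTop N] with n hn using (hz n σ (hN n hn)).2.1
  have hpos : ∀ σ, 0 ≤ H σ := fun σ => by linarith [(hstrip σ).1, Real.sigmoid_lt_one σ]
  have herr : ∀ (n : ℕ), ∀ σ ∈ Set.Icc (-n : ℝ) n, |z n σ - H σ| ≤ Real.sigmoid (-n) := by
    intro n σ hσ
    refine le_of_tendsto ((tendsto_const_nhds.sub (hH σ)).abs) ?_
    filter_upwards [eventually_ge_atTop n] with m hm
    exact abs_sub_le_of_approx_separatrix hm (hz _) (hz _) hσ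
  have hderiv : ∀ σ, HasDerivAt H (-orbitSlope (Real.sigmoid σ) (H σ)) σ := by
    intro σ
    obtain ⟨N, hN⟩ := exists_nat_gt |σ|
    have hsub : ∀ n ≥ N, Set.Ioo (-N : ℝ) N ⊆ Set.Ioo (-n : ℝ) n := fun n hn =>
      Set.Ioo_subset_Ioo (neg_le_neg (Nat.cast_le.2 hn)) (Nat.cast_le.2 hn)
    -- The slopes converge locally uniformly because the slope is 20-Lipschitz in z, so the limit
    -- solves the same equation.
    refine hasDerivAt_of_tendstoUniformlyOn (f := z) (l := atTop)
      (f' := fun n σ => -orbitSlope (Real.sigmoid σ) (z n σ))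
      (g' := fun σ => -orbitSlope (Real.sigmoid σ) (H σ)) (s := Set.Ioo (-N : ℝ) N) isOpen_Ioo ?_ ?_
      (fun σ _ => hH σ) (abs_lt.1 hN)
    · refine Metric.tendstoUniformlyOn_iff.2 fun ε hε => ?_
      filter_upwards [tendsto_sigmoid_neg_natCast.eventually_lt_const (show 0 < ε / 20 by positivity),
        eventually_ge_atTop N] with n hn hnN r hr
      have hr' := Set.Ioo_subset_Icc_self (hsub n hnN hr)
      have h0 := sigmoid_mem_Icc r
      have h1 := Real.sigmoid_lt_one r
      have hzr := hz n r hr'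
      rw [dist_neg_neg, dist_comm, Real.dist_eq, orbitSlope_sub h0.1 (by linarith) (hpos r), abs_mul]
      have hq := abs_orbitSlopeQuot_le h0 ⟨by linarith, hzr.2.1⟩ ⟨hpos r, (hstrip r).2⟩
      nlinarith [herr n r hr', abs_nonneg (z n r - H r),
        abs_nonneg (orbitSlopeQuot (Real.sigmoid r) (z n r) (H r))]
    · filter_upwards [eventually_ge_atTop N] with n hn r hr
      have := hsub n hn hr
      exact (hz n r (Set.Ioo_subset_Icc_self this)).2.2.hasDerivAt (Icc_mem_nhds this.1 this.2)
  refine ⟨H, contDiff_iff_contDiffAt.2 fun σ => ?_, fun σ => ⟨(hstrip σ).1, (hstrip σ).2, hderiv σ⟩⟩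
  -- The right-hand side is smooth for y ≥ 0, and a solution of a smooth equation is smooth.
  have hsm : ContDiffOn ℝ ∞ (Function.uncurry fun σ y => -orbitSlope (Real.sigmoid σ) y)
      (Set.Icc (σ - 1) (σ + 1) ×ˢ Set.Ici 0) := by
    rintro ⟨r, y⟩ ⟨_, hy⟩
    have h1 : ContDiffAt ℝ ∞ (fun p : ℝ × ℝ => (Real.sigmoid p.1, p.2)) (r, y) :=
      ((contDiff_sigmoid.of_le le_top).comp contDiff_fst).contDiffAt.prodMk contDiff_snd.contDiffAt
    exact ((contDiffAt_orbitSlope (Real.sigmoid_pos r).le hy).comp (r, y) h1).neg.contDiffWithinAt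
  exact (ODE.contDiffOn_enat_Icc_of_hasDerivWithinAt hsm
    (fun t _ => (hderiv t).hasDerivWithinAt) (fun t _ => hpos t)).contDiffAt
    (Icc_mem_nhds (by linarith) (by linarith))

end Separatrix

/-! ### Blow-up at the left end of an interval -/

section Blowup

/-- Backward in time y stays positive, so y' ≤ ky ≤ 0 there. This is how a gap, once open, is shown
not to shrink toward the past. -/
theorem backward_ge_of_deriv_le_mul {y y' k : ℝ → ℝ} {I : Set ℝ} (hI : IsOpen I)
    (hI' : I.OrdConnected) (hk : ContinuousOn k I) (hy : ∀ t ∈ I, HasDerivAt y (y' t) t)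
    {t₁ : ℝ} (ht₁ : t₁ ∈ I) (hle : ∀ r ∈ I, r ≤ t₁ → y' r ≤ k r * y r) (hk0 : ∀ r ∈ I, k r ≤ 0)
    (h : 0 < y t₁) : ∀ t ∈ I, t ≤ t₁ → y t₁ ≤ y t := by
  intro t ht htt
  have hpos : ∀ r ∈ I, r ≤ t₁ → 0 < y r := fun r hr hrt =>
    pos_of_deriv_le_mul hI hI' hk hy hr ht₁ hrt hle h
  have hsub : Set.Icc t t₁ ⊆ I := hI'.out ht ht₁
  have hanti : AntitoneOn y (Set.Icc t t₁) := by
    refine antitoneOn_of_hasDerivWithinAt_nonpos (convex_Icc _ _)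
      (fun r hr => (hy r (hsub hr)).continuousAt.continuousWithinAt)
      (fun r hr => (hy r (hsub (interior_subset hr))).hasDerivWithinAt) fun r hr => ?_
    have hr' := interior_subset hr
    exact (hle r (hsub hr') hr'.2).trans
      (mul_nonpos_of_nonpos_of_nonneg (hk0 r (hsub hr')) (hpos r (hsub hr') hr'.2).le)
  exact hanti (Set.left_mem_Icc.2 htt) (Set.right_mem_Icc.2 htt) htt

theorem AntitoneOn.tendsto_nhdsGT_atTop_or_nhds {h : ℝ → ℝ} {a b : ℝ} (hab : a < b)
    (hh : AntitoneOn h (Set.Ioo a b)) :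
    Tendsto h (𝓝[>] a) atTop ∨ ∃ L, Tendsto h (𝓝[>] a) (𝓝 L) ∧ ∀ t ∈ Set.Ioo a b, h t ≤ L := by
  by_cases hb : BddAbove (h '' Set.Ioo a b)
  · refine Or.inr ⟨sSup (h '' Set.Ioo a b), ?_, fun t ht => le_csSup hb ⟨t, ht, rfl⟩⟩
    exact hh.tendsto_nhdsWithin_Ioo_right (Set.nonempty_Ioo.2 hab) hb
  · left
    rw [tendsto_atTop]
    intro M
    rw [not_bddAbove_iff] at hb
    obtain ⟨_, ⟨t, ht, rfl⟩, hM⟩ := hb M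
    filter_upwards [Ioo_mem_nhdsGT ht.1] with r hr
    exact hM.le.trans (hh ⟨hr.1, hr.2.trans ht.2⟩ ht hr.2.le)

variable {I : Set ℝ} {X r : ℝ → ℝ} {K : ℝ}

theorem hasDerivAt_inv_sq {t : ℝ} (hX : 0 < X t) (hd : HasDerivAt X (-(K * r t) * X t) t) :
    HasDerivAt (fun t => (X t ^ 2)⁻¹) (2 * K * (r t / X t ^ 2)) t := by
  refine ((hd.fun_pow 2).fun_inv (by positivity)).congr_deriv ?_
  field_simp
  ring

/-- `X' = -K r X` with `r ≥ m X²` makes `X` blow up in finite backward time. -/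
theorem bddBelow_of_deriv_cubic (hI' : I.OrdConnected) (hK : 0 < K)
    (hpos : ∀ t ∈ I, 0 < X t) (hd : ∀ t ∈ I, HasDerivAt X (-(K * r t) * X t) t)
    {t₁ m : ℝ} (ht₁ : t₁ ∈ I) (hm : 0 < m) (hr : ∀ t ∈ I, t ≤ t₁ → m * X t ^ 2 ≤ r t) :
    BddBelow I := by
  by_contra hb
  rw [not_bddBelow_iff] at hb
  have hV : ∀ t ∈ I, HasDerivAt (fun t => (X t ^ 2)⁻¹) (2 * K * (r t / X t ^ 2)) t :=
    fun t ht => hasDerivAt_inv_sq (hpos t ht) (hd t ht)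
  -- Before this time X⁻², whose derivative is at least 2Km, would be negative.
  obtain ⟨t, ht, htt⟩ := hb (t₁ - (X t₁ ^ 2)⁻¹ / (2 * K * m))
  have h0 : 0 < (X t₁ ^ 2)⁻¹ := by have := hpos t₁ ht₁; positivity
  have h1 : 0 < (X t₁ ^ 2)⁻¹ / (2 * K * m) := by positivity
  have hlt : t ≤ t₁ := by linarith
  have hsub : Set.Icc t t₁ ⊆ I := hI'.out ht ht₁
  have hmono : MonotoneOn (fun s => (X s ^ 2)⁻¹ - 2 * K * m * s) (Set.Icc t t₁) := by
    have hd' : ∀ s ∈ Set.Icc t t₁, HasDerivAt (fun s => (X s ^ 2)⁻¹ - 2 * K * m * s)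
        (2 * K * (r s / X s ^ 2) - 2 * K * m) s := fun s hs => by
      simpa using (hV s (hsub hs)).fun_sub ((hasDerivAt_id s).const_mul (2 * K * m))
    refine monotoneOn_of_hasDerivWithinAt_nonneg (convex_Icc _ _)
      (fun s hs => (hd' s hs).continuousAt.continuousWithinAt)
      (fun s hs => (hd' s (interior_subset hs)).hasDerivWithinAt) fun s hs => ?_
    have hs' := interior_subset hs
    have hXs := hpos s (hsub hs')
    have : m ≤ r s / X s ^ 2 := (le_div_iff₀ (by positivity)).2 (hr s (hsub hs') hs'.2)
    nlinarith
  have h2 := hmono (Set.left_mem_Icc.2 hlt) (Set.right_mem_Icc.2 hlt) hlt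
  have h3 : 0 < (X t ^ 2)⁻¹ := by have := hpos t ht; positivity
  have h4 : (X t₁ ^ 2)⁻¹ / (2 * K * m) * (2 * K * m) = (X t₁ ^ 2)⁻¹ := by field_simp
  simp only at h2
  have h5 : 2 * K * m * (t₁ - t) > (X t₁ ^ 2)⁻¹ := by
    rw [← h4, mul_comm]
    exact mul_lt_mul_of_pos_right (by linarith) (by positivity)
  linarith

/-- The exact blow-up rate of a solution of `X' = -K r X` with `r ∼ 2 X²`. -/
theorem tendsto_mul_sqrt_of_deriv_cubic (hK : 0 < K) {t₀ : ℝ} (hI : ∀ᶠ t in 𝓝[>] t₀, t ∈ I)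
    (hpos : ∀ t ∈ I, 0 < X t) (hd : ∀ t ∈ I, HasDerivAt X (-(K * r t) * X t) t)
    (hX : Tendsto X (𝓝[>] t₀) atTop) (hr : Tendsto (fun t => r t / X t ^ 2) (𝓝[>] t₀) (𝓝 2)) :
    Tendsto (fun t => X t * √(t - t₀)) (𝓝[>] t₀) (𝓝 (√(1 / (4 * K)))) := by
  have hV0 : Tendsto (fun t => (X t ^ 2)⁻¹) (𝓝[>] t₀) (𝓝 0) :=
    tendsto_inv_atTop_zero.comp ((tendsto_pow_atTop two_ne_zero).comp hX)
  have hτ0 : Tendsto (fun t => t - t₀) (𝓝[>] t₀) (𝓝 0) := by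
    have : Tendsto (fun t => t - t₀) (𝓝 t₀) (𝓝 (t₀ - t₀)) := (continuous_sub_right t₀).tendsto t₀
    rw [sub_self] at this
    exact this.mono_left nhdsWithin_le_nhds
  -- L'Hôpital: both sides vanish at `t₀` and (X⁻²)' = 2K·r/X² tends to 4K.
  have hlh : Tendsto (fun t => (X t ^ 2)⁻¹ / (t - t₀)) (𝓝[>] t₀) (𝓝 (4 * K)) := by
    refine HasDerivAt.lhopital_zero_nhdsGT (f' := fun t => 2 * K * (r t / X t ^ 2))
      (g' := fun _ => 1) ?_ ?_ (by simp) hV0 hτ0 ?_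
    · filter_upwards [hI] with t ht using hasDerivAt_inv_sq (hpos t ht) (hd t ht)
    · exact Eventually.of_forall fun t => (hasDerivAt_id t).sub_const t₀
    · have := hr.const_mul (2 * K)
      simp only [div_one]
      convert this using 2
      ring
  have h2 := (hlh.inv₀ (by positivity)).sqrt
  rw [one_div]
  refine h2.congr' ?_
  filter_upwards [hI, self_mem_nhdsWithin] with t ht htt
  have hXt := hpos t ht
  rw [inv_div, div_inv_eq_mul, mul_comm, Real.sqrt_mul (by positivity), Real.sqrt_sq hXt.le]

/-- Case of one dominant coefficient `X`. Here `ε = 1` if `X = B, Y = A, Z = C` and `ε = -1` if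
`X = A, Y = B, Z = C`. -/
theorem dominant_asymptotics {Y Z : ℝ → ℝ} {P ε : ℝ} (hε : ε ^ 2 = 1) (hI : IsOpen I)
    (hI' : I.OrdConnected) (hK : 0 < K) (hP : 0 < P)
    (hXp : ∀ t ∈ I, 0 < X t) (hYp : ∀ t ∈ I, 0 < Y t) (hZp : ∀ t ∈ I, 0 < Z t)
    (hprod : ∀ t ∈ I, X t * Y t * Z t = P)
    (hX : ∀ t ∈ I, HasDerivAt X
      (-(K * (2 * X t ^ 2 + X t * Y t - ε * (X t * Z t) - (Y t + ε * Z t) ^ 2)) * X t) t)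
    (hY : ∀ t ∈ I, HasDerivAt Y
      (-(K * (2 * Y t ^ 2 + X t * Y t + ε * (Y t * Z t) - (X t - ε * Z t) ^ 2)) * Y t) t)
    (hZ : ∀ t ∈ I, HasDerivAt Z
      (-(K * (2 * Z t ^ 2 + ε * (Y t * Z t) - ε * (X t * Z t) - (X t + Y t) ^ 2)) * Z t) t)
    (hmax : ∀ t₀, IsGLB I t₀ → ∀ p q s, ¬ (Tendsto X (𝓝[>] t₀) (𝓝 p) ∧
      Tendsto Y (𝓝[>] t₀) (𝓝 q) ∧ Tendsto Z (𝓝[>] t₀) (𝓝 s)))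
    {t₁ d : ℝ} (ht₁ : t₁ ∈ I) (hd : 0 < d) (hYZ : ∀ t ∈ I, t ≤ t₁ → 0 ≤ Y t + ε * Z t)
    (hYX : ∀ t ∈ I, t ≤ t₁ → Y t ≤ X t)
    (hD : ∀ t ∈ I, t ≤ t₁ → d * X t ≤ X t - Y t - ε * Z t) :
    ∃ t₀, IsGLB I t₀ ∧ Tendsto (fun t => X t * √(t - t₀)) (𝓝[>] t₀) (𝓝 (√(1 / (4 * K)))) ∧
      ∃ η > 0, ∃ ζ > 0, Tendsto (fun t => Y t * √(X t)) (𝓝[>] t₀) (𝓝 η) ∧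
        Tendsto (fun t => Z t * √(X t)) (𝓝[>] t₀) (𝓝 ζ) := by
  -- With s = Y + εZ the rate equals (X - s)(2X + s) + 2XY, where X - s ≥ dX and s ≥ 0.
  have hrate : ∀ t ∈ I, t ≤ t₁ → (2 * d) * X t ^ 2 ≤
      2 * X t ^ 2 + X t * Y t - ε * (X t * Z t) - (Y t + ε * Z t) ^ 2 := by
    intro t ht htt
    have h1 := hXp t ht
    have h2 := hYp t ht
    have h3 := hYZ t ht htt
    have h4 := hD t ht htt
    nlinarith [mul_pos h1 h2, mul_pos hd h1, mul_nonneg h3 (show 0 ≤ X t - (Y t + ε * Z t) by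
      nlinarith [mul_pos hd h1])]
  have hbdd : BddBelow I := bddBelow_of_deriv_cubic hI' hK hXp hX ht₁ (by positivity : 0 < 2 * d) hrate
  obtain ⟨t₀, ht₀⟩ := Real.exists_isGLB ⟨t₁, ht₁⟩ hbdd
  have ht₀I : t₀ ∉ I := by
    intro hmem
    obtain ⟨l, hl, hlI⟩ := exists_Ioc_subset_of_mem_nhds (hI.mem_nhds hmem) ⟨t₀ - 1, by simp⟩
    have := ht₀.1 (hlI (show (l + t₀) / 2 ∈ Set.Ioc l t₀ from ⟨by linarith, by linarith⟩))
    linarith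
  have ht₀₁ : t₀ < t₁ := lt_of_le_of_ne (ht₀.1 ht₁) fun h => ht₀I (h ▸ ht₁)
  have hsub : Set.Ioc t₀ t₁ ⊆ I := by
    intro t ht
    obtain ⟨r, hr, hrt⟩ := (isGLB_lt_iff ht₀).1 ht.1
    exact hI'.out hr ht₁ ⟨hrt.le, ht.2⟩
  have hev : ∀ᶠ t in 𝓝[>] t₀, t ∈ Set.Ioo t₀ t₁ := Ioo_mem_nhdsGT ht₀₁
  have hevI : ∀ᶠ t in 𝓝[>] t₀, t ∈ I := hev.mono fun t ht => hsub ⟨ht.1, ht.2.le⟩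
  have hR : ∀ t ∈ I, HasDerivAt (fun t => Y t / Z t)
      (-(3 * K * ((Y t + ε * Z t) * (X t + Y t - ε * Z t))) * (Y t / Z t)) t := by
    intro t ht
    have h3 := hZp t ht
    refine ((hY t ht).fun_div (hZ t ht) h3.ne').congr_deriv ?_
    field_simp
    linear_combination (-2 * Y t * Z t ^ 2) * hε
  have hu : ∀ t ∈ I, HasDerivAt (fun t => Y t / X t)
      (3 * K * ((X t + Y t) * (X t - Y t - ε * Z t)) * (Y t / X t)) t := by
    intro t ht
    have h1 := hXp t ht
    refine ((hY t ht).fun_div (hX t ht) h1.ne').congr_deriv ?_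
    field_simp
    ring
  have hfac : ∀ t ∈ I, t ≤ t₁ → 0 ≤ X t + Y t - ε * Z t := by
    intro t ht htt
    nlinarith [hXp t ht, hYp t ht, hD t ht htt, mul_pos hd (hXp t ht)]
  have hRpos : ∀ t ∈ I, 0 < Y t / Z t := fun t ht => div_pos (hYp t ht) (hZp t ht)
  have hRanti : AntitoneOn (fun t => Y t / Z t) (Set.Ioc t₀ t₁) := by
    refine antitoneOn_of_hasDerivWithinAt_nonpos (convex_Ioc _ _)
      (fun t ht => (hR t (hsub ht)).continuousAt.continuousWithinAt)
      (fun t ht => (hR t (hsub (interior_subset ht))).hasDerivWithinAt) fun t ht => ?_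
    have ht' := interior_subset ht
    have := mul_nonneg (hYZ t (hsub ht') ht'.2) (hfac t (hsub ht') ht'.2)
    have h2 := hRpos t (hsub ht')
    rw [neg_mul, neg_nonpos]
    positivity
  set R₁ := Y t₁ / Z t₁ with hR₁
  have hR₁pos : 0 < R₁ := hRpos t₁ ht₁
  have hR₁le : ∀ t ∈ Set.Ioc t₀ t₁, R₁ ≤ Y t / Z t := fun t ht =>
    hRanti ht ⟨ht₀₁, le_rfl⟩ ht.2
  have hZle : ∀ t ∈ Set.Ioc t₀ t₁, Z t ≤ Y t / R₁ := by
    intro t ht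
    have h1 := hR₁le t ht
    rw [le_div_iff₀ (hZp t (hsub ht))] at h1
    rw [le_div_iff₀ hR₁pos]
    linarith
  -- Chosen so that M·(dXY) equals the bound (1+1/R₁)Y·(2+1/R₁)X on the decay rate of log(Y/Z), up
  -- to the common factor 3K.
  set M := (1 + 1 / R₁) * (2 + 1 / R₁) / d with hM
  have hMpos : 0 < M := by positivity
  have habs : |ε| = 1 :=
    (pow_eq_one_iff_of_nonneg (abs_nonneg ε) two_ne_zero).1 (by rw [sq_abs, hε])
  -- Backward in time Y/Z does not decrease. This corrected logarithm is nondecreasing in t, so it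
  -- bounds Y/Z from above and gives a finite limit.
  have hmono : MonotoneOn (fun t => Real.log (Y t / Z t) + M * (Y t / X t)) (Set.Ioc t₀ t₁) := by
    have hder : ∀ t ∈ I, HasDerivAt (fun t => Real.log (Y t / Z t) + M * (Y t / X t))
        (-(3 * K * ((Y t + ε * Z t) * (X t + Y t - ε * Z t))) +
          M * (3 * K * ((X t + Y t) * (X t - Y t - ε * Z t)) * (Y t / X t))) t := by
      intro t ht
      refine (((hR t ht).log (hRpos t ht).ne').add ((hu t ht).const_mul M)).congr_deriv ?_
      rw [mul_div_cancel_right₀ _ (hRpos t ht).ne']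
    refine monotoneOn_of_hasDerivWithinAt_nonneg (convex_Ioc _ _)
      (fun t ht => (hder t (hsub ht)).continuousAt.continuousWithinAt)
      (fun t ht => (hder t (hsub (interior_subset ht))).hasDerivWithinAt) fun t ht => ?_
    have ht' := interior_subset ht
    have h1 := hXp t (hsub ht')
    have h2 := hYp t (hsub ht')
    have h3 := hZp t (hsub ht')
    have hD' := hD t (hsub ht') ht'.2
    have hYX' := hYX t (hsub ht') ht'.2
    have hf := hfac t (hsub ht') ht'.2
    have hzle := hZle t ht'
    have hεZ : |ε * Z t| ≤ Y t / R₁ := by rw [abs_mul, habs, one_mul, abs_of_pos h3]; exact hzle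
    obtain ⟨e1, e2⟩ := abs_le.1 hεZ
    have hs1 : Y t + ε * Z t ≤ (1 + 1 / R₁) * Y t := by
      have : (1 + 1 / R₁) * Y t = Y t + Y t / R₁ := by ring
      linarith
    have hs2 : X t + Y t - ε * Z t ≤ (2 + 1 / R₁) * X t := by
      have : (2 + 1 / R₁) * X t = 2 * X t + X t / R₁ := by ring
      have : Y t / R₁ ≤ X t / R₁ := div_le_div_of_nonneg_right hYX' hR₁pos.le
      linarith
    have hprod1 : (Y t + ε * Z t) * (X t + Y t - ε * Z t) ≤
        ((1 + 1 / R₁) * Y t) * ((2 + 1 / R₁) * X t) :=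
      mul_le_mul hs1 hs2 hf (by positivity)
    have hprod2 : d * X t * Y t ≤ (X t + Y t) * (X t - Y t - ε * Z t) * (Y t / X t) := by
      have : d * X t * Y t = (X t * (d * X t)) * (Y t / X t) := by field_simp
      rw [this]
      refine mul_le_mul_of_nonneg_right ?_ (by positivity)
      exact mul_le_mul (by linarith) hD' (by positivity) (by positivity)
    have hMd : M * (d * X t * Y t) = ((1 + 1 / R₁) * Y t) * ((2 + 1 / R₁) * X t) := by
      rw [hM]; field_simp
    have := mul_le_mul_of_nonneg_left hprod2 hMpos.le
    nlinarith
  have hRlim : ∃ L, Tendsto (fun t => Y t / Z t) (𝓝[>] t₀) (𝓝 L) ∧ R₁ ≤ L := by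
    rcases (hRanti.mono Set.Ioo_subset_Ioc_self).tendsto_nhdsGT_atTop_or_nhds ht₀₁ with h | ⟨L, hL, hle⟩
    · exfalso
      have hlog := Real.tendsto_log_atTop.comp h
      obtain ⟨t, ht, hgt⟩ := (hev.and (hlog.eventually_gt_atTop (Real.log R₁ + M * (Y t₁ / X t₁)))).exists
      have h1 := hmono (Set.Ioo_subset_Ioc_self ht) ⟨ht₀₁, le_rfl⟩ ht.2.le
      have h2 : 0 < M * (Y t / X t) := by
        have := hXp t (hsub (Set.Ioo_subset_Ioc_self ht))
        have := hYp t (hsub (Set.Ioo_subset_Ioc_self ht))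
        positivity
      simp only [Function.comp_apply] at hgt h1
      rw [← hR₁] at h1
      linarith
    · refine ⟨L, hL, ge_of_tendsto hL ?_⟩
      filter_upwards [hev] with t ht using hR₁le t (Set.Ioo_subset_Ioc_self ht)
  obtain ⟨L, hL, hRL⟩ := hRlim
  have hLpos : 0 < L := hR₁pos.trans_le hRL
  -- Since XYZ = P, the ratio Y/Z alone determines Y√X and Z√X.
  have hYeq : ∀ t ∈ I, Y t * √(X t) = √(P * (Y t / Z t)) := by
    intro t ht
    have h1 := hXp t ht
    have h2 := hYp t ht
    have h3 := hZp t ht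
    rw [← hprod t ht, show X t * Y t * Z t * (Y t / Z t) = Y t ^ 2 * X t by field_simp,
      Real.sqrt_mul (by positivity), Real.sqrt_sq h2.le]
  have hZeq : ∀ t ∈ I, Z t * √(X t) = √(P / (Y t / Z t)) := by
    intro t ht
    have h1 := hXp t ht
    have h2 := hYp t ht
    have h3 := hZp t ht
    rw [← hprod t ht, show X t * Y t * Z t / (Y t / Z t) = Z t ^ 2 * X t by field_simp,
      Real.sqrt_mul (by positivity), Real.sqrt_sq h3.le]
  have hYlim : Tendsto (fun t => Y t * √(X t)) (𝓝[>] t₀) (𝓝 (√(P * L))) :=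
    (hL.const_mul P).sqrt.congr' (hevI.mono fun t ht => (hYeq t ht).symm)
  have hZlim : Tendsto (fun t => Z t * √(X t)) (𝓝[>] t₀) (𝓝 (√(P / L))) :=
    (tendsto_const_nhds.div hL hLpos.ne').sqrt.congr' (hevI.mono fun t ht => (hZeq t ht).symm)
  have hXanti : AntitoneOn X (Set.Ioo t₀ t₁) := by
    refine antitoneOn_of_hasDerivWithinAt_nonpos (convex_Ioo _ _)
      (fun t ht => (hX t (hsub (Set.Ioo_subset_Ioc_self ht))).continuousAt.continuousWithinAt)
      (fun t ht => (hX t (hsub (Set.Ioo_subset_Ioc_self (interior_subset ht)))).hasDerivWithinAt)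
      fun t ht => ?_
    have ht' := Set.Ioo_subset_Ioc_self (interior_subset ht)
    have h1 := hXp t (hsub ht')
    have h2 := hrate t (hsub ht') ht'.2
    have h3 : 0 ≤ 2 * X t ^ 2 + X t * Y t - ε * (X t * Z t) - (Y t + ε * Z t) ^ 2 :=
      le_trans (by positivity) h2
    rw [neg_mul, neg_nonpos]
    positivity
  have hXtop : Tendsto X (𝓝[>] t₀) atTop := by
    rcases hXanti.tendsto_nhdsGT_atTop_or_nhds ht₀₁ with h | ⟨p, hp, hle⟩
    · exact h
    -- A finite limit of X would force Y and Z to converge as well, which maximality excludes.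
    exfalso
    have hp0 : 0 < p := by
      obtain ⟨t, ht⟩ := hev.exists
      exact (hXp t (hsub (Set.Ioo_subset_Ioc_self ht))).trans_le (hle t ht)
    have hsq : √p ≠ 0 := (Real.sqrt_pos.2 hp0).ne'
    refine hmax t₀ ht₀ p (√(P * L) / √p) (√(P / L) / √p) ⟨hp, ?_, ?_⟩
    · refine (hYlim.div hp.sqrt hsq).congr' (hevI.mono fun t ht => ?_)
      rw [Pi.div_apply, mul_div_cancel_right₀ _ (Real.sqrt_pos.2 (hXp t ht)).ne']
    · refine (hZlim.div hp.sqrt hsq).congr' (hevI.mono fun t ht => ?_)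
      rw [Pi.div_apply, mul_div_cancel_right₀ _ (Real.sqrt_pos.2 (hXp t ht)).ne']
  have hinv : Tendsto (fun t => (X t * √(X t))⁻¹) (𝓝[>] t₀) (𝓝 0) :=
    tendsto_inv_atTop_zero.comp (hXtop.atTop_mul_atTop₀ (Real.tendsto_sqrt_atTop.comp hXtop))
  have hu0 : Tendsto (fun t => Y t / X t) (𝓝[>] t₀) (𝓝 0) := by
    have := hYlim.mul hinv
    rw [mul_zero] at this
    refine this.congr' (hevI.mono fun t ht => ?_)
    have h1 := hXp t ht
    have h2 := Real.sqrt_pos.2 h1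
    field_simp
  have hw0 : Tendsto (fun t => Z t / X t) (𝓝[>] t₀) (𝓝 0) := by
    have := hZlim.mul hinv
    rw [mul_zero] at this
    refine this.congr' (hevI.mono fun t ht => ?_)
    have h1 := hXp t ht
    have h2 := Real.sqrt_pos.2 h1
    field_simp
  refine ⟨t₀, ht₀, ?_, _, Real.sqrt_pos.2 (mul_pos hP hLpos), _, Real.sqrt_pos.2 (div_pos hP hLpos),
    hYlim, hZlim⟩
  refine tendsto_mul_sqrt_of_deriv_cubic hK hevI hXp hX hXtop ?_
  have h := ((hu0.const_add 2).sub (hw0.const_mul ε)).sub ((hu0.add (hw0.const_mul ε)).pow 2)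
  have h2 : (2 : ℝ) + 0 - ε * 0 - (0 + ε * 0) ^ 2 = 2 := by ring
  rw [h2] at h
  refine h.congr' (hevI.mono fun t ht => ?_)
  have h1 := hXp t ht
  field_simp

end Blowup

/-! ### Backward behavior of diagonal flows -/

section DiagonalFlow

/-- The coefficients of a maximal diagonal normalized Ricci flow with `b > c` and `a b c = P`, where
`K = 8 / (3 P)`. -/
structure IsDiagonalFlow (P K : ℝ) (I : Set ℝ) (a b c : ℝ → ℝ) : Prop where
  isOpen : IsOpen I
  ordConnected : I.OrdConnected
  zero_mem : (0 : ℝ) ∈ I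
  P_pos : 0 < P
  K_pos : 0 < K
  a_pos : ∀ t ∈ I, 0 < a t
  b_pos : ∀ t ∈ I, 0 < b t
  c_pos : ∀ t ∈ I, 0 < c t
  c_lt_b : ∀ t ∈ I, c t < b t
  prod_eq : ∀ t ∈ I, a t * b t * c t = P
  deriv_a : ∀ t ∈ I, HasDerivAt a
    (-K * (2 * a t ^ 2 + a t * b t + a t * c t - (b t - c t) ^ 2) * a t) t
  deriv_b : ∀ t ∈ I, HasDerivAt b
    (-K * (2 * b t ^ 2 + a t * b t - b t * c t - (a t + c t) ^ 2) * b t) t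
  deriv_c : ∀ t ∈ I, HasDerivAt c
    (-K * (2 * c t ^ 2 + a t * c t - b t * c t - (a t + b t) ^ 2) * c t) t
  not_tendsto : ∀ t₀, IsGLB I t₀ → ∀ p q s, ¬ (Tendsto a (𝓝[>] t₀) (𝓝 p) ∧
    Tendsto b (𝓝[>] t₀) (𝓝 q) ∧ Tendsto c (𝓝[>] t₀) (𝓝 s))

namespace IsDiagonalFlow

variable {P K : ℝ} {I : Set ℝ} {a b c : ℝ → ℝ}

theorem glb_notMem (h : IsDiagonalFlow P K I a b c) {t₀ : ℝ} (ht₀ : IsGLB I t₀) : t₀ ∉ I := by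
  intro hmem
  obtain ⟨l, hl, hlI⟩ := exists_Ioc_subset_of_mem_nhds (h.isOpen.mem_nhds hmem) ⟨t₀ - 1, by simp⟩
  have := ht₀.1 (hlI (show (l + t₀) / 2 ∈ Set.Ioc l t₀ from ⟨by linarith, by linarith⟩))
  linarith

theorem glb_neg (h : IsDiagonalFlow P K I a b c) {t₀ : ℝ} (ht₀ : IsGLB I t₀) : t₀ < 0 :=
  lt_of_le_of_ne (ht₀.1 h.zero_mem) fun h0 => h.glb_notMem ht₀ (h0 ▸ h.zero_mem)

theorem Ioc_subset (h : IsDiagonalFlow P K I a b c) {t₀ : ℝ} (ht₀ : IsGLB I t₀) :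
    Set.Ioc t₀ 0 ⊆ I := by
  intro t ht
  obtain ⟨r, hr, hrt⟩ := (isGLB_lt_iff ht₀).1 ht.1
  exact h.ordConnected.out hr h.zero_mem ⟨hrt.le, ht.2⟩

theorem eventually_mem (h : IsDiagonalFlow P K I a b c) {t₀ : ℝ} (ht₀ : IsGLB I t₀) :
    ∀ᶠ t in 𝓝[>] t₀, t ∈ Set.Ioo t₀ 0 := Ioo_mem_nhdsGT (h.glb_neg ht₀)

theorem continuousOn_a (h : IsDiagonalFlow P K I a b c) : ContinuousOn a I :=
  fun t ht => (h.deriv_a t ht).continuousAt.continuousWithinAt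

theorem continuousOn_b (h : IsDiagonalFlow P K I a b c) : ContinuousOn b I :=
  fun t ht => (h.deriv_b t ht).continuousAt.continuousWithinAt

theorem continuousOn_c (h : IsDiagonalFlow P K I a b c) : ContinuousOn c I :=
  fun t ht => (h.deriv_c t ht).continuousAt.continuousWithinAt

theorem deriv_c_div_b (h : IsDiagonalFlow P K I a b c) {t : ℝ} (ht : t ∈ I) :
    HasDerivAt (fun t => c t / b t)
      (3 * K * ((b t - c t) * (a t + b t + c t)) * (c t / b t)) t := by
  have := h.b_pos t ht
  refine ((h.deriv_c t ht).fun_div (h.deriv_b t ht) this.ne').congr_deriv ?_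
  field_simp
  ring

theorem deriv_a_div_b (h : IsDiagonalFlow P K I a b c) {t : ℝ} (ht : t ∈ I) :
    HasDerivAt (fun t => a t / b t)
      (-(3 * K * ((a t + b t) * (a t + c t - b t))) * (a t / b t)) t := by
  have := h.b_pos t ht
  refine ((h.deriv_a t ht).fun_div (h.deriv_b t ht) this.ne').congr_deriv ?_
  field_simp
  ring

theorem deriv_b_div_a (h : IsDiagonalFlow P K I a b c) {t : ℝ} (ht : t ∈ I) :
    HasDerivAt (fun t => b t / a t)
      (3 * K * ((a t + b t) * (a t + c t - b t)) * (b t / a t)) t := by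
  have := h.a_pos t ht
  refine ((h.deriv_b t ht).fun_div (h.deriv_a t ht) this.ne').congr_deriv ?_
  field_simp
  ring

theorem monotoneOn_c_div_b (h : IsDiagonalFlow P K I a b c) :
    MonotoneOn (fun t => c t / b t) I := by
  refine monotoneOn_of_hasDerivWithinAt_nonneg h.ordConnected.convex
      (fun t ht => (h.deriv_c_div_b ht).continuousAt.continuousWithinAt)
      (fun t ht => (h.deriv_c_div_b (interior_subset ht)).hasDerivWithinAt) fun t ht => ?_
  have ht' := interior_subset ht
  have h1 := h.a_pos t ht'
  have h2 := h.b_pos t ht'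
  have h3 := h.c_pos t ht'
  have h4 := sub_pos.2 (h.c_lt_b t ht')
  have := h.K_pos
  positivity

/-- Orbits with `b - c ≤ a ≤ b`. -/
theorem strip_asymptotics (h : IsDiagonalFlow P K I a b c)
    (hs : ∀ t ∈ I, t ≤ 0 → a t ≤ b t ∧ b t ≤ a t + c t) :
    ∃ t₀, IsGLB I t₀ ∧ Tendsto (fun t => c t / b t) (𝓝[>] t₀) (𝓝 0) ∧
      Tendsto (fun t => a t / b t) (𝓝[>] t₀) (𝓝 1) ∧
      Tendsto (fun t => b t * √(t - t₀)) (𝓝[>] t₀) (𝓝 (√(1 / (4 * K)))) := by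
  have hK := h.K_pos
  have hdb : ∀ t ∈ I, HasDerivAt b
      (-(K * (2 * b t ^ 2 + a t * b t - b t * c t - (a t + c t) ^ 2)) * b t) t := fun t ht =>
    (h.deriv_b t ht).congr_deriv (by ring)
  have hbdd : BddBelow I := by
    by_contra hb
    have hmem : ∀ t ≤ (0 : ℝ), t ∈ I := by
      intro t ht
      obtain ⟨r, hr, hrt⟩ := not_bddBelow_iff.1 hb t
      exact h.ordConnected.out hr h.zero_mem ⟨hrt.le, ht⟩
    -- Either b ≥ 1, or a ≤ b and c ≤ 1 give P = abc ≤ b². In both cases b² ≥ m, so log(c/b) grows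
    -- at a rate at least μ = 3Km(1 - w₀).
    set m := min 1 P with hm
    have hmpos : 0 < m := lt_min one_pos h.P_pos
    have hbm : ∀ t ≤ (0 : ℝ), m ≤ b t ^ 2 := by
      intro t ht
      have h1 := h.a_pos t (hmem t ht)
      have h2 := h.b_pos t (hmem t ht)
      have h3 := h.c_pos t (hmem t ht)
      have h4 := h.c_lt_b t (hmem t ht)
      have h5 := (hs t (hmem t ht) ht).1
      rcases le_total 1 (b t) with hb1 | hb1
      · exact (min_le_left _ _).trans (by nlinarith)
      · refine (min_le_right _ _).trans ?_
        rw [← h.prod_eq t (hmem t ht)]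
        have : a t * c t ≤ b t * 1 := mul_le_mul h5 (by linarith) h3.le h2.le
        nlinarith
    have h0 := h.zero_mem
    set w₀ := c 0 / b 0 with hw₀
    have hw₀1 : w₀ < 1 := (div_lt_one (h.b_pos 0 h0)).2 (h.c_lt_b 0 h0)
    set μ := 3 * K * m * (1 - w₀) with hμ
    have hμpos : 0 < μ := by have := sub_pos.2 hw₀1; positivity
    have hmono : MonotoneOn (fun t => Real.log (c t / b t) - μ * t) (Set.Iic 0) := by
      have hder : ∀ t ≤ (0 : ℝ), HasDerivAt (fun t => Real.log (c t / b t) - μ * t)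
          (3 * K * ((b t - c t) * (a t + b t + c t)) - μ) t := by
        intro t ht
        have hne : c t / b t ≠ 0 := (div_pos (h.c_pos t (hmem t ht)) (h.b_pos t (hmem t ht))).ne'
        refine (((h.deriv_c_div_b (hmem t ht)).log hne).fun_sub
          ((hasDerivAt_id t).const_mul μ)).congr_deriv ?_
        rw [mul_div_cancel_right₀ _ hne, mul_one]
      refine monotoneOn_of_hasDerivWithinAt_nonneg (convex_Iic _)
        (fun t ht => (hder t ht).continuousAt.continuousWithinAt)
        (fun t ht => (hder t (interior_subset (s := Set.Iic (0 : ℝ)) ht)).hasDerivWithinAt)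
        fun t ht => ?_
      have ht' : t ≤ 0 := interior_subset (s := Set.Iic (0 : ℝ)) ht
      have h1 := h.a_pos t (hmem t ht')
      have h2 := h.b_pos t (hmem t ht')
      have h3 := h.c_pos t (hmem t ht')
      have h5 : c t / b t ≤ w₀ := h.monotoneOn_c_div_b (hmem t ht') h0 ht'
      rw [div_le_iff₀ h2] at h5
      have h6 : b t * (1 - w₀) ≤ b t - c t := by linarith
      have h7 : b t * (1 - w₀) * b t ≤ (b t - c t) * (a t + b t + c t) :=
        mul_le_mul h6 (by linarith) h2.le (by have := h.c_lt_b t (hmem t ht'); linarith)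
      have h8 : m * (1 - w₀) ≤ b t * (1 - w₀) * b t := by
        have := mul_le_mul_of_nonneg_right (hbm t ht') (sub_pos.2 hw₀1).le
        nlinarith
      rw [hμ, sub_nonneg]
      nlinarith
    -- Before `t₁` the linear decay gives c ≤ b/8. The strip then gives a ≥ 7b/8 and a + c ≤ 9b/8,
    -- so the rate of b is at least b² and b blows up in finite time.
    set t₁ := min 0 ((Real.log (1 / 8) - Real.log w₀) / μ) with ht₁
    have ht₁0 : t₁ ≤ 0 := min_le_left _ _
    have hw8 : ∀ t ≤ t₁, c t ≤ b t / 8 := by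
      intro t ht
      have ht0 := ht.trans ht₁0
      have h1 := hmono (Set.mem_Iic.2 ht0) (Set.mem_Iic.2 le_rfl) ht0
      simp only [mul_zero, sub_zero] at h1
      have h2 : t ≤ (Real.log (1 / 8) - Real.log w₀) / μ := ht.trans (min_le_right _ _)
      rw [le_div_iff₀ hμpos] at h2
      have h3 : Real.log (c t / b t) ≤ Real.log (1 / 8) := by
        rw [← hw₀] at h1
        linarith
      have h4 := (Real.log_le_log_iff (div_pos (h.c_pos t (hmem t ht0)) (h.b_pos t (hmem t ht0)))
        (by norm_num)).1 h3
      rw [div_le_iff₀ (h.b_pos t (hmem t ht0))] at h4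
      linarith
    refine hb (bddBelow_of_deriv_cubic h.ordConnected hK h.b_pos hdb (hmem t₁ ht₁0) one_pos ?_)
    intro t ht htt
    have h1 := h.a_pos t ht
    have h2 := h.b_pos t ht
    have h3 := h.c_pos t ht
    have h4 := hw8 t htt
    have h5 := hs t ht (htt.trans ht₁0)
    have h6 : 7 / 8 * b t ≤ a t := by linarith
    have h7 : a t + c t ≤ 9 / 8 * b t := by linarith
    nlinarith [mul_le_mul_of_nonneg_left h6 h2.le, mul_le_mul_of_nonneg_left h4 h2.le,
      mul_le_mul h7 h7 (by positivity) (by positivity)]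
  obtain ⟨t₀, ht₀⟩ := Real.exists_isGLB ⟨0, h.zero_mem⟩ hbdd
  have ht₀0 := h.glb_neg ht₀
  have hsub' := h.Ioc_subset ht₀
  have hsub : Set.Ioo t₀ 0 ⊆ I := Set.Ioo_subset_Ioc_self.trans hsub'
  have hev := h.eventually_mem ht₀
  have hevI : ∀ᶠ t in 𝓝[>] t₀, t ∈ I := hev.mono fun t ht => hsub ht
  have hbddw : BddBelow ((fun t => c t / b t) '' Set.Ioo t₀ 0) := by
    refine ⟨0, ?_⟩
    rintro _ ⟨t, ht, rfl⟩
    exact (div_pos (h.c_pos t (hsub ht)) (h.b_pos t (hsub ht))).le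
  have hwlim := (h.monotoneOn_c_div_b.mono hsub).tendsto_nhdsWithin_Ioo_right
    (Set.nonempty_Ioo.2 ht₀0) hbddw
  set L := sInf ((fun t => c t / b t) '' Set.Ioo t₀ 0) with hLdef
  have hL0 : 0 ≤ L := ge_of_tendsto hwlim (hevI.mono fun t ht =>
    (div_pos (h.c_pos t ht) (h.b_pos t ht)).le)
  have hzanti : AntitoneOn (fun t => a t / b t) (Set.Ioc t₀ 0) := by
    refine antitoneOn_of_hasDerivWithinAt_nonpos (convex_Ioc _ _)
      (fun t ht => (h.deriv_a_div_b (hsub' ht)).continuousAt.continuousWithinAt)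
      (fun t ht => (h.deriv_a_div_b (hsub' (interior_subset ht))).hasDerivWithinAt) fun t ht => ?_
    have ht' := interior_subset ht
    have h1 := h.a_pos t (hsub' ht')
    have h2 := h.b_pos t (hsub' ht')
    have h3 : 0 ≤ a t + c t - b t := by linarith [(hs t (hsub' ht') ht'.2).2]
    rw [neg_mul, neg_nonpos]
    positivity
  have hz0 : 0 < a 0 / b 0 := div_pos (h.a_pos 0 h.zero_mem) (h.b_pos 0 h.zero_mem)
  obtain ⟨ζ, hζ, hζ0⟩ : ∃ ζ, Tendsto (fun t => a t / b t) (𝓝[>] t₀) (𝓝 ζ) ∧ 0 < ζ := by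
    rcases (hzanti.mono Set.Ioo_subset_Ioc_self).tendsto_nhdsGT_atTop_or_nhds ht₀0 with hh | ⟨ζ, hh, _⟩
    · exfalso
      obtain ⟨t, ht, hgt⟩ := (hev.and (hh.eventually_gt_atTop 1)).exists
      have := (hs t (hsub ht) ht.2.le).1
      rw [lt_div_iff₀ (h.b_pos t (hsub ht))] at hgt
      linarith
    · refine ⟨ζ, hh, hz0.trans_le (ge_of_tendsto hh (hev.mono fun t ht => ?_))⟩
      exact hzanti (Set.Ioo_subset_Ioc_self ht) ⟨ht₀0, le_rfl⟩ ht.2.le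
  -- The product abc = P reads b³ = P/(zw), so the limits of the ratios determine that of b.
  have hb3 : ∀ t ∈ I, b t = (P / ((a t / b t) * (c t / b t))) ^ ((3 : ℕ) : ℝ)⁻¹ := by
    intro t ht
    have h1 := h.a_pos t ht
    have h2 := h.b_pos t ht
    have h3 := h.c_pos t ht
    have : P / ((a t / b t) * (c t / b t)) = b t ^ 3 := by
      rw [← h.prod_eq t ht]
      field_simp
    rw [this, Real.pow_rpow_inv_natCast h2.le three_ne_zero]
  -- If w had a positive limit, a, b and c would all converge, contrary to maximality.
  have hL : L = 0 := by
    by_contra hne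
    have hζL : ζ * L ≠ 0 := mul_ne_zero hζ0.ne' hne
    have hblim : Tendsto b (𝓝[>] t₀) (𝓝 ((P / (ζ * L)) ^ ((3 : ℕ) : ℝ)⁻¹)) := by
      refine Tendsto.congr' (hevI.mono fun t ht => (hb3 t ht).symm) ?_
      exact (tendsto_const_nhds.div (hζ.mul hwlim) hζL).rpow_const (Or.inr (by positivity))
    have halim := (hζ.mul hblim).congr' (hevI.mono fun t ht => div_mul_cancel₀ _ (h.b_pos t ht).ne')
    have hclim := (hwlim.mul hblim).congr'
      (hevI.mono fun t ht => div_mul_cancel₀ _ (h.b_pos t ht).ne')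
    exact h.not_tendsto t₀ ht₀ _ _ _ ⟨halim, hblim, hclim⟩
  rw [hL] at hwlim
  have hzlim : Tendsto (fun t => a t / b t) (𝓝[>] t₀) (𝓝 1) := by
    have h1 : Tendsto (fun t => 1 - c t / b t) (𝓝[>] t₀) (𝓝 1) := by
      simpa using hwlim.const_sub 1
    refine tendsto_of_tendsto_of_tendsto_of_le_of_le' h1 tendsto_const_nhds ?_ ?_
    · filter_upwards [hev] with t ht
      have h2 := h.b_pos t (hsub ht)
      rw [sub_le_iff_le_add, ← add_div, le_div_iff₀ h2]
      linarith [(hs t (hsub ht) ht.2.le).2]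
    · filter_upwards [hev] with t ht
      exact (div_le_one (h.b_pos t (hsub ht))).2 (hs t (hsub ht) ht.2.le).1
  refine ⟨t₀, ht₀, hwlim, hzlim, ?_⟩
  have hbtop : Tendsto b (𝓝[>] t₀) atTop := by
    refine Tendsto.congr' (hevI.mono fun t ht => (hb3 t ht).symm) ?_
    refine (tendsto_rpow_atTop (by positivity)).comp ?_
    have h1 : Tendsto (fun t => (a t / b t) * (c t / b t)) (𝓝[>] t₀) (𝓝[>] 0) := by
      refine tendsto_nhdsWithin_iff.2 ⟨by simpa using hzlim.mul hwlim, hevI.mono fun t ht => ?_⟩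
      have h1 := h.a_pos t ht
      have h2 := h.b_pos t ht
      have h3 := h.c_pos t ht
      simp only [Set.mem_Ioi]
      positivity
    simp_rw [div_eq_mul_inv P]
    exact (tendsto_inv_nhdsGT_zero.comp h1).const_mul_atTop h.P_pos
  refine tendsto_mul_sqrt_of_deriv_cubic hK hevI h.b_pos hdb hbtop ?_
  have hlim := ((hzlim.const_add 2).sub hwlim).sub ((hzlim.add hwlim).pow 2)
  have h2 : (2 : ℝ) + 1 - 0 - (1 + 0) ^ 2 = 2 := by norm_num
  rw [h2] at hlim
  refine hlim.congr' (hevI.mono fun t ht => ?_)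
  have h1 := h.b_pos t ht
  field_simp

/-- Orbits on which `b` dominates at some time. -/
theorem asymptotics_of_b_dominant (h : IsDiagonalFlow P K I a b c) {t₁ : ℝ} (ht₁ : t₁ ∈ I)
    (hlt : a t₁ + c t₁ < b t₁) :
    ∃ t₀, IsGLB I t₀ ∧ Tendsto (fun t => b t * √(t - t₀)) (𝓝[>] t₀) (𝓝 (√(1 / (4 * K)))) ∧
      ∃ η > 0, ∃ ζ > 0, Tendsto (fun t => a t * √(b t)) (𝓝[>] t₀) (𝓝 η) ∧
        Tendsto (fun t => c t * √(b t)) (𝓝[>] t₀) (𝓝 ζ) := by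
  have hK := h.K_pos
  have hy : ∀ t ∈ I, HasDerivAt (fun t => 1 - a t / b t - c t / b t)
      (-(-(3 * K * ((a t + b t) * (a t + c t - b t))) * (a t / b t)) -
        3 * K * ((b t - c t) * (a t + b t + c t)) * (c t / b t)) t := fun t ht =>
    ((h.deriv_a_div_b ht).const_sub 1).fun_sub (h.deriv_c_div_b ht)
  -- The contribution of (c/b)' to the derivative of y = 1 - (a+c)/b is nonpositive. Without it y
  -- satisfies the linear equation with this rate.
  have hge := backward_ge_of_deriv_le_mul (k := fun t => -(3 * K * ((a t + b t) * a t)))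
    h.isOpen h.ordConnected ?_ hy ht₁ ?_ ?_ ?_
  · set d := 1 - a t₁ / b t₁ - c t₁ / b t₁ with hd
    have hdpos : 0 < d := by
      have := h.b_pos t₁ ht₁
      rw [hd, sub_sub, ← add_div, sub_pos, div_lt_one this]
      exact hlt
    have hD : ∀ t ∈ I, t ≤ t₁ → d * b t ≤ b t - a t - 1 * c t := by
      intro t ht htt
      have h1 := hge t ht htt
      have h2 := h.b_pos t ht
      have h3 : (1 - a t / b t - c t / b t) * b t = b t - a t - 1 * c t := by field_simp
      rw [← h3]
      exact mul_le_mul_of_nonneg_right h1 h2.le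
    refine dominant_asymptotics (ε := 1) (by norm_num) h.isOpen h.ordConnected hK h.P_pos
      h.b_pos h.a_pos h.c_pos (fun t ht => by rw [← h.prod_eq t ht]; ring)
      (fun t ht => (h.deriv_b t ht).congr_deriv (by ring))
      (fun t ht => (h.deriv_a t ht).congr_deriv (by ring))
      (fun t ht => (h.deriv_c t ht).congr_deriv (by ring))
      (fun t₀ ht₀ p q s hh => h.not_tendsto t₀ ht₀ q p s ⟨hh.2.1, hh.1, hh.2.2⟩)
      ht₁ hdpos ?_ ?_ hD
    · intro t ht _
      linarith [h.a_pos t ht, h.c_pos t ht]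
    · intro t ht htt
      linarith [hD t ht htt, h.c_pos t ht, mul_pos hdpos (h.b_pos t ht)]
  · exact ((continuousOn_const.mul ((h.continuousOn_a.add h.continuousOn_b).mul
      h.continuousOn_a))).neg
  · intro t ht _
    have h1 := h.a_pos t ht
    have h2 := h.b_pos t ht
    have h3 := h.c_pos t ht
    have h4 := sub_pos.2 (h.c_lt_b t ht)
    have h5 : -(3 * K * ((a t + b t) * a t)) * (1 - a t / b t - c t / b t) =
        -(-(3 * K * ((a t + b t) * (a t + c t - b t))) * (a t / b t)) := by
      field_simp
      ring
    rw [h5, sub_le_self_iff]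
    positivity
  · intro t ht
    have h1 := h.a_pos t ht
    have h2 := h.b_pos t ht
    rw [neg_nonpos]
    positivity
  · have := h.b_pos t₁ ht₁
    rw [sub_sub, ← add_div, sub_pos, div_lt_one this]
    exact hlt

/-- Orbits on which `a` dominates at some time. -/
theorem asymptotics_of_a_dominant (h : IsDiagonalFlow P K I a b c) {t₁ : ℝ} (ht₁ : t₁ ∈ I)
    (hlt : b t₁ < a t₁) :
    ∃ t₀, IsGLB I t₀ ∧ Tendsto (fun t => a t * √(t - t₀)) (𝓝[>] t₀) (𝓝 (√(1 / (4 * K)))) ∧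
      ∃ η > 0, ∃ ζ > 0, Tendsto (fun t => b t * √(a t)) (𝓝[>] t₀) (𝓝 η) ∧
        Tendsto (fun t => c t * √(a t)) (𝓝[>] t₀) (𝓝 ζ) := by
  have hK := h.K_pos
  have hy : ∀ t ∈ I, HasDerivAt (fun t => 1 - b t / a t)
      (-(3 * K * ((a t + b t) * (a t + c t - b t)) * (b t / a t))) t := fun t ht =>
    (h.deriv_b_div_a ht).const_sub 1
  -- Replacing a + c - b by the smaller a - b turns the derivative of 1 - b/a into a linear
  -- inequality with this rate.
  have hge := backward_ge_of_deriv_le_mul (k := fun t => -(3 * K * ((a t + b t) * b t)))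
    h.isOpen h.ordConnected ?_ hy ht₁ ?_ ?_ ?_
  · set d := 1 - b t₁ / a t₁ with hd
    have hdpos : 0 < d := by
      have := h.a_pos t₁ ht₁
      rw [hd, sub_pos, div_lt_one this]
      exact hlt
    have hD : ∀ t ∈ I, t ≤ t₁ → d * a t ≤ a t - b t := by
      intro t ht htt
      have h1 := hge t ht htt
      have h2 := h.a_pos t ht
      have h3 : (1 - b t / a t) * a t = a t - b t := by field_simp
      rw [← h3]
      exact mul_le_mul_of_nonneg_right h1 h2.le
    refine dominant_asymptotics (ε := -1) (by norm_num) h.isOpen h.ordConnected hK h.P_pos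
      h.a_pos h.b_pos h.c_pos h.prod_eq
      (fun t ht => (h.deriv_a t ht).congr_deriv (by ring))
      (fun t ht => (h.deriv_b t ht).congr_deriv (by ring))
      (fun t ht => (h.deriv_c t ht).congr_deriv (by ring))
      h.not_tendsto ht₁ hdpos ?_ ?_ ?_
    · intro t ht _
      linarith [h.c_lt_b t ht]
    · intro t ht htt
      linarith [hD t ht htt, mul_pos hdpos (h.a_pos t ht)]
    · intro t ht htt
      linarith [hD t ht htt, h.c_pos t ht]
  · exact ((continuousOn_const.mul ((h.continuousOn_a.add h.continuousOn_b).mul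
      h.continuousOn_b))).neg
  · intro t ht _
    have h1 := h.a_pos t ht
    have h2 := h.b_pos t ht
    have h3 := h.c_pos t ht
    have h5 : -(3 * K * ((a t + b t) * b t)) * (1 - b t / a t) =
        -(3 * K * ((a t + b t) * (a t - b t)) * (b t / a t)) := by
      field_simp
    rw [h5, neg_le_neg_iff]
    gcongr
    linarith
  · intro t ht
    have h1 := h.a_pos t ht
    have h2 := h.b_pos t ht
    rw [neg_nonpos]
    positivity
  · have := h.a_pos t₁ ht₁
    rw [sub_pos, div_lt_one this]
    exact hlt

end IsDiagonalFlow

/-! ### Comparison of orbits with the separatrix. -/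

theorem sigmoid_log_div {b c : ℝ} (hc : 0 < c) (hcb : c < b) :
    Real.sigmoid (Real.log (c / (b - c))) = c / b := by
  have h1 := sub_pos.2 hcb
  have h2 : 0 < b := hc.trans hcb
  rw [Real.sigmoid_def, Real.exp_neg, Real.exp_log (div_pos hc h1)]
  field_simp
  ring

namespace IsDiagonalFlow

variable {P K : ℝ} {I : Set ℝ} {a b c H : ℝ → ℝ}

/-- The signed distance of the orbit to the separatrix satisfies a linear equation. -/
theorem deriv_dist_separatrix (h : IsDiagonalFlow P K I a b c)
    (hH : ∀ σ, 1 ≤ H σ + Real.sigmoid σ ∧ H σ ≤ 1 ∧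
      HasDerivAt H (-orbitSlope (Real.sigmoid σ) (H σ)) σ) {t : ℝ} (ht : t ∈ I) :
    HasDerivAt (fun t => a t / b t - H (Real.log (c t / (b t - c t))))
      (-(3 * K * (b t * (a t + b t + c t))) *
        orbitSlopeQuot (c t / b t) (a t / b t) (H (Real.log (c t / (b t - c t)))) *
        (a t / b t - H (Real.log (c t / (b t - c t))))) t := by
  have h1 := h.a_pos t ht
  have h2 := h.b_pos t ht
  have h3 := h.c_pos t ht
  have h4 := sub_pos.2 (h.c_lt_b t ht)
  -- The derivative of σ is positive, so σ is a change of time along the orbit.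
  have hσ : HasDerivAt (fun t => Real.log (c t / (b t - c t)))
      (3 * K * (b t * (a t + b t + c t))) t := by
    refine (((h.deriv_c t ht).fun_div ((h.deriv_b t ht).fun_sub (h.deriv_c t ht)) h4.ne').log
      (div_pos h3 h4).ne').congr_deriv ?_
    field_simp
    ring
  have hcomp := (hH (Real.log (c t / (b t - c t)))).2.2.comp t hσ
  refine ((h.deriv_a_div_b ht).fun_sub hcomp).congr_deriv ?_
  have hsig := sigmoid_log_div h3 (h.c_lt_b t ht)
  have hHpos : 0 ≤ H (Real.log (c t / (b t - c t))) := by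
    linarith [(hH (Real.log (c t / (b t - c t)))).1,
      Real.sigmoid_lt_one (Real.log (c t / (b t - c t)))]
  have hsub := orbitSlope_sub (w := c t / b t) (z := a t / b t) (by positivity) (by positivity) hHpos
  rw [hsig]
  have hz : -(3 * K * ((a t + b t) * (a t + c t - b t))) * (a t / b t) =
      -(3 * K * (b t * (a t + b t + c t))) * orbitSlope (c t / b t) (a t / b t) := by
    rw [orbitSlope]
    field_simp
    ring
  rw [hz]
  linear_combination (-(3 * K * (b t * (a t + b t + c t)))) * hsub

theorem continuousOn_rate_separatrix (h : IsDiagonalFlow P K I a b c) (hHc : Continuous H)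
    (hH : ∀ σ, 1 ≤ H σ + Real.sigmoid σ) :
    ContinuousOn (fun t => -(3 * K * (b t * (a t + b t + c t))) *
        orbitSlopeQuot (c t / b t) (a t / b t) (H (Real.log (c t / (b t - c t))))) I := by
  have hb : ∀ t ∈ I, b t ≠ 0 := fun t ht => (h.b_pos t ht).ne'
  have hw := h.continuousOn_c.div h.continuousOn_b hb
  have hz := h.continuousOn_a.div h.continuousOn_b hb
  have hσ : ContinuousOn (fun t => H (Real.log (c t / (b t - c t)))) I :=
    hHc.comp_continuousOn ((h.continuousOn_c.div (h.continuousOn_b.sub h.continuousOn_c)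
      fun t ht => (sub_pos.2 (h.c_lt_b t ht)).ne').log fun t ht =>
        (div_pos (h.c_pos t ht) (sub_pos.2 (h.c_lt_b t ht))).ne')
  have hHpos : ∀ σ, 0 < H σ := fun σ => by linarith [hH σ, Real.sigmoid_lt_one σ]
  refine ContinuousOn.mul (continuousOn_const.mul (h.continuousOn_b.mul
    ((h.continuousOn_a.add h.continuousOn_b).add h.continuousOn_c))).neg ?_
  unfold orbitSlopeQuot
  refine ContinuousOn.div ?_ ?_ ?_
  · exact ((continuousOn_const.add hw).mul ((((((hz.pow 2).add (hz.mul hσ)).add (hσ.pow 2)).add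
      (hw.mul (hz.add hσ))).add hw).sub continuousOn_const)).add
      ((hz.mul hσ).mul ((hz.add hσ).add hw))
  · exact ((continuousOn_const.add hz).add hw).mul ((continuousOn_const.add hσ).add hw)
  · intro t ht
    have h1 := h.a_pos t ht
    have h2 := h.b_pos t ht
    have h3 := h.c_pos t ht
    have h4 := hHpos (Real.log (c t / (b t - c t)))
    positivity

theorem rate_separatrix_nonpos (h : IsDiagonalFlow P K I a b c)
    (hH : ∀ σ, 1 ≤ H σ + Real.sigmoid σ) {t : ℝ} (ht : t ∈ I) :
    -(3 * K * (b t * (a t + b t + c t))) *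
        orbitSlopeQuot (c t / b t) (a t / b t) (H (Real.log (c t / (b t - c t)))) ≤ 0 := by
  have h1 := h.a_pos t ht
  have h2 := h.b_pos t ht
  have h3 := h.c_pos t ht
  have hK := h.K_pos
  have h4 := hH (Real.log (c t / (b t - c t)))
  have h5 := Real.sigmoid_lt_one (Real.log (c t / (b t - c t)))
  rw [sigmoid_log_div h3 (h.c_lt_b t ht)] at h4 h5
  have hq := orbitSlopeQuot_nonneg (w := c t / b t) (z := a t / b t)
    (y := H (Real.log (c t / (b t - c t)))) (by positivity) (by positivity) (by linarith) h4
  rw [neg_mul, neg_nonpos]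
  positivity

theorem strip_of_eq_separatrix (h : IsDiagonalFlow P K I a b c) (hHc : Continuous H)
    (hH : ∀ σ, 1 ≤ H σ + Real.sigmoid σ ∧ H σ ≤ 1 ∧
      HasDerivAt H (-orbitSlope (Real.sigmoid σ) (H σ)) σ)
    (h0 : a 0 / b 0 = H (Real.log (c 0 / (b 0 - c 0)))) :
    ∀ t ∈ I, t ≤ 0 → a t ≤ b t ∧ b t ≤ a t + c t := by
  intro t ht _
  have hz := zero_of_hasDerivAt_mul h.isOpen h.ordConnected
    (h.continuousOn_rate_separatrix hHc fun σ => (hH σ).1)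
    (fun t ht => h.deriv_dist_separatrix hH ht) h.zero_mem (sub_eq_zero.2 h0) t ht
  have h2 := h.b_pos t ht
  have h3 := h.c_pos t ht
  have hHt := hH (Real.log (c t / (b t - c t)))
  rw [← sub_eq_zero.1 hz, sigmoid_log_div h3 (h.c_lt_b t ht), ← add_div, le_div_iff₀ h2,
    div_le_iff₀ h2] at hHt
  exact ⟨by linarith [hHt.2.1], by linarith [hHt.1]⟩

/-- Backward in time z - H stays at least δ, and H ≥ 1 - w, so z + w ≥ 1 + δ. If also a ≤ b
throughout, the orbit would be in the strip, where z + w → 1. -/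
theorem exists_a_dominant (h : IsDiagonalFlow P K I a b c) (hHc : Continuous H)
    (hH : ∀ σ, 1 ≤ H σ + Real.sigmoid σ ∧ H σ ≤ 1 ∧
      HasDerivAt H (-orbitSlope (Real.sigmoid σ) (H σ)) σ)
    (h0 : H (Real.log (c 0 / (b 0 - c 0))) < a 0 / b 0) : ∃ t ∈ I, b t < a t := by
  have hge := backward_ge_of_deriv_le_mul h.isOpen h.ordConnected
    (h.continuousOn_rate_separatrix hHc fun σ => (hH σ).1)
    (fun t ht => h.deriv_dist_separatrix hH ht) h.zero_mem (fun _ _ _ => le_rfl)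
    (fun t ht => h.rate_separatrix_nonpos (fun σ => (hH σ).1) ht) (sub_pos.2 h0)
  set δ := a 0 / b 0 - H (Real.log (c 0 / (b 0 - c 0))) with hδ
  have hδ0 : 0 < δ := sub_pos.2 h0
  have key : ∀ t ∈ I, t ≤ 0 → 1 + δ ≤ a t / b t + c t / b t := by
    intro t ht ht0
    have h1 := hge t ht ht0
    have h2 := (hH (Real.log (c t / (b t - c t)))).1
    rw [sigmoid_log_div (h.c_pos t ht) (h.c_lt_b t ht)] at h2
    linarith
  by_contra! hcon
  obtain ⟨t₀, ht₀, hw, hz, -⟩ := h.strip_asymptotics fun t ht ht0 => by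
    refine ⟨hcon t ht, ?_⟩
    have h1 := key t ht ht0
    rw [← add_div, le_div_iff₀ (h.b_pos t ht)] at h1
    nlinarith [h.b_pos t ht]
  have hlim := hz.add hw
  have := ge_of_tendsto hlim ((h.eventually_mem ht₀).mono fun t ht =>
    key t (h.Ioc_subset ht₀ ⟨ht.1, ht.2.le⟩) ht.2.le)
  linarith

/-- The mirror argument: H ≤ 1 gives z ≤ 1 - δ backward in time, while an orbit in the strip has z →
1. -/
theorem exists_b_dominant (h : IsDiagonalFlow P K I a b c) (hHc : Continuous H)
    (hH : ∀ σ, 1 ≤ H σ + Real.sigmoid σ ∧ H σ ≤ 1 ∧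
      HasDerivAt H (-orbitSlope (Real.sigmoid σ) (H σ)) σ)
    (h0 : a 0 / b 0 < H (Real.log (c 0 / (b 0 - c 0)))) : ∃ t ∈ I, a t + c t < b t := by
  have hge := backward_ge_of_deriv_le_mul h.isOpen h.ordConnected
    (h.continuousOn_rate_separatrix hHc fun σ => (hH σ).1)
    (fun t ht => (h.deriv_dist_separatrix hH ht).neg) h.zero_mem
    (fun r _ _ => (by rw [Pi.neg_apply, mul_neg]))
    (fun t ht => h.rate_separatrix_nonpos (fun σ => (hH σ).1) ht) (neg_pos.2 (sub_neg.2 h0))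
  simp only [Pi.neg_apply, neg_sub] at hge
  set δ := H (Real.log (c 0 / (b 0 - c 0))) - a 0 / b 0 with hδ
  have hδ0 : 0 < δ := sub_pos.2 h0
  have key : ∀ t ∈ I, t ≤ 0 → a t / b t ≤ 1 - δ := by
    intro t ht ht0
    have h1 := hge t ht ht0
    have h2 := (hH (Real.log (c t / (b t - c t)))).2.1
    linarith
  by_contra! hcon
  obtain ⟨t₀, ht₀, hw, hz, -⟩ := h.strip_asymptotics fun t ht ht0 => by
    refine ⟨?_, hcon t ht⟩
    have h1 := key t ht ht0
    rw [div_le_iff₀ (h.b_pos t ht)] at h1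
    nlinarith [h.b_pos t ht]
  have := le_of_tendsto hz ((h.eventually_mem ht₀).mono fun t ht =>
    key t (h.Ioc_subset ht₀ ⟨ht.1, ht.2.le⟩) ht.2.le)
  linarith

end IsDiagonalFlow

end DiagonalFlow

/-! ### Conversion of limits to asymptotics -/

section Equivalents

theorem isEquivalent_of_tendsto_mul_rpow {X : ℝ → ℝ} {T η p : ℝ} (hη : η ≠ 0)
    (h : Tendsto (fun t => X t * (t + T) ^ (-p)) (𝓝[>] (-T)) (𝓝 η)) :
    X ~[𝓝[>] (-T)] fun t => η * (t + T) ^ p := by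
  refine isEquivalent_of_tendsto_one ?_
  have h1 := h.div_const η
  rw [div_self hη] at h1
  refine h1.congr' ?_
  filter_upwards [self_mem_nhdsWithin] with t ht
  have hpos : 0 < t + T := by linarith [Set.mem_Ioi.1 ht]
  rw [Pi.div_apply, Real.rpow_neg hpos.le]
  have := (Real.rpow_pos_of_pos hpos p).ne'
  field_simp

theorem isEquivalent_of_tendsto_mul_sqrt {X : ℝ → ℝ} {T κ : ℝ} (hκ : 0 < κ)
    (h : Tendsto (fun t => X t * √(t - -T)) (𝓝[>] (-T)) (𝓝 κ)) :
    X ~[𝓝[>] (-T)] fun t => κ * (t + T) ^ (-1 / 2 : ℝ) := by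
  refine isEquivalent_of_tendsto_mul_rpow hκ.ne' (h.congr fun t => ?_)
  rw [sub_neg_eq_add, Real.sqrt_eq_rpow]
  norm_num

/-- With τ = t + T, X is asymptotic to κτ^(-1/2), so Y ∼ η/√X gives the exponent 1/4 and the
constant η/√κ. -/
theorem isEquivalent_of_tendsto_mul_sqrt_sqrt {X Y : ℝ → ℝ} {T κ η : ℝ} (hκ : 0 < κ) (hη : 0 < η)
    (hX : ∀ᶠ t in 𝓝[>] (-T), 0 < X t)
    (h : Tendsto (fun t => X t * √(t - -T)) (𝓝[>] (-T)) (𝓝 κ))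
    (hY : Tendsto (fun t => Y t * √(X t)) (𝓝[>] (-T)) (𝓝 η)) :
    Y ~[𝓝[>] (-T)] fun t => η / √κ * (t + T) ^ (1 / 4 : ℝ) := by
  have hκ' := Real.sqrt_pos.2 hκ
  refine isEquivalent_of_tendsto_mul_rpow (div_pos hη hκ').ne' ((hY.div h.sqrt hκ'.ne').congr' ?_)
  filter_upwards [hX, self_mem_nhdsWithin] with t hXt ht
  have hpos : 0 < t + T := by linarith [Set.mem_Ioi.1 ht]
  have h4 : √(√(t + T)) = (t + T) ^ (1 / 4 : ℝ) := by
    rw [Real.sqrt_eq_rpow, Real.sqrt_eq_rpow, ← Real.rpow_mul hpos.le]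
    norm_num
  have h1 := (Real.rpow_pos_of_pos hpos (1 / 4)).ne'
  have h2 := (Real.sqrt_pos.2 hXt).ne'
  rw [Pi.div_apply, sub_neg_eq_add, Real.sqrt_mul hXt.le, h4, Real.rpow_neg hpos.le]
  field_simp

theorem tendsto_add_nhdsGT_neg (T : ℝ) : Tendsto (fun t => t + T) (𝓝[>] (-T)) (𝓝[>] 0) := by
  refine tendsto_nhdsWithin_iff.2 ⟨?_, ?_⟩
  · have : Tendsto (fun t => t + T) (𝓝 (-T)) (𝓝 (-T + T)) := (continuous_add_const T).tendsto _
    rw [neg_add_cancel] at this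
    exact this.mono_left nhdsWithin_le_nhds
  · filter_upwards [self_mem_nhdsWithin] with t ht
    simp only [Set.mem_Ioi] at ht ⊢
    linarith

/-- One side tends to infinity and the other to 0. This alone separates the three behaviors. -/
theorem not_isEquivalent_rpow {T κ η : ℝ} (hκ : 0 < κ) :
    ¬ (fun t => κ * (t + T) ^ (-1 / 2 : ℝ)) ~[𝓝[>] (-T)] fun t => η * (t + T) ^ (1 / 4 : ℝ) := by
  intro h
  have h1 : Tendsto (fun t => η * (t + T) ^ (1 / 4 : ℝ)) (𝓝[>] (-T)) (𝓝 0) := by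
    have h2 : Tendsto (fun s : ℝ => s ^ (1 / 4 : ℝ)) (𝓝[>] 0) (𝓝 0) := by
      have := (Real.continuousAt_rpow_const 0 (1 / 4 : ℝ) (Or.inr (by norm_num))).tendsto
      rw [Real.zero_rpow (by norm_num)] at this
      exact this.mono_left nhdsWithin_le_nhds
    simpa using (h2.comp (tendsto_add_nhdsGT_neg T)).const_mul η
  have h3 : Tendsto (fun t => κ * (t + T) ^ (-1 / 2 : ℝ)) (𝓝[>] (-T)) atTop :=
    ((tendsto_rpow_neg_nhdsGT_zero (by norm_num)).comp (tendsto_add_nhdsGT_neg T)).const_mul_atTop hκ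
  exact not_tendsto_nhds_of_tendsto_atTop h3 0 (h.symm.tendsto_nhds h1)

end Equivalents

/-! ### Behavior of maximal flows -/

section Behavior

variable {f : Module.Basis (Fin 3) ℝ SL2Alg} {x : Fin 3 → ℝ} {g : ℝ → LeftInvariantMetric SL2Alg}
  {I : Set ℝ}

theorem pos_of_mem_initialSet (hx : x ∈ initialSet) (i : Fin 3) : 0 < x i := by
  obtain ⟨h0, h1, h2⟩ := hx
  fin_cases i
  · exact h0
  · exact h2.trans h1
  · exact h2

theorem IsMaximalFlowFrom.isDiagonalFlow (hf : IsMilnorFrame f) (hx : x ∈ initialSet)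
    (hg : IsMaximalFlowFrom f x g I) :
    IsDiagonalFlow (x 0 * x 1 * x 2) (8 / (3 * (x 0 * x 1 * x 2))) I
      (fun t => diagCoeff f g t 0) (fun t => diagCoeff f g t 1) (fun t => diagCoeff f g t 2) := by
  have hP : 0 < x 0 * x 1 * x 2 := mul_pos (mul_pos (pos_of_mem_initialSet hx 0)
    (pos_of_mem_initialSet hx 1)) (pos_of_mem_initialSet hx 2)
  have hd : ∀ t ∈ I, ∀ i, HasDerivAt (fun t => diagCoeff f g t i)
      (polyField (x 0 * x 1 * x 2) (diagCoeff f g t) i) t := fun t ht i =>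
    hasDerivAt_pi.1 (hg.hasDerivAt_diagCoeff hf ht) i
  refine ⟨hg.1.isOpen, hg.1.ordConnected, hg.1.zero_mem, hP, by positivity,
    fun t _ => diagCoeff_pos t 0, fun t _ => diagCoeff_pos t 1, fun t _ => diagCoeff_pos t 2, ?_,
    fun t ht => hg.prod_eq hf ht, fun t ht => hd t ht 0, fun t ht => hd t ht 1,
    fun t ht => hd t ht 2, ?_⟩
  · intro t ht
    have hc : ∀ i, ContinuousOn (fun t => diagCoeff f g t i) I :=
      fun i t ht => (hd t ht i).continuousAt.continuousWithinAt
    have h0 := hc 0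
    have h1 := hc 1
    have h2 := hc 2
    -- The field is symmetric in b and c, so b - c satisfies a homogeneous linear equation, with the
    -- rate given here.
    refine sub_pos.1 (pos_of_hasDerivAt_mul (y := fun t => diagCoeff f g t 1 - diagCoeff f g t 2)
      (k := fun t => -(8 / (3 * (x 0 * x 1 * x 2))) * (2 * (diagCoeff f g t 1 ^ 2 +
        diagCoeff f g t 1 * diagCoeff f g t 2 + diagCoeff f g t 2 ^ 2) +
        diagCoeff f g t 0 * (diagCoeff f g t 1 + diagCoeff f g t 2) - diagCoeff f g t 0 ^ 2))
      hg.1.isOpen hg.1.ordConnected (by fun_prop) ?_ hg.1.zero_mem ?_ t ht)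
    · intro r hr
      refine ((hd r hr 1).fun_sub (hd r hr 2)).congr_deriv ?_
      simp only [polyField, Matrix.cons_val]
      ring
    · simp only [hg.diagCoeff_zero]
      exact sub_pos.2 hx.2.1
  · intro t₀ ht₀ p q s hlim
    refine hg.not_tendsto hf ht₀ (p := ![p, q, s]) (tendsto_pi_nhds.2 fun i => ?_)
    fin_cases i
    · exact hlim.1
    · exact hlim.2.1
    · exact hlim.2.2

/-- Both sides are √(3P/32); the right one is the constant 1/√(4K) of the cubic blow-up. -/
theorem blowupConstant_eq (x : Fin 3 → ℝ) :
    blowupConstant x = √(1 / (4 * (8 / (3 * (x 0 * x 1 * x 2))))) := by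
  have h4 : (4 : ℝ) = √16 := by
    rw [show (16 : ℝ) = 4 ^ 2 by norm_num, Real.sqrt_sq (by norm_num)]
  rw [blowupConstant]
  nth_rewrite 1 [h4]
  rw [← Real.sqrt_div (by norm_num), ← Real.sqrt_mul (by norm_num)]
  congr 1
  field_simp
  ring

theorem blowupConstant_pos (hx : x ∈ initialSet) : 0 < blowupConstant x := by
  have hP : 0 < x 0 * x 1 * x 2 := mul_pos (mul_pos (pos_of_mem_initialSet hx 0)
    (pos_of_mem_initialSet hx 1)) (pos_of_mem_initialSet hx 2)
  rw [blowupConstant]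
  positivity

variable {H : ℝ → ℝ}

theorem IsMaximalFlowFrom.backwardCase1 (hf : IsMilnorFrame f) (hx : x ∈ initialSet)
    (hg : IsMaximalFlowFrom f x g I) (hHc : Continuous H)
    (hH : ∀ σ, 1 ≤ H σ + Real.sigmoid σ ∧ H σ ≤ 1 ∧
      HasDerivAt H (-orbitSlope (Real.sigmoid σ) (H σ)) σ)
    (h0 : H (Real.log (x 2 / (x 1 - x 2))) < x 0 / x 1) : BackwardCase1 f x g I := by
  have h := hg.isDiagonalFlow hf hx
  obtain ⟨t₁, ht₁, hlt⟩ := h.exists_a_dominant hHc hH (by simpa only [hg.diagCoeff_zero] using h0)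
  obtain ⟨t₀, ht₀, hX, η, hη, ζ, hζ, hY, hZ⟩ := h.asymptotics_of_a_dominant ht₁ hlt
  have hκ := blowupConstant_pos hx
  rw [← blowupConstant_eq x] at hX
  obtain ⟨T, rfl⟩ : ∃ T, t₀ = -T := ⟨-t₀, (neg_neg _).symm⟩
  have hpos : ∀ᶠ t in 𝓝[>] (-T), 0 < diagCoeff f g t 0 :=
    Eventually.of_forall fun t => diagCoeff_pos t 0
  refine ⟨η / √(blowupConstant x), ζ / √(blowupConstant x), by positivity, by positivity, T,
    by linarith [h.glb_neg ht₀], ht₀, fun i => ?_⟩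
  fin_cases i
  · exact isEquivalent_of_tendsto_mul_sqrt hκ hX
  · exact isEquivalent_of_tendsto_mul_sqrt_sqrt hκ hη hpos hX hY
  · exact isEquivalent_of_tendsto_mul_sqrt_sqrt hκ hζ hpos hX hZ

theorem IsMaximalFlowFrom.backwardCase2 (hf : IsMilnorFrame f) (hx : x ∈ initialSet)
    (hg : IsMaximalFlowFrom f x g I) (hHc : Continuous H)
    (hH : ∀ σ, 1 ≤ H σ + Real.sigmoid σ ∧ H σ ≤ 1 ∧
      HasDerivAt H (-orbitSlope (Real.sigmoid σ) (H σ)) σ)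
    (h0 : x 0 / x 1 < H (Real.log (x 2 / (x 1 - x 2)))) : BackwardCase2 f x g I := by
  have h := hg.isDiagonalFlow hf hx
  obtain ⟨t₁, ht₁, hlt⟩ := h.exists_b_dominant hHc hH (by simpa only [hg.diagCoeff_zero] using h0)
  obtain ⟨t₀, ht₀, hX, η, hη, ζ, hζ, hY, hZ⟩ := h.asymptotics_of_b_dominant ht₁ hlt
  have hκ := blowupConstant_pos hx
  rw [← blowupConstant_eq x] at hX
  obtain ⟨T, rfl⟩ : ∃ T, t₀ = -T := ⟨-t₀, (neg_neg _).symm⟩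
  have hpos : ∀ᶠ t in 𝓝[>] (-T), 0 < diagCoeff f g t 1 :=
    Eventually.of_forall fun t => diagCoeff_pos t 1
  refine ⟨η / √(blowupConstant x), ζ / √(blowupConstant x), by positivity, by positivity, T,
    by linarith [h.glb_neg ht₀], ht₀, fun i => ?_⟩
  fin_cases i
  · exact isEquivalent_of_tendsto_mul_sqrt_sqrt hκ hη hpos hX hY
  · exact isEquivalent_of_tendsto_mul_sqrt hκ hX
  · exact isEquivalent_of_tendsto_mul_sqrt_sqrt hκ hζ hpos hX hZ

theorem IsMaximalFlowFrom.backwardCase3 (hf : IsMilnorFrame f) (hx : x ∈ initialSet)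
    (hg : IsMaximalFlowFrom f x g I) (hHc : Continuous H)
    (hH : ∀ σ, 1 ≤ H σ + Real.sigmoid σ ∧ H σ ≤ 1 ∧
      HasDerivAt H (-orbitSlope (Real.sigmoid σ) (H σ)) σ)
    (h0 : x 0 / x 1 = H (Real.log (x 2 / (x 1 - x 2)))) : BackwardCase3 f x g I := by
  have h := hg.isDiagonalFlow hf hx
  obtain ⟨t₀, ht₀, -, hz, hb⟩ := h.strip_asymptotics
    (h.strip_of_eq_separatrix hHc hH (by simpa only [hg.diagCoeff_zero] using h0))
  have hκ := blowupConstant_pos hx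
  have hκ2 : blowupConstant x ^ 2 = 3 * (x 0 * x 1 * x 2) / 32 := by
    have := h.P_pos
    rw [blowupConstant_eq x, Real.sq_sqrt (by positivity)]
    field_simp
    ring
  rw [← blowupConstant_eq x] at hb
  obtain ⟨T, rfl⟩ : ∃ T, t₀ = -T := ⟨-t₀, (neg_neg _).symm⟩
  have ha : Tendsto (fun t => diagCoeff f g t 0 * √(t - -T)) (𝓝[>] (-T))
      (𝓝 (blowupConstant x)) := by
    have := hz.mul hb
    rw [one_mul] at this
    refine this.congr fun t => ?_
    have := (diagCoeff_pos (f := f) (g := g) t 1).ne'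
    field_simp
  have hc : Tendsto (fun t => diagCoeff f g t 2 * (t + T) ^ (-1 : ℝ)) (𝓝[>] (-T))
      (𝓝 (32 / 3)) := by
    -- C = P/(AB), and AB(t+T) → κ² = 3P/32, whence the constant 32/3.
    have h1 := (tendsto_const_nhds (x := x 0 * x 1 * x 2)).div (ha.mul hb) (by positivity)
    have h2 : x 0 * x 1 * x 2 / (blowupConstant x * blowupConstant x) = 32 / 3 := by
      rw [← sq, hκ2, div_div_eq_mul_div, mul_comm (3 : ℝ), mul_div_mul_left _ _ h.P_pos.ne']
    rw [h2] at h1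
    refine h1.congr' ?_
    filter_upwards [h.eventually_mem ht₀, self_mem_nhdsWithin] with t ht htt
    have hpos : 0 < t + T := by linarith [Set.mem_Ioi.1 htt]
    have h3 := diagCoeff_pos (f := f) (g := g) t 0
    have h4 := diagCoeff_pos (f := f) (g := g) t 1
    rw [Pi.div_apply, ← hg.prod_eq hf (h.Ioc_subset ht₀ ⟨ht.1, ht.2.le⟩), sub_neg_eq_add,
      Real.rpow_neg_one, mul_mul_mul_comm, Real.mul_self_sqrt hpos.le]
    field_simp
  refine ⟨T, by linarith [h.glb_neg ht₀], ht₀, fun i => ?_⟩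
  fin_cases i
  · exact isEquivalent_of_tendsto_mul_sqrt hκ ha
  · exact isEquivalent_of_tendsto_mul_sqrt hκ hb
  · have := isEquivalent_of_tendsto_mul_rpow (p := 1) (by norm_num) hc
    simp only [Real.rpow_one] at this
    exact this

/-! ### Mutual exclusion of the three behaviors. -/

theorem BackwardAsymptotics.isEquivalent {u v : Fin 3 → ℝ → ℝ} (hu : BackwardAsymptotics f g I u)
    (hv : BackwardAsymptotics f g I v) :
    ∃ T : ℝ, ∀ i, (fun t => u i (t + T)) ~[𝓝[>] (-T)] fun t => v i (t + T) := by
  obtain ⟨T, -, hT, h⟩ := hu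
  obtain ⟨T', -, hT', h'⟩ := hv
  obtain rfl : T = T' := neg_inj.1 (hT.unique hT')
  exact ⟨T, fun i => (h i).symm.trans (h' i)⟩

theorem not_backwardCase1_and_backwardCase2 (hx : x ∈ initialSet) (h1 : BackwardCase1 f x g I)
    (h2 : BackwardCase2 f x g I) : False := by
  obtain ⟨_, _, _, _, h1⟩ := h1
  obtain ⟨_, _, _, _, h2⟩ := h2
  obtain ⟨T, h⟩ := h1.isEquivalent h2
  exact not_isEquivalent_rpow (blowupConstant_pos hx) (h 0)

theorem not_backwardCase1_and_backwardCase3 (hx : x ∈ initialSet) (h1 : BackwardCase1 f x g I)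
    (h3 : BackwardCase3 f x g I) : False := by
  obtain ⟨_, _, _, _, h1⟩ := h1
  obtain ⟨T, h⟩ := BackwardAsymptotics.isEquivalent h3 h1
  exact not_isEquivalent_rpow (blowupConstant_pos hx) (h 1)

theorem not_backwardCase2_and_backwardCase3 (hx : x ∈ initialSet) (h2 : BackwardCase2 f x g I)
    (h3 : BackwardCase3 f x g I) : False := by
  obtain ⟨_, _, _, _, h2⟩ := h2
  obtain ⟨T, h⟩ := BackwardAsymptotics.isEquivalent h3 h2
  exact not_isEquivalent_rpow (blowupConstant_pos hx) (h 0)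

end Behavior

/-! ### The partition of the space of initial metrics -/

section Partition

theorem areTheTwoComponents_of_isOpen {X : Type*} [TopologicalSpace X] {U U₁ U₂ : Set X}
    (hU : U = U₁ ∪ U₂) (h₁ : IsOpen U₁) (h₂ : IsOpen U₂) (hd : Disjoint U₁ U₂)
    (hc₁ : IsConnected U₁) (hc₂ : IsConnected U₂) : AreTheTwoComponents U U₁ U₂ := by
  have e₁ : ∀ x ∈ U₁, connectedComponentIn U x = U₁ := by
    intro x hx
    have hxU : x ∈ U := hU ▸ Or.inl hx
    refine Set.Subset.antisymm ?_ (hc₁.isPreconnected.subset_connectedComponentIn hx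
      (hU ▸ Set.subset_union_left))
    exact isPreconnected_connectedComponentIn.subset_left_of_subset_union h₁ h₂ hd
      (hU ▸ connectedComponentIn_subset U x) ⟨x, mem_connectedComponentIn hxU, hx⟩
  have e₂ : ∀ x ∈ U₂, connectedComponentIn U x = U₂ := by
    intro x hx
    have hxU : x ∈ U := hU ▸ Or.inr hx
    refine Set.Subset.antisymm ?_ (hc₂.isPreconnected.subset_connectedComponentIn hx
      (hU ▸ Set.subset_union_right))
    exact isPreconnected_connectedComponentIn.subset_right_of_subset_union h₁ h₂ hd
      (hU ▸ connectedComponentIn_subset U x) ⟨x, mem_connectedComponentIn hxU, hx⟩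
  obtain ⟨p, hp⟩ := hc₁.nonempty
  obtain ⟨q, hq⟩ := hc₂.nonempty
  refine ⟨fun h => Set.disjoint_left.1 hd hp (h ▸ hp), Set.Subset.antisymm ?_ ?_⟩
  · rintro _ ⟨x, hx, rfl⟩
    rw [hU] at hx
    rcases hx with hx | hx
    · exact Or.inl (e₁ x hx)
    · exact Or.inr (e₂ x hx)
  · rintro V (rfl | rfl)
    · exact ⟨p, hU ▸ Or.inl hp, e₁ p hp⟩
    · exact ⟨q, hU ▸ Or.inr hq, e₂ q hq⟩

theorem isOpen_initialSet : IsOpen initialSet := by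
  have h : initialSet = {x : Fin 3 → ℝ | 0 < x 0} ∩ ({x | x 2 < x 1} ∩ {x | 0 < x 2}) := rfl
  rw [h]
  exact (isOpen_lt continuous_const (continuous_apply 0)).inter
    ((isOpen_lt (continuous_apply 2) (continuous_apply 1)).inter
      (isOpen_lt continuous_const (continuous_apply 2)))

/-- The defining function of the cone over the graph of `H`. -/
def coneFunction (H : ℝ → ℝ) (x : Fin 3 → ℝ) : ℝ := x 0 - x 1 * H (Real.log (x 2 / (x 1 - x 2)))

variable {H : ℝ → ℝ}

theorem contDiffOn_coneFunction (hH : ContDiff ℝ ∞ H) :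
    ContDiffOn ℝ ∞ (coneFunction H) initialSet := by
  intro x hx
  have h1 : x 1 - x 2 ≠ 0 := (sub_pos.2 hx.2.1).ne'
  have h2 : x 2 / (x 1 - x 2) ≠ 0 := (div_pos hx.2.2 (sub_pos.2 hx.2.1)).ne'
  have hc : ∀ i, ContDiffAt ℝ ∞ (fun x : Fin 3 → ℝ => x i) x := fun i => by fun_prop
  refine ContDiffAt.contDiffWithinAt ?_
  unfold coneFunction
  exact (hc 0).sub ((hc 1).mul (hH.contDiffAt.comp x
    (((hc 2).div ((hc 1).sub (hc 2)) h1).log h2)))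

/-- The function has slope 1 in the first coordinate. This gives both the nonvanishing differential
and the density of the complement of its zero set. -/
theorem coneFunction_add_single (x : Fin 3 → ℝ) (s : ℝ) :
    coneFunction H (x + s • Pi.single 0 1) = coneFunction H x + s := by
  simp [coneFunction]
  ring

theorem fderiv_coneFunction_ne_zero (hH : ContDiff ℝ ∞ H) {x : Fin 3 → ℝ} (hx : x ∈ initialSet) :
    fderiv ℝ (coneFunction H) x ≠ 0 := by
  intro h0
  have hd : HasFDerivAt (coneFunction H) (fderiv ℝ (coneFunction H) x) x :=
    (((contDiffOn_coneFunction hH).contDiffAt (isOpen_initialSet.mem_nhds hx)).differentiableAt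
      (by simp)).hasFDerivAt
  rw [h0] at hd
  have h1 := hd.hasLineDerivAt (Pi.single 0 1)
  have h2 : HasDerivAt (fun s => coneFunction H x + s) 1 0 := (hasDerivAt_id 0).const_add _
  simp only [HasLineDerivAt, coneFunction_add_single] at h1
  have := h1.unique h2
  simp at this

theorem coneFunction_smul {r : ℝ} (hr : 0 < r) (x : Fin 3 → ℝ) :
    coneFunction H (r • x) = r * coneFunction H x := by
  simp only [coneFunction, Pi.smul_apply, smul_eq_mul]
  rw [← mul_sub, mul_div_mul_left _ _ hr.ne']
  ring

theorem smul_mem_initialSet {r : ℝ} (hr : 0 < r) {x : Fin 3 → ℝ} (hx : x ∈ initialSet) :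
    r • x ∈ initialSet :=
  ⟨mul_pos hr hx.1, mul_lt_mul_of_pos_left hx.2.1 hr, mul_pos hr hx.2.2⟩

/-- The coordinates (`coneFunction H x`, x₁ - x₂, x₂) straighten the region to the open octant,
which is convex. -/
theorem isConnected_coneFunction_pos (hHc : Continuous H) (hHpos : ∀ σ, 0 < H σ) :
    IsConnected {x ∈ initialSet | 0 < coneFunction H x} := by
  let D : Set (Fin 3 → ℝ) := {v | 0 < v 0 ∧ 0 < v 1 ∧ 0 < v 2}
  let m : (Fin 3 → ℝ) → Fin 3 → ℝ := fun v =>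
    ![(v 2 + v 1) * H (Real.log (v 2 / v 1)) + v 0, v 2 + v 1, v 2]
  have hD : IsConnected D := by
    refine ⟨⟨fun _ => 1, by simp [D]⟩, Convex.isPreconnected ?_⟩
    intro u hu v hv s t hs ht hst
    have key : ∀ i, 0 < u i → 0 < v i → 0 < (s • u + t • v) i := fun i h1 h2 =>
      convex_Ioi (0 : ℝ) h1 h2 hs ht hst
    exact ⟨key 0 hu.1 hv.1, key 1 hu.2.1 hv.2.1, key 2 hu.2.2 hv.2.2⟩
  have hm : ContinuousOn m D := by
    intro v hv
    have h1 : v 1 ≠ 0 := hv.2.1.ne'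
    have h2 : v 2 / v 1 ≠ 0 := (div_pos hv.2.2 hv.2.1).ne'
    have hc : ∀ i, ContinuousAt (fun x : Fin 3 → ℝ => x i) v := fun i =>
      (continuous_apply i).continuousAt
    refine ContinuousAt.continuousWithinAt (continuousAt_pi.2 fun i => ?_)
    fin_cases i
    · exact (((hc 2).add (hc 1)).mul (hHc.continuousAt.comp (((hc 2).div (hc 1) h1).log h2))).add
        (hc 0)
    · exact (hc 2).add (hc 1)
    · exact hc 2
  convert hD.image m hm using 1
  ext x
  constructor
  · rintro ⟨hx, hF⟩
    refine ⟨![coneFunction H x, x 1 - x 2, x 2], ⟨hF, sub_pos.2 hx.2.1, hx.2.2⟩, ?_⟩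
    funext i
    fin_cases i <;> simp [m, coneFunction]
  · rintro ⟨v, ⟨h0, h1, h2⟩, rfl⟩
    have := hHpos (Real.log (v 2 / v 1))
    refine ⟨⟨?_, ?_, ?_⟩, ?_⟩
    · simp only [m, Matrix.cons_val]; positivity
    · simpa [m] using h1
    · simpa [m] using h2
    · simpa [m, coneFunction] using h0

/-- Here the constraint x₀ > 0 matters as well, so x₀ is measured as a fraction of x₁H, and the
model is (0,1) times an open quadrant. -/
theorem isConnected_coneFunction_neg (hHc : Continuous H) (hHpos : ∀ σ, 0 < H σ) :
    IsConnected {x ∈ initialSet | coneFunction H x < 0} := by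
  let D : Set (Fin 3 → ℝ) := {v | v 0 ∈ Set.Ioo (0 : ℝ) 1 ∧ 0 < v 1 ∧ 0 < v 2}
  let m : (Fin 3 → ℝ) → Fin 3 → ℝ := fun v =>
    ![(v 2 + v 1) * H (Real.log (v 2 / v 1)) * v 0, v 2 + v 1, v 2]
  have hD : IsConnected D := by
    refine ⟨⟨fun _ => 1 / 2, by norm_num [D]⟩, Convex.isPreconnected ?_⟩
    intro u hu v hv s t hs ht hst
    have key : ∀ i, 0 < u i → 0 < v i → 0 < (s • u + t • v) i := fun i h1 h2 =>
      convex_Ioi (0 : ℝ) h1 h2 hs ht hst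
    exact ⟨convex_Ioo (0 : ℝ) 1 hu.1 hv.1 hs ht hst, key 1 hu.2.1 hv.2.1, key 2 hu.2.2 hv.2.2⟩
  have hm : ContinuousOn m D := by
    intro v hv
    have h1 : v 1 ≠ 0 := hv.2.1.ne'
    have h2 : v 2 / v 1 ≠ 0 := (div_pos hv.2.2 hv.2.1).ne'
    have hc : ∀ i, ContinuousAt (fun x : Fin 3 → ℝ => x i) v := fun i =>
      (continuous_apply i).continuousAt
    refine ContinuousAt.continuousWithinAt (continuousAt_pi.2 fun i => ?_)
    fin_cases i
    · exact (((hc 2).add (hc 1)).mul (hHc.continuousAt.comp (((hc 2).div (hc 1) h1).log h2))).mul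
        (hc 0)
    · exact (hc 2).add (hc 1)
    · exact hc 2
  convert hD.image m hm using 1
  ext x
  constructor
  · rintro ⟨hx, hF⟩
    have h1 := pos_of_mem_initialSet hx 1
    have hH := hHpos (Real.log (x 2 / (x 1 - x 2)))
    refine ⟨![x 0 / (x 1 * H (Real.log (x 2 / (x 1 - x 2)))), x 1 - x 2, x 2],
      ⟨⟨div_pos hx.1 (mul_pos h1 hH), (div_lt_one (mul_pos h1 hH)).2 (sub_neg.1 hF)⟩,
        sub_pos.2 hx.2.1, hx.2.2⟩, ?_⟩
    funext i
    fin_cases i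
    · simp [m]
      field_simp
    · simp [m]
    · simp [m]
  · rintro ⟨v, ⟨h0, h1, h2⟩, rfl⟩
    have hH := hHpos (Real.log (v 2 / v 1))
    have h00 := h0.1
    refine ⟨⟨?_, ?_, ?_⟩, ?_⟩
    · simp only [m, Matrix.cons_val]; positivity
    · simpa [m] using h1
    · simpa [m] using h2
    · have hpos : 0 < (v 2 + v 1) * H (Real.log (v 2 / v 1)) := by positivity
      simp [m, coneFunction]
      nlinarith [h0.2]

variable {f : Module.Basis (Fin 3) ℝ SL2Alg}

/-- The sign of `coneFunction H` decides the behavior. The converse inclusions hold because a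
maximal flow exists and the behaviors exclude each other. -/
theorem initialSetOf_eq (hf : IsMilnorFrame f) (hHc : Continuous H)
    (hH : ∀ σ, 1 ≤ H σ + Real.sigmoid σ ∧ H σ ≤ 1 ∧
      HasDerivAt H (-orbitSlope (Real.sigmoid σ) (H σ)) σ) :
    initialSetOf f (BackwardCase1 f) = {x ∈ initialSet | 0 < coneFunction H x} ∧
    initialSetOf f (BackwardCase2 f) = {x ∈ initialSet | coneFunction H x < 0} ∧
    {x ∈ initialSet | coneFunction H x = 0} ⊆ initialSetOf f (BackwardCase3 f) := by
  have hex : ∀ x ∈ initialSet, ∃ g I, IsMaximalFlowFrom f x g I := fun x hx =>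
    hf.exists_isMaximalFlowFrom (pos_of_mem_initialSet hx)
  have e1 : ∀ x ∈ initialSet, 0 < coneFunction H x → ∀ g I, IsMaximalFlowFrom f x g I →
      BackwardCase1 f x g I := by
    intro x hx h g I hg
    refine hg.backwardCase1 hf hx hHc hH ?_
    rw [lt_div_iff₀ (pos_of_mem_initialSet hx 1), mul_comm]
    exact sub_pos.1 h
  have e2 : ∀ x ∈ initialSet, coneFunction H x < 0 → ∀ g I, IsMaximalFlowFrom f x g I →
      BackwardCase2 f x g I := by
    intro x hx h g I hg
    refine hg.backwardCase2 hf hx hHc hH ?_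
    rw [div_lt_iff₀ (pos_of_mem_initialSet hx 1), mul_comm]
    exact sub_neg.1 h
  have e3 : ∀ x ∈ initialSet, coneFunction H x = 0 → ∀ g I, IsMaximalFlowFrom f x g I →
      BackwardCase3 f x g I := by
    intro x hx h g I hg
    refine hg.backwardCase3 hf hx hHc hH ?_
    rw [div_eq_iff (pos_of_mem_initialSet hx 1).ne', mul_comm]
    exact sub_eq_zero.1 h
  refine ⟨Set.Subset.antisymm ?_ ?_, Set.Subset.antisymm ?_ ?_, ?_⟩
  · rintro x ⟨hx, ⟨g, I, hg⟩, h⟩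
    refine ⟨hx, ?_⟩
    rcases lt_trichotomy (coneFunction H x) 0 with h0 | h0 | h0
    · exact (not_backwardCase1_and_backwardCase2 hx (h g I hg) (e2 x hx h0 g I hg)).elim
    · exact (not_backwardCase1_and_backwardCase3 hx (h g I hg) (e3 x hx h0 g I hg)).elim
    · exact h0
  · rintro x ⟨hx, h⟩
    exact ⟨hx, hex x hx, e1 x hx h⟩
  · rintro x ⟨hx, ⟨g, I, hg⟩, h⟩
    refine ⟨hx, ?_⟩
    rcases lt_trichotomy (coneFunction H x) 0 with h0 | h0 | h0
    · exact h0
    · exact (not_backwardCase2_and_backwardCase3 hx (h g I hg) (e3 x hx h0 g I hg)).elim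
    · exact (not_backwardCase1_and_backwardCase2 hx (e1 x hx h0 g I hg) (h g I hg)).elim
  · rintro x ⟨hx, h⟩
    exact ⟨hx, hex x hx, e2 x hx h⟩
  · rintro x ⟨hx, h⟩
    exact ⟨hx, hex x hx, e3 x hx h⟩

end Partition

end

theorem theorem2p3 (f : Module.Basis (Fin 3) ℝ SL2Alg) (hf : IsMilnorFrame f) :
    (∀ x ∈ initialSet, ∀ g I, IsMaximalFlowFrom f x g I →
      ∀ t ∈ I, ∀ i j, i ≠ j → (g t).form (f i) (f j) = 0) ∧
    (∃ Q₀ : Set (Fin 3 → ℝ), Q₀ ⊆ initialSet ∧ IsOpen Q₀ ∧ initialSet ⊆ closure Q₀ ∧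
      ∀ x ∈ Q₀, ∀ g I, IsMaximalFlowFrom f x g I →
        BackwardCase1 f x g I ∨ BackwardCase2 f x g I) ∧
    (∃ S₀ : Set (Fin 3 → ℝ), S₀ ⊆ initialSet ∧ IsSmoothEmbeddedHypersurface S₀ ∧
      (∀ r : ℝ, 0 < r → ∀ x ∈ S₀, r • x ∈ S₀) ∧
      IsOpen (initialSetOf f (BackwardCase1 f)) ∧ IsOpen (initialSetOf f (BackwardCase2 f)) ∧
      AreTheTwoComponents (initialSet \ S₀)
        (initialSetOf f (BackwardCase1 f)) (initialSetOf f (BackwardCase2 f)) ∧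
      S₀ ⊆ initialSetOf f (BackwardCase3 f)) := by
  obtain ⟨H, hHs, hH⟩ := exists_separatrix
  have hHc := hHs.continuous
  have hHpos : ∀ σ, 0 < H σ := fun σ => by linarith [(hH σ).1, Real.sigmoid_lt_one σ]
  obtain ⟨e1, e2, e3⟩ := initialSetOf_eq hf hHc hH
  have hcont := (contDiffOn_coneFunction hHs).continuousOn
  have ho1 : IsOpen {x ∈ initialSet | 0 < coneFunction H x} :=
    hcont.isOpen_inter_preimage isOpen_initialSet isOpen_Ioi
  have ho2 : IsOpen {x ∈ initialSet | coneFunction H x < 0} :=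
    hcont.isOpen_inter_preimage isOpen_initialSet isOpen_Iio
  refine ⟨fun x hx g I hg t ht i j hij => hg.gram_offDiag hf ht hij,
    ⟨initialSetOf f (BackwardCase1 f) ∪ initialSetOf f (BackwardCase2 f), ?_, ?_, ?_, ?_⟩,
    ⟨{x ∈ initialSet | coneFunction H x = 0}, fun x hx => hx.1, ?_, ?_, ?_, ?_, ?_, e3⟩⟩
  · exact Set.union_subset (fun x hx => hx.1) fun x hx => hx.1
  · rw [e1, e2]
    exact ho1.union ho2
  · intro x hx
    rw [e1, e2]
    by_cases h0 : coneFunction H x = 0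
    -- A point of the hypersurface is a limit of points of Q₁: a slight increase of the first
    -- coordinate makes `coneFunction` positive.
    · have hlim : Tendsto (fun s : ℝ => x + s • (Pi.single 0 1 : Fin 3 → ℝ)) (𝓝[>] 0) (𝓝 x) := by
        have : Continuous fun s : ℝ => x + s • (Pi.single 0 1 : Fin 3 → ℝ) := by fun_prop
        have := this.tendsto 0
        rw [zero_smul, add_zero] at this
        exact this.mono_left nhdsWithin_le_nhds
      refine mem_closure_of_tendsto hlim ?_
      filter_upwards [hlim.eventually_mem (isOpen_initialSet.mem_nhds hx), self_mem_nhdsWithin]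
        with s hs hs0
      refine Or.inl ⟨hs, ?_⟩
      rw [coneFunction_add_single, h0, zero_add]
      exact hs0
    · refine subset_closure ?_
      rcases lt_or_gt_of_ne h0 with h | h
      · exact Or.inr ⟨hx, h⟩
      · exact Or.inl ⟨hx, h⟩
  · rintro x (hx | hx) g I hg
    · exact Or.inl (hx.2.2 g I hg)
    · exact Or.inr (hx.2.2 g I hg)
  · intro p hp
    refine ⟨initialSet, isOpen_initialSet, hp.1, coneFunction H, contDiffOn_coneFunction hHs,
      fun x hx => fderiv_coneFunction_ne_zero hHs hx, ?_⟩
    exact Set.inter_eq_left.2 fun x hx => hx.1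
  · rintro r hr x ⟨hx, h0⟩
    exact ⟨smul_mem_initialSet hr hx, by rw [coneFunction_smul hr, h0, mul_zero]⟩
  · rw [e1]
    exact ho1
  · rw [e2]
    exact ho2
  · rw [e1, e2]
    refine areTheTwoComponents_of_isOpen ?_ ho1 ho2 ?_ (isConnected_coneFunction_pos hHc hHpos)
      (isConnected_coneFunction_neg hHc hHpos)
    · ext x
      constructor
      · rintro ⟨hx, h0⟩
        rcases lt_trichotomy (coneFunction H x) 0 with h | h | h
        · exact Or.inr ⟨hx, h⟩
        · exact (h0 ⟨hx, h⟩).elim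
        · exact Or.inl ⟨hx, h⟩
      · rintro (⟨hx, h⟩ | ⟨hx, h⟩)
        · exact ⟨hx, fun h0 => h.ne' h0.2⟩
        · exact ⟨hx, fun h0 => h.ne h0.2⟩
    · exact Set.disjoint_left.2 fun x h1 h2 => lt_asymm h1.2 h2.2
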